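/- Let $\lambda>0$, $\mu>1$, $c>0$ and $m\in(-1,1)$ be constants, and let $N=\{N_t;t\ge 0\}$ be a homogeneous Poisson process with rate $\mu$ on a probability space $(\Omega,\mathcal H,\mathbb P_0)$, with jump times $0=\sigma_0<\sigma_1<\sigma_2<\cdots$. Let $\mathbb F$ be the natural filtration of $N$, enlarged with the $\mathbb P_0$-null sets and made right-continuous, and let $\mathcal S$ be the collection of all $\mathbb F$-stopping times with values in $[0,\infty]$. For $(\phi_0,\phi_1)\in\mathbb R_+^2=[0,\infty)^2$ let $\tilde\Phi=(\tilde\Phi^{(0)},\tilde\Phi^{(1)})$ be the piecewise-deterministic process started at $\tilde\Phi_0=(\phi_0,\phi_1)$ with $$d\tilde\Phi^{(0)}_t=\Big[(\lambda+1)\tilde\Phi^{(0)}_t+\tfrac{\lambda(1-m)}{\sqrt2}\Big]dt-\tfrac1\mu\tilde\Phi^{(0)}_{t-}\,dN_t,\qquad d\tilde\Phi^{(1)}_t=\Big[(\lambda-1)\tilde\Phi^{(1)}_t+\tfrac{\lambda(1+m)}{\sqrt2}\Big]dt+\tfrac1\mu\tilde\Phi^{(1)}_{t-}\,dN_t,$$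 and write $\mathbb E_0^{\phi_0,\phi_1}$ for the $\mathbb P_0$-expectation when $\tilde\Phi$ starts at $(\phi_0,\phi_1)$. Let $g(\phi_0,\phi_1)=\phi_0+\phi_1-\frac{\lambda}{c}\sqrt2$, and let $$V(\phi_0,\phi_1)=\inf_{\tau\in\mathcal S}\mathbb E_0^{\phi_0,\phi_1}\Big[\int_0^\tau e^{-\lambda t}g(\tilde\Phi_t)\,dt\Big]$$ be the value function of the optimal stopping problem. For a Borel function $w:\mathbb R_+^2\to[-\infty,\infty)$ that is bounded above (in particular, for a bounded Borel function) let $$Jw(t,\phi_0,\phi_1)=\mathbb E_0^{\phi_0,\phi_1}\Big[\int_0^{t\wedge\sigma_1}e^{-\lambda u}g(\tilde\Phi_u)\,du+\mathbf 1_{\{t\ge\sigma_1\}}e^{-\lambda\sigma_1}w(\tilde\Phi_{\sigma_1})\Big],\quad t\in[0,\infty],\qquad J_0w(\phi_0,\phi_1)=\inf_{t\in[0,\infty]}Jw(t,\phi_0,\phi_1),$$ and let $v_0\equiv0$ and $v_n=J_0v_{n-1}$ for $n\ge1$. Then, for every $(\phi_0,\phi_1)\in\mathbb R_+^2$, the limit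 $v(\phi_0,\phi_1)=\lim_{n\to\infty}v_n(\phi_0,\phi_1)$ exists and equals $V(\phi_0,\phi_1)$. Moreover, $V$ is Borel with $-\sqrt2/c\le V\le0$, it satisfies $V=J_0V$ on $\mathbb R_+^2$, and it is the largest nonpositive solution of this equation: every Borel function $U:\mathbb R_+^2\to[-\infty,0]$ with $U=J_0U$ on $\mathbb R_+^2$ satisfies $U\le V$ on $\mathbb R_+^2$. -/

import Mathlib

open MeasureTheory ProbabilityTheory Filter Topology
open scoped NNReal ENNReal

noncomputable section

namespace PoissonDisorder

/-- The extended-real integral `∫ f dμ = ∫ f⁺ dμ - ∫ f⁻ dμ`, the usual meaning of the integral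
(or expectation) of a function one of whose two parts has a finite integral. -/
def extIntegral {α : Type*} [MeasurableSpace α] (μ : Measure α) (f : α → EReal) : EReal :=
  ((∫⁻ a, (f a).toENNReal ∂μ : ℝ≥0∞) : EReal) - ((∫⁻ a, (-f a).toENNReal ∂μ : ℝ≥0∞) : EReal)

/-- Homogeneous Poisson process with rate `rate`: a counting process with independent increments
and `N t - N s ∼ Poisson (rate * (t - s))`. The natural-number subtraction is harmless since the
paths are nondecreasing. -/
structure IsPoissonProcess {Ω : Type*} [MeasurableSpace Ω] (N : ℝ≥0 → Ω → ℕ) (rate : ℝ)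
    (P : Measure Ω) : Prop where
  measurable : ∀ t, Measurable (N t)
  zero : ∀ ω, N 0 ω = 0
  mono : ∀ ω, Monotone fun t => N t ω
  rightCont : ∀ ω t, ContinuousWithinAt (fun s => N s ω) (Set.Ici t) t
  indep : HasIndepIncrements N P
  law : ∀ s t : ℝ≥0, s ≤ t →
    P.map (fun ω => N t ω - N s ω) = poissonMeasure (rate * ((t : ℝ) - s)).toNNReal

/-- The history of `N`: the natural filtration, enlarged with the null sets and made
right-continuous. -/
def history {Ω : Type*} [mΩ : MeasurableSpace Ω] (P : Measure Ω) (N : ℝ≥0 → Ω → ℕ)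
    (hN : ∀ t, Measurable (N t)) : Filtration ℝ≥0 mΩ :=
  Filtration.rightCont
    { seq := fun t => Filtration.natural N (fun s => (hN s).stronglyMeasurable) t ⊔
        MeasurableSpace.generateFrom {A : Set Ω | MeasurableSet A ∧ P A = 0}
      mono' := fun _ _ hst => sup_le_sup_right (Filtration.mono _ hst) _
      le' := fun t => sup_le (Filtration.le _ t)
        (MeasurableSpace.generateFrom_le fun _ hA => hA.1) }

/-- The time `σ n` of the `n`-th jump of `N` (with `σ 0 = 0`, and `⊤` if there is no such jump). -/
def jumpTime {Ω : Type*} (N : ℝ≥0 → Ω → ℕ) (n : ℕ) (ω : Ω) : ℝ≥0∞ :=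
  ⨅ (t : ℝ≥0) (_ : n ≤ N t ω), (t : ℝ≥0∞)

/-- The parameters: the rate `lam` of the disorder time, the pre-disorder rate `mu`, the cost `c`
of the detection delay, and the mean `m` of the change of the rate. -/
structure Params where
  lam : ℝ
  mu : ℝ
  c : ℝ
  m : ℝ

/-- The state space `ℝ₊²`. -/
def quadrant : Set (ℝ × ℝ) := {φ | 0 ≤ φ.1 ∧ 0 ≤ φ.2}

namespace Params

variable (p : Params)

/-- The solution of `x' = (lam + 1) x + lam (1 - m) / √2`, `x 0 = φ₀`. -/
def x (t φ₀ : ℝ) : ℝ :=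
  -(p.lam * (1 - p.m) / (√2 * (p.lam + 1))) +
    Real.exp ((p.lam + 1) * t) * (φ₀ + p.lam * (1 - p.m) / (√2 * (p.lam + 1)))

/-- The solution of `y' = (lam - 1) y + lam (1 + m) / √2`, `y 0 = φ₁`. -/
def y (t φ₁ : ℝ) : ℝ :=
  if p.lam = 1 then φ₁ + (1 + p.m) / √2 * t
  else -(p.lam * (1 + p.m) / (√2 * (p.lam - 1))) +
    Real.exp ((p.lam - 1) * t) * (φ₁ + p.lam * (1 + p.m) / (√2 * (p.lam - 1)))

/-- The motion of the sufficient statistic between jumps. -/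
def flow (t : ℝ) (φ : ℝ × ℝ) : ℝ × ℝ := (p.x t φ.1, p.y t φ.2)

/-- The displacement of the sufficient statistic at a jump of `N`. -/
def jump (φ : ℝ × ℝ) : ℝ × ℝ := ((1 - 1 / p.mu) * φ.1, (1 + 1 / p.mu) * φ.2)

/-- The running cost rate. -/
def g (φ : ℝ × ℝ) : ℝ := φ.1 + φ.2 - p.lam / p.c * √2

variable {Ω : Type*} (N : ℝ≥0 → Ω → ℕ)

/-- The sufficient statistic started at `φ`, evaluated at the jump time `σ n`. -/
def postJump (φ : ℝ × ℝ) : ℕ → Ω → ℝ × ℝ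
  | 0, _ => φ
  | n + 1, ω => p.jump
      (p.flow ((jumpTime N (n + 1) ω).toReal - (jumpTime N n ω).toReal) (postJump φ n ω))

/-- The sufficient statistic `Φ` started at `φ`, that is, the piecewise-deterministic process with
`dΦ⁰ = ((lam + 1) Φ⁰ + lam (1 - m) / √2) dt - (1 / mu) Φ⁰₋ dN`,
`dΦ¹ = ((lam - 1) Φ¹ + lam (1 + m) / √2) dt + (1 / mu) Φ¹₋ dN`. -/
def statistic (φ : ℝ × ℝ) (t : ℝ≥0) (ω : Ω) : ℝ × ℝ :=
  p.flow ((t : ℝ) - (jumpTime N (N t ω) ω).toReal) (p.postJump N φ (N t ω) ω)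

/-- The discounted running cost `∫₀ᵀ e^{-lam t} g(Φ_t) dt`, an element of `(-∞, ∞]`;
`T = ⊤` is allowed. -/
def runningCost (φ : ℝ × ℝ) (T : ℝ≥0∞) (ω : Ω) : EReal :=
  extIntegral (volume.restrict {t : ℝ | 0 ≤ t ∧ ENNReal.ofReal t < T})
    fun t => ((Real.exp (-p.lam * t) * p.g (p.statistic N φ t.toNNReal ω) : ℝ) : EReal)

variable [MeasurableSpace Ω] (P : Measure Ω)

/-- The value function `V` of the optimal stopping problem: the infimum of the expected discounted
running cost over all stopping times (possibly infinite) of the history of `N`. -/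
def value (hN : ∀ t, Measurable (N t)) (φ : ℝ × ℝ) : EReal :=
  ⨅ (τ : Ω → ℝ≥0∞) (_ : IsStoppingTime (history P N hN) τ),
    extIntegral P fun ω => p.runningCost N φ (τ ω) ω

/-- The single-jump operator
`J w (T, φ) = E [∫₀^{T ∧ σ₁} e^{-lam t} g(Φ_t) dt + 1_{T ≥ σ₁} e^{-lam σ₁} w(Φ_{σ₁})]`,
where `e^{-∞} = 0`. -/
def J (w : ℝ × ℝ → EReal) (T : ℝ≥0∞) (φ : ℝ × ℝ) : EReal :=
  extIntegral P fun ω =>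
    p.runningCost N φ (min T (jumpTime N 1 ω)) ω +
      if jumpTime N 1 ω ≤ T ∧ jumpTime N 1 ω < ⊤ then
        ((Real.exp (-p.lam * (jumpTime N 1 ω).toReal) : ℝ) : EReal) *
          w (p.statistic N φ (jumpTime N 1 ω).toNNReal ω)
      else 0

/-- The operator `J₀ w (φ) = inf_{T ∈ [0, ∞]} J w (T, φ)`. -/
def J₀ (w : ℝ × ℝ → EReal) (φ : ℝ × ℝ) : EReal := ⨅ T : ℝ≥0∞, p.J N P w T φ

/-- The successive approximations `v 0 = 0`, `v n = J₀ (v (n - 1))`. -/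
def v : ℕ → ℝ × ℝ → EReal
  | 0 => fun _ => 0
  | n + 1 => p.J₀ N P (v n)

/-- `U` is a nonpositive Borel solution of `U = J₀ U` on `ℝ₊²`. -/
def IsNonposSolution (U : ℝ × ℝ → EReal) : Prop :=
  Measurable (fun φ : quadrant => U φ) ∧ (∀ φ ∈ quadrant, U φ ≤ 0) ∧
    ∀ φ ∈ quadrant, U φ = p.J₀ N P U φ

end Params

end PoissonDisorder

end

/-! ### Deterministic motion between jumps: explicit flow, invariance of the quadrant, growth. -/

noncomputable section

namespace PoissonDisorder

/-! Between jumps the statistic follows a deterministic flow, and the first jump time is exponential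
with rate `mu`. Integrating that time out turns the single-jump operator into a deterministic
integral (`J_eq_op`): the horizon `T` costs the integral over `[0, T)` of `e^{-(lam + mu) t} (g + mu
* (w ∘ jump))` along the flow. The flow grows at most like `e^{(lam + 1) t}`, so the integrand is of
order `e^{-(mu - 1) t}` (`abs_opIntegrand_le`), which is integrable up to `T = ⊤`, and the bounds
`-√2 / c ≤ w ≤ 0` are preserved (`isCandidate_opInf`). Rational horizons suffice for the infimum,
whence Borel measurability. Started from `0`, the monotone operator produces a decreasing sequence,
whose limit is a fixed point by dominated convergence (`limitValue_eq_opInf`). A nonpositive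
solution lies below `v 0 = 0`, hence by monotonicity below every `v n` and below the limit
(`le_v_of_isNonposSolution`).

It remains to identify this fixed point `w` with the value function, which is done by discretizing
time. The semigroup property of the flow turns `w = J₀ w` into dynamic programming over a step `h`:
`w` is at most the value of continuing for `h` (`le_continuation`), with equality wherever `w <
-(lam + mu) * bound * h`, because no horizon shorter than `h` can earn that much
(`eq_continuation`). The same two facts make `w` Lipschitz along the flow, so what happens after the
first jump inside a step hardly matters. With the Markov property of the Poisson process at a fixed
time, the cost of a step plus the discounted `w` at its end therefore has the same mean, on every
event of the past, as the discounted continuation value, up to `O(h²)`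
(`abs_setIntegral_step_sub_le`).

Over a fixed time span these errors add up to `O(h)`. Telescoping over the grid shows that every
stopping time, rounded to the grid, costs at least `w φ` in the limit (`le_integral_gridCost`), and
that continuing as long as `w` is below the threshold costs at most `w φ` in the limit
(`integral_gridCost_le`). The mesh goes to `0` first; then the time span goes to infinity, where
discounting removes the remainder (`value_eq_limitValue`). -/

/-- The standing assumptions on the parameters. -/
structure Params.Admissible (p : Params) : Prop where
  lam_pos : 0 < p.lam
  one_lt_mu : 1 < p.mu
  c_pos : 0 < p.c
  neg_one_lt_m : -1 < p.m
  m_lt_one : p.m < 1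

/-- The primitive `∫₀ᵗ e^{as} ds` of the exponential. -/
def expPrimitive (a t : ℝ) : ℝ := ∫ s in (0 : ℝ)..t, Real.exp (a * s)

lemma expPrimitive_of_ne_zero {a : ℝ} (ha : a ≠ 0) (t : ℝ) :
    expPrimitive a t = (Real.exp (a * t) - 1) / a := by
  unfold expPrimitive
  rw [intervalIntegral.integral_comp_mul_left (fun s => Real.exp s) ha]
  simp
  field_simp

lemma expPrimitive_zero_left (t : ℝ) : expPrimitive 0 t = t := by
  simp [expPrimitive]

lemma expPrimitive_nonneg (a : ℝ) {t : ℝ} (ht : 0 ≤ t) : 0 ≤ expPrimitive a t :=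
  intervalIntegral.integral_nonneg ht fun _ _ => (Real.exp_pos _).le

lemma expPrimitive_mono {a b t : ℝ} (hab : a ≤ b) (ht : 0 ≤ t) :
    expPrimitive a t ≤ expPrimitive b t := by
  refine intervalIntegral.integral_mono_on ht (Continuous.intervalIntegrable (by fun_prop) _ _)
    (Continuous.intervalIntegrable (by fun_prop) _ _) fun s hs => ?_
  exact Real.exp_le_exp.2 (mul_le_mul_of_nonneg_right hab hs.1)

namespace Params

variable {p : Params}

lemma x_eq (hp : p.Admissible) (t φ₀ : ℝ) :
    p.x t φ₀ = Real.exp ((p.lam + 1) * t) * φ₀ +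
      p.lam * (1 - p.m) / √2 * expPrimitive (p.lam + 1) t := by
  have h1 : p.lam + 1 ≠ 0 := by linarith [hp.lam_pos]
  have h2 : √(2 : ℝ) ≠ 0 := by positivity
  rw [x, expPrimitive_of_ne_zero h1]
  field_simp
  ring

/-- The primitive of the exponential absorbs the exceptional value `lam = 1`, so that sign and
growth estimates need no case distinction. -/
lemma y_eq (t φ₁ : ℝ) :
    p.y t φ₁ = Real.exp ((p.lam - 1) * t) * φ₁ +
      p.lam * (1 + p.m) / √2 * expPrimitive (p.lam - 1) t := by
  have h2 : √(2 : ℝ) ≠ 0 := by positivity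
  unfold y
  split_ifs with h
  · simp [h, expPrimitive_zero_left]
  · have h1 : p.lam - 1 ≠ 0 := sub_ne_zero.2 h
    rw [expPrimitive_of_ne_zero h1]
    field_simp
    ring

lemma flow_zero (φ : ℝ × ℝ) : p.flow 0 φ = φ := by
  ext <;> simp [flow, x, y]

lemma flow_add (s t : ℝ) (φ : ℝ × ℝ) : p.flow (s + t) φ = p.flow t (p.flow s φ) := by
  ext
  · simp only [flow, x, mul_add, Real.exp_add]
    ring
  · simp only [flow, y]
    split_ifs
    · ring
    · simp only [mul_add, Real.exp_add]
      ring

lemma continuous_flow : Continuous fun q : ℝ × ℝ × ℝ => p.flow q.1 q.2 := by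
  unfold flow x y
  refine Continuous.prodMk (by fun_prop) ?_
  split_ifs <;> fun_prop

lemma measurable_flow : Measurable fun q : ℝ × ℝ × ℝ => p.flow q.1 q.2 :=
  continuous_flow.measurable

lemma measurable_jump : Measurable p.jump := by
  unfold jump
  fun_prop

lemma measurable_g : Measurable p.g := by
  unfold g
  fun_prop

lemma flow_mem (hp : p.Admissible) {t : ℝ} (ht : 0 ≤ t) {φ : ℝ × ℝ} (hφ : φ ∈ quadrant) :
    p.flow t φ ∈ quadrant := by
  have h1 := hp.lam_pos
  have h2 := hp.m_lt_one
  have h3 := hp.neg_one_lt_m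
  have h4 : 0 ≤ 1 - p.m := by linarith
  have h5 : 0 ≤ 1 + p.m := by linarith
  have e1 := expPrimitive_nonneg (p.lam + 1) ht
  have e2 := expPrimitive_nonneg (p.lam - 1) ht
  obtain ⟨ha, hb⟩ := hφ
  constructor
  · simp only [flow, x_eq hp]
    positivity
  · simp only [flow, y_eq]
    positivity

lemma jump_mem (hp : p.Admissible) {φ : ℝ × ℝ} (hφ : φ ∈ quadrant) : p.jump φ ∈ quadrant := by
  have h : 1 / p.mu ≤ 1 := (div_le_one (by linarith [hp.one_lt_mu])).2 hp.one_lt_mu.le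
  have h0 : 0 ≤ 1 / p.mu := by have := hp.one_lt_mu; positivity
  exact ⟨mul_nonneg (by linarith) hφ.1, mul_nonneg (by linarith) hφ.2⟩

/-- The function `1 + √2 + φ₀ + φ₁`, which controls the growth of the sufficient statistic. -/
def size (φ : ℝ × ℝ) : ℝ := 1 + √2 + φ.1 + φ.2

lemma measurable_size : Measurable size := by
  unfold size
  fun_prop

lemma one_le_size {φ : ℝ × ℝ} (hφ : φ ∈ quadrant) : 1 ≤ size φ := by
  have := Real.sqrt_nonneg 2
  unfold size
  linarith [hφ.1, hφ.2]

lemma size_pos {φ : ℝ × ℝ} (hφ : φ ∈ quadrant) : 0 < size φ :=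
  zero_lt_one.trans_le (one_le_size hφ)

/-- The two drift terms add up to `√2 * lam`, and the summand `√2` of `size` is what absorbs the
inhomogeneous part of the solution. The summand `1` only serves to have `1 ≤ size`. -/
lemma size_flow_le (hp : p.Admissible) {t : ℝ} (ht : 0 ≤ t) {φ : ℝ × ℝ} (hφ : φ ∈ quadrant) :
    size (p.flow t φ) ≤ Real.exp ((p.lam + 1) * t) * size φ := by
  have h1 := hp.lam_pos
  have h3 := hp.neg_one_lt_m
  have hl : p.lam + 1 ≠ 0 := by linarith
  have h5 : 0 ≤ p.lam * (1 + p.m) / √2 :=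
    div_nonneg (mul_nonneg h1.le (by linarith)) (Real.sqrt_nonneg 2)
  have e2 := expPrimitive_mono (show p.lam - 1 ≤ p.lam + 1 by linarith) ht
  have e3 : Real.exp ((p.lam - 1) * t) ≤ Real.exp ((p.lam + 1) * t) :=
    Real.exp_le_exp.2 (mul_le_mul_of_nonneg_right (by linarith) ht)
  have e4 : 1 ≤ Real.exp ((p.lam + 1) * t) := Real.one_le_exp (by positivity)
  have e5 : p.lam * (1 - p.m) / √2 * expPrimitive (p.lam + 1) t +
      p.lam * (1 + p.m) / √2 * expPrimitive (p.lam + 1) t =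
      √2 * (p.lam / (p.lam + 1)) * (Real.exp ((p.lam + 1) * t) - 1) := by
    rw [expPrimitive_of_ne_zero hl]
    have h2 : √(2 : ℝ) ≠ 0 := by positivity
    field_simp
    rw [Real.sq_sqrt zero_le_two]
    ring
  have e6 : p.lam / (p.lam + 1) ≤ 1 := (div_le_one (by linarith)).2 (by linarith)
  have e7 : √2 * (p.lam / (p.lam + 1)) * (Real.exp ((p.lam + 1) * t) - 1) ≤
      √2 * (Real.exp ((p.lam + 1) * t) - 1) :=
    mul_le_mul_of_nonneg_right (mul_le_of_le_one_right (Real.sqrt_nonneg 2) e6) (by linarith)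
  have e8 := mul_le_mul_of_nonneg_left e2 h5
  have e9 := mul_le_mul_of_nonneg_right e3 hφ.2
  simp only [size, flow, x_eq hp, y_eq]
  nlinarith

lemma size_jump_le (hp : p.Admissible) {φ : ℝ × ℝ} (hφ : φ ∈ quadrant) :
    size (p.jump φ) ≤ 2 * size φ := by
  have h : 1 / p.mu ≤ 1 := (div_le_one (by linarith [hp.one_lt_mu])).2 hp.one_lt_mu.le
  have h0 : 0 ≤ 1 / p.mu := by have := hp.one_lt_mu; positivity
  have h2 := mul_le_mul_of_nonneg_right h hφ.2
  have h3 := mul_nonneg h0 hφ.1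
  have := Real.sqrt_nonneg 2
  have := hφ.1
  simp only [size, jump]
  nlinarith

/-- The bound `√2 / c` of the value function. -/
def bound (p : Params) : ℝ := √2 / p.c

lemma bound_pos (hp : p.Admissible) : 0 < p.bound := by
  have := hp.c_pos
  unfold bound
  positivity

lemma neg_le_g {φ : ℝ × ℝ} (hφ : φ ∈ quadrant) : -(p.lam * p.bound) ≤ p.g φ := by
  have : p.lam * p.bound = p.lam / p.c * √2 := by unfold bound; ring
  unfold g
  linarith [hφ.1, hφ.2]

/-- The constant in the bound of the running cost rate by the size. -/
def gConst (p : Params) : ℝ := 1 + p.lam * p.bound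

lemma gConst_pos (hp : p.Admissible) : 0 < p.gConst := by
  have := hp.lam_pos
  have := bound_pos hp
  unfold gConst
  positivity

lemma g_le_size (hp : p.Admissible) (φ : ℝ × ℝ) : p.g φ ≤ size φ := by
  have : p.lam * p.bound = p.lam / p.c * √2 := by unfold bound; ring
  have h1 := mul_pos hp.lam_pos (bound_pos hp)
  have := Real.sqrt_nonneg 2
  unfold g size
  linarith

lemma abs_g_le (hp : p.Admissible) {φ : ℝ × ℝ} (hφ : φ ∈ quadrant) :
    |p.g φ| ≤ p.gConst * size φ := by
  have h := mul_pos hp.lam_pos (bound_pos hp)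
  have h1 := one_le_size hφ
  have h2 := neg_le_g (p := p) hφ
  have h3 := g_le_size hp φ
  unfold gConst
  rw [abs_le]
  constructor <;> nlinarith

end Params

end PoissonDisorder

end

/-! ### The single-jump operator in deterministic form, and its iteration from zero. -/

noncomputable section

namespace PoissonDisorder

/-- The set of times in `[0, T)`. -/
def horizon (T : ℝ≥0∞) : Set ℝ := {t : ℝ | 0 ≤ t ∧ ENNReal.ofReal t < T}

lemma measurableSet_horizon (T : ℝ≥0∞) : MeasurableSet (horizon T) :=
  measurableSet_Ici.inter (ENNReal.measurable_ofReal measurableSet_Iio)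

lemma horizon_subset_Ici (T : ℝ≥0∞) : horizon T ⊆ Set.Ici 0 := fun _ ht => ht.1

lemma horizon_mono {S T : ℝ≥0∞} (h : S ≤ T) : horizon S ⊆ horizon T :=
  fun _ ht => ⟨ht.1, ht.2.trans_le h⟩

lemma horizon_ofReal (h : ℝ) : horizon (ENNReal.ofReal h) = Set.Ico 0 h := by
  ext t
  simp only [horizon, Set.mem_ofPred_eq, Set.mem_Ico]
  exact and_congr_right fun ht => ENNReal.ofReal_lt_ofReal_iff_of_nonneg ht

lemma horizon_zero : horizon 0 = ∅ := by
  simp [horizon]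

lemma ofReal_nnratCast (q : ℚ≥0) : ENNReal.ofReal (q : ℝ) = ((q : ℝ≥0) : ℝ≥0∞) := by
  rw [show (q : ℝ) = ((q : ℝ≥0) : ℝ) from rfl, ENNReal.ofReal_coe_nnreal]

/-- Every horizon, `⊤` included, is exhausted from below by rational ones; this reduces the infimum
over horizons to a countable, hence measurable, one. -/
lemma horizon_eq_iUnion (T : ℝ≥0∞) :
    horizon T = ⋃ q : {q : ℚ≥0 // ((q : ℝ≥0) : ℝ≥0∞) ≤ T}, horizon ((q : ℚ≥0) : ℝ≥0) := by
  refine Set.Subset.antisymm (fun t ht => ?_) (Set.iUnion_subset fun q => horizon_mono q.2)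
  obtain ⟨q, hq0, hq1, hq2⟩ := ENNReal.lt_iff_exists_rat_btwn.1 ht.2
  lift q to ℚ≥0 using hq0
  have h : (((q : ℚ) : ℝ).toNNReal : ℝ≥0∞) = ((q : ℝ≥0) : ℝ≥0∞) := ofReal_nnratCast q
  rw [h] at hq1 hq2
  exact Set.mem_iUnion.2 ⟨⟨q, hq2.le⟩, ht.1, hq1⟩

namespace Params

/-- The integrand of the deterministic form of the single-jump operator. -/
def opIntegrand (p : Params) (w : ℝ × ℝ → ℝ) (φ : ℝ × ℝ) (t : ℝ) : ℝ :=
  Real.exp (-(p.lam + p.mu) * t) * (p.g (p.flow t φ) + p.mu * w (p.jump (p.flow t φ)))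

/-- The deterministic form of the single-jump operator. -/
def op (p : Params) (w : ℝ × ℝ → ℝ) (T : ℝ≥0∞) (φ : ℝ × ℝ) : ℝ :=
  ∫ t in horizon T, p.opIntegrand w φ t

/-- The infimum of `op` over all horizons, expressed by rational horizons. -/
def opInf (p : Params) (w : ℝ × ℝ → ℝ) (φ : ℝ × ℝ) : ℝ :=
  ⨅ q : ℚ≥0, p.op w ((q : ℝ≥0) : ℝ≥0∞) φ

/-- Borel functions with the bounds of the value function on the quadrant. -/
structure IsCandidate (p : Params) (w : ℝ × ℝ → ℝ) : Prop where
  measurable : Measurable w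
  nonpos : ∀ φ ∈ quadrant, w φ ≤ 0
  neg_bound_le : ∀ φ ∈ quadrant, -p.bound ≤ w φ

variable {p : Params} {w w' : ℝ × ℝ → ℝ} {φ : ℝ × ℝ}

lemma isCandidate_zero (hp : p.Admissible) : p.IsCandidate fun _ => 0 :=
  ⟨measurable_const, fun _ _ => le_rfl, fun _ _ => by linarith [bound_pos hp]⟩

lemma measurable_opIntegrand (hw : Measurable w) :
    Measurable fun q : (ℝ × ℝ) × ℝ => p.opIntegrand w q.1 q.2 := by
  have h : Measurable fun q : (ℝ × ℝ) × ℝ => p.flow q.2 q.1 :=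
    measurable_flow.comp (measurable_snd.prodMk measurable_fst)
  exact ((measurable_snd.const_mul _).exp).mul
    ((measurable_g.comp h).add ((hw.comp (measurable_jump.comp h)).const_mul _))

lemma measurable_op (hw : Measurable w) (T : ℝ≥0∞) : Measurable (p.op w T) :=
  ((measurable_opIntegrand hw).stronglyMeasurable.integral_prod_right
    (ν := volume.restrict (horizon T))).measurable

lemma measurable_opInf (hw : Measurable w) : Measurable (p.opInf w) :=
  Measurable.iInf fun q : ℚ≥0 => measurable_op hw ((q : ℝ≥0) : ℝ≥0∞)

lemma exp_mul_exp_flow (t : ℝ) :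
    Real.exp (-(p.lam + p.mu) * t) * Real.exp ((p.lam + 1) * t) =
      Real.exp (-(p.mu - 1) * t) := by
  rw [← Real.exp_add]
  ring_nf

/-- Discount and survival contribute `e^{-(lam + mu) t}`, the growth of the state `e^{(lam + 1) t}`;
the surviving rate `mu - 1` is positive because `1 < mu`. This is the dominating function for every
horizon and every candidate. -/
lemma abs_opIntegrand_le (hp : p.Admissible) (hw : p.IsCandidate w) (hφ : φ ∈ quadrant) {t : ℝ}
    (ht : 0 ≤ t) : |p.opIntegrand w φ t| ≤
      (p.gConst + p.mu * p.bound) * size φ * Real.exp (-(p.mu - 1) * t) := by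
  have hmu : 0 < p.mu := by linarith [hp.one_lt_mu]
  have hf := flow_mem hp ht hφ
  have hj := jump_mem hp hf
  have h1 := one_le_size hφ
  have h2 := abs_g_le hp hf
  have h3 := size_flow_le hp ht hφ
  have h4 : |w (p.jump (p.flow t φ))| ≤ p.bound :=
    abs_le.2 ⟨hw.neg_bound_le _ hj, (hw.nonpos _ hj).trans (bound_pos hp).le⟩
  have h5 : 1 ≤ Real.exp ((p.lam + 1) * t) :=
    Real.one_le_exp (mul_nonneg (by linarith [hp.lam_pos]) ht)
  have h6 : 1 ≤ Real.exp ((p.lam + 1) * t) * size φ := one_le_mul_of_one_le_of_one_le h5 h1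
  have hb := mul_pos hmu (bound_pos hp)
  have h7 : |p.g (p.flow t φ) + p.mu * w (p.jump (p.flow t φ))| ≤
      (p.gConst + p.mu * p.bound) * (Real.exp ((p.lam + 1) * t) * size φ) := by
    refine (abs_add_le _ _).trans ?_
    rw [abs_mul, abs_of_pos hmu]
    have := mul_le_mul_of_nonneg_left h3 (gConst_pos hp).le
    have := mul_le_mul_of_nonneg_left h4 hmu.le
    nlinarith
  rw [opIntegrand, abs_mul, abs_of_pos (Real.exp_pos _), ← exp_mul_exp_flow (p := p)]
  calc _ ≤ _ := mul_le_mul_of_nonneg_left h7 (Real.exp_pos _).le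
    _ = _ := by ring

lemma integrableOn_exp_neg_Ici {a : ℝ} (ha : 0 < a) :
    IntegrableOn (fun t => Real.exp (-a * t)) (Set.Ici 0) := by
  rw [integrableOn_Ici_iff_integrableOn_Ioi]
  exact exp_neg_integrableOn_Ioi 0 ha

lemma integrableOn_opIntegrand (hp : p.Admissible) (hw : p.IsCandidate w) (hφ : φ ∈ quadrant)
    (T : ℝ≥0∞) : IntegrableOn (p.opIntegrand w φ) (horizon T) := by
  have hm : Measurable (p.opIntegrand w φ) :=
    (measurable_opIntegrand hw.measurable).comp measurable_prodMk_left
  refine IntegrableOn.mono_set (t := Set.Ici 0) ?_ (horizon_subset_Ici T)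
  refine Integrable.mono'
    ((integrableOn_exp_neg_Ici (sub_pos.2 hp.one_lt_mu)).const_mul
      ((p.gConst + p.mu * p.bound) * size φ)) hm.aestronglyMeasurable ?_
  filter_upwards [ae_restrict_mem measurableSet_Ici] with t ht
  exact abs_opIntegrand_le hp hw hφ ht

lemma op_zero_right (w : ℝ × ℝ → ℝ) (φ : ℝ × ℝ) : p.op w 0 φ = 0 := by
  simp [op, horizon_zero]

lemma neg_le_opIntegrand (hp : p.Admissible) (hw : p.IsCandidate w) (hφ : φ ∈ quadrant) {t : ℝ}
    (ht : 0 ≤ t) : -((p.lam + p.mu) * p.bound) * Real.exp (-(p.lam + p.mu) * t) ≤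
      p.opIntegrand w φ t := by
  have hf := flow_mem hp ht hφ
  have h1 := neg_le_g (p := p) hf
  have h2 := hw.neg_bound_le _ (jump_mem hp hf)
  have h3 := mul_le_mul_of_nonneg_left h2 (show 0 ≤ p.mu by linarith [hp.one_lt_mu])
  rw [opIntegrand, mul_comm]
  exact mul_le_mul_of_nonneg_left (by linarith) (Real.exp_pos _).le

lemma opIntegrand_le (hp : p.Admissible) (hw : p.IsCandidate w) (hφ : φ ∈ quadrant) {t : ℝ}
    (ht : 0 ≤ t) : p.opIntegrand w φ t ≤ size φ := by
  have hf := flow_mem hp ht hφ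
  have h2 := hw.nonpos _ (jump_mem hp hf)
  have h3 := mul_nonpos_of_nonneg_of_nonpos (show 0 ≤ p.mu by linarith [hp.one_lt_mu]) h2
  have h4 := (g_le_size hp (p.flow t φ)).trans (size_flow_le hp ht hφ)
  have h5 : Real.exp (-(p.mu - 1) * t) ≤ 1 :=
    Real.exp_le_one_iff.2 (by have := mul_nonneg (sub_pos.2 hp.one_lt_mu).le ht; linarith)
  calc p.opIntegrand w φ t
      ≤ Real.exp (-(p.lam + p.mu) * t) * (Real.exp ((p.lam + 1) * t) * size φ) :=
        mul_le_mul_of_nonneg_left (by linarith) (Real.exp_pos _).le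
    _ = Real.exp (-(p.mu - 1) * t) * size φ := by rw [← exp_mul_exp_flow (p := p)]; ring
    _ ≤ size φ := mul_le_of_le_one_left (size_pos hφ).le h5

/-- The bound reproduces itself: `g ≥ -lam * bound` and `mu * w ≥ -mu * bound`, while `(lam + mu) *
e^{-(lam + mu) t}` has total mass one. -/
lemma neg_bound_le_op (hp : p.Admissible) (hw : p.IsCandidate w) (hφ : φ ∈ quadrant)
    (T : ℝ≥0∞) : -p.bound ≤ p.op w T φ := by
  have hs : 0 < p.lam + p.mu := by linarith [hp.lam_pos, hp.one_lt_mu]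
  have hi := integrableOn_exp_neg_Ici hs
  have h1 : ∫ t in horizon T, -((p.lam + p.mu) * p.bound) * Real.exp (-(p.lam + p.mu) * t) ≤
      p.op w T φ :=
    setIntegral_mono_on ((hi.mono_set (horizon_subset_Ici T)).const_mul _)
      (integrableOn_opIntegrand hp hw hφ T) (measurableSet_horizon T)
      fun t ht => neg_le_opIntegrand hp hw hφ ht.1
  refine le_trans ?_ h1
  have h2 : ∫ t in horizon T, Real.exp (-(p.lam + p.mu) * t) ≤
      ∫ t in Set.Ici 0, Real.exp (-(p.lam + p.mu) * t) :=
    setIntegral_mono_set hi (ae_of_all _ fun _ => (Real.exp_pos _).le)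
      (horizon_subset_Ici T).eventuallyLE
  have h3 : ∫ t in Set.Ici 0, Real.exp (-(p.lam + p.mu) * t) = 1 / (p.lam + p.mu) := by
    rw [integral_Ici_eq_integral_Ioi, integral_exp_mul_Ioi (by linarith)]
    simp only [mul_zero, Real.exp_zero, div_neg, neg_div, neg_neg]
  rw [h3] at h2
  rw [integral_const_mul]
  have h4 := mul_le_mul_of_nonneg_left h2 (mul_pos hs (bound_pos hp)).le
  have h5 : (p.lam + p.mu) * p.bound * (1 / (p.lam + p.mu)) = p.bound := by field_simp
  linarith

lemma neg_le_op_ofReal (hp : p.Admissible) (hw : p.IsCandidate w) (hφ : φ ∈ quadrant) {h : ℝ}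
    (hh : 0 ≤ h) :
    -((p.lam + p.mu) * p.bound * h) ≤ p.op w (ENNReal.ofReal h) φ := by
  have hs : 0 < p.lam + p.mu := by linarith [hp.lam_pos, hp.one_lt_mu]
  have hb := mul_pos hs (bound_pos hp)
  have h1 : ∫ _ in horizon (ENNReal.ofReal h), -((p.lam + p.mu) * p.bound) ≤
      p.op w (ENNReal.ofReal h) φ := by
    refine setIntegral_mono_on (by rw [horizon_ofReal]; exact integrableOn_const (by simp))
      (integrableOn_opIntegrand hp hw hφ _) (measurableSet_horizon _) fun t ht =>
        le_trans ?_ (neg_le_opIntegrand hp hw hφ ht.1)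
    have : Real.exp (-(p.lam + p.mu) * t) ≤ 1 :=
      Real.exp_le_one_iff.2 (by have := mul_nonneg hs.le ht.1; linarith)
    nlinarith
  refine le_trans (le_of_eq ?_) h1
  rw [horizon_ofReal]
  simp [hh]
  ring

lemma op_ofReal_le (hp : p.Admissible) (hw : p.IsCandidate w) (hφ : φ ∈ quadrant) {h : ℝ}
    (hh : 0 ≤ h) : p.op w (ENNReal.ofReal h) φ ≤ h * size φ := by
  have h1 : p.op w (ENNReal.ofReal h) φ ≤ ∫ _ in horizon (ENNReal.ofReal h), size φ :=
    setIntegral_mono_on (integrableOn_opIntegrand hp hw hφ _) (by rw [horizon_ofReal]; simp)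
      (measurableSet_horizon _) fun t ht => opIntegrand_le hp hw hφ ht.1
  refine h1.trans (le_of_eq ?_)
  rw [horizon_ofReal]
  simp [hh]

lemma opIntegrand_add (s t : ℝ) : p.opIntegrand w φ (s + t) =
    Real.exp (-(p.lam + p.mu) * s) * p.opIntegrand w (p.flow s φ) t := by
  simp only [opIntegrand, flow_add, mul_add, Real.exp_add]
  ring

/-- Restart at time `s`: the flow is a semigroup, and the weight `e^{-(lam + mu) s}` is the discount
times the probability of no jump before `s`. -/
lemma op_add (hp : p.Admissible) (hw : p.IsCandidate w) (hφ : φ ∈ quadrant) {s : ℝ}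
    (hs : 0 ≤ s) (T : ℝ≥0∞) : p.op w (ENNReal.ofReal s + T) φ =
      p.op w (ENNReal.ofReal s) φ + Real.exp (-(p.lam + p.mu) * s) * p.op w T (p.flow s φ) := by
  have hu : horizon (ENNReal.ofReal s + T) = Set.Ico 0 s ∪ (fun t => s + t) '' horizon T := by
    ext t
    simp only [horizon, Set.mem_ofPred_eq, Set.mem_union, Set.mem_Ico, Set.mem_image]
    constructor
    · rintro ⟨h0, h1⟩
      rcases lt_or_ge t s with h | h
      · exact Or.inl ⟨h0, h⟩
      · refine Or.inr ⟨t - s, ⟨by linarith, ?_⟩, by ring⟩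
        rw [show t = s + (t - s) by ring, ENNReal.ofReal_add hs (by linarith)] at h1
        exact lt_of_add_lt_add_left h1
    · rintro (⟨h0, h1⟩ | ⟨r, ⟨h0, h1⟩, rfl⟩)
      · exact ⟨h0, ((ENNReal.ofReal_lt_ofReal_iff_of_nonneg h0).2 h1).trans_le le_self_add⟩
      · refine ⟨by linarith, ?_⟩
        rw [ENNReal.ofReal_add hs h0]
        exact ENNReal.add_lt_add_left ENNReal.ofReal_ne_top h1
  have hd : Disjoint (Set.Ico 0 s) ((fun t => s + t) '' horizon T) := by
    rw [Set.disjoint_left]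
    rintro t ht ⟨r, hr, rfl⟩
    linarith [ht.2, hr.1]
  have hme : MeasurableEmbedding fun t : ℝ => s + t := measurableEmbedding_addLeft s
  have hi := integrableOn_opIntegrand hp hw hφ (ENNReal.ofReal s + T)
  rw [hu] at hi
  rw [op, hu, setIntegral_union hd (hme.measurableSet_image.2 (measurableSet_horizon T))
    (hi.mono_set Set.subset_union_left) (hi.mono_set Set.subset_union_right), op, horizon_ofReal,
    (measurePreserving_add_left volume s).setIntegral_image_emb hme]
  congr 1
  simp only [opIntegrand_add]
  rw [integral_const_mul, op]

lemma op_mono (hp : p.Admissible) (hw : p.IsCandidate w) (hw' : p.IsCandidate w')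
    (hle : ∀ ψ ∈ quadrant, w ψ ≤ w' ψ) (hφ : φ ∈ quadrant) (T : ℝ≥0∞) :
    p.op w T φ ≤ p.op w' T φ := by
  refine setIntegral_mono_on (integrableOn_opIntegrand hp hw hφ T)
    (integrableOn_opIntegrand hp hw' hφ T) (measurableSet_horizon T) fun t ht => ?_
  have h1 := hle _ (jump_mem hp (flow_mem hp ht.1 hφ))
  have h2 := mul_le_mul_of_nonneg_left h1 (show 0 ≤ p.mu by linarith [hp.one_lt_mu])
  exact mul_le_mul_of_nonneg_left (by linarith) (Real.exp_pos _).le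

lemma bddBelow_op (hp : p.Admissible) (hw : p.IsCandidate w) (hφ : φ ∈ quadrant) :
    BddBelow (Set.range fun q : ℚ≥0 => p.op w ((q : ℝ≥0) : ℝ≥0∞) φ) :=
  ⟨-p.bound, by rintro _ ⟨q, rfl⟩; exact neg_bound_le_op hp hw hφ _⟩

/-- The cost at `T` is the limit of the costs at the rationals below `T`, the set integral being
continuous along increasing sets. -/
lemma opInf_le (hp : p.Admissible) (hw : p.IsCandidate w) (hφ : φ ∈ quadrant) (T : ℝ≥0∞) :
    p.opInf w φ ≤ p.op w T φ := by
  let ι := {q : ℚ≥0 // ((q : ℝ≥0) : ℝ≥0∞) ≤ T}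
  have : Nonempty ι := ⟨⟨0, by simp⟩⟩
  have hmono : Monotone fun q : ι => horizon ((q : ℚ≥0) : ℝ≥0) := fun a b hab =>
    horizon_mono (ENNReal.coe_le_coe.2 (by exact_mod_cast hab))
  have h := tendsto_setIntegral_of_monotone (μ := volume) (f := p.opIntegrand w φ)
    (fun q : ι => measurableSet_horizon _) hmono
    (by rw [← horizon_eq_iUnion]; exact integrableOn_opIntegrand hp hw hφ T)
  rw [← horizon_eq_iUnion] at h
  exact ge_of_tendsto' h fun q => ciInf_le (bddBelow_op hp hw hφ) q.1

lemma iInf_op_eq (hp : p.Admissible) (hw : p.IsCandidate w) (hφ : φ ∈ quadrant) :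
    ⨅ T : ℝ≥0∞, ((p.op w T φ : ℝ) : EReal) = ((p.opInf w φ : ℝ) : EReal) := by
  refine le_antisymm ?_ (le_iInf fun T => EReal.coe_le_coe_iff.2 (opInf_le hp hw hφ T))
  refine le_of_forall_gt fun b hb => ?_
  obtain ⟨r, hr1, hr2⟩ := EReal.lt_iff_exists_real_btwn.1 hb
  obtain ⟨q, hq⟩ := exists_lt_of_ciInf_lt (EReal.coe_lt_coe_iff.1 hr1)
  exact (iInf_le _ _).trans_lt ((EReal.coe_lt_coe_iff.2 hq).trans hr2)

lemma isCandidate_opInf (hp : p.Admissible) (hw : p.IsCandidate w) :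
    p.IsCandidate (p.opInf w) where
  measurable := measurable_opInf hw.measurable
  nonpos _ hφ := (opInf_le hp hw hφ 0).trans_eq (op_zero_right w _)
  neg_bound_le _ hφ := le_ciInf fun _ => neg_bound_le_op hp hw hφ _

/-- The real-valued successive approximations. -/
def approx (p : Params) : ℕ → ℝ × ℝ → ℝ
  | 0 => fun _ => 0
  | n + 1 => p.opInf (approx p n)

/-- The limit of the successive approximations. -/
def limitValue (p : Params) (φ : ℝ × ℝ) : ℝ := ⨅ n, p.approx n φ

lemma isCandidate_approx (hp : p.Admissible) (n : ℕ) : p.IsCandidate (p.approx n) := by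
  induction n with
  | zero => exact isCandidate_zero hp
  | succ n ih => exact isCandidate_opInf hp ih

lemma opInf_mono (hp : p.Admissible) (hw : p.IsCandidate w) (hw' : p.IsCandidate w')
    (hle : ∀ ψ ∈ quadrant, w ψ ≤ w' ψ) (hφ : φ ∈ quadrant) : p.opInf w φ ≤ p.opInf w' φ :=
  ciInf_mono (bddBelow_op hp hw hφ) fun _ => op_mono hp hw hw' hle hφ _

lemma approx_succ_le (hp : p.Admissible) (n : ℕ) :
    ∀ φ ∈ quadrant, p.approx (n + 1) φ ≤ p.approx n φ := by
  induction n with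
  | zero => exact fun φ hφ => (isCandidate_approx hp 1).nonpos φ hφ
  | succ n ih =>
    exact fun φ hφ => opInf_mono hp (isCandidate_approx hp _) (isCandidate_approx hp _) ih hφ

lemma bddBelow_approx (hp : p.Admissible) (hφ : φ ∈ quadrant) :
    BddBelow (Set.range fun n => p.approx n φ) :=
  ⟨-p.bound, by rintro _ ⟨n, rfl⟩; exact (isCandidate_approx hp n).neg_bound_le φ hφ⟩

lemma tendsto_approx (hp : p.Admissible) (hφ : φ ∈ quadrant) :
    Tendsto (fun n => p.approx n φ) atTop (𝓝 (p.limitValue φ)) :=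
  tendsto_atTop_ciInf (antitone_nat_of_succ_le fun n => approx_succ_le hp n φ hφ)
    (bddBelow_approx hp hφ)

lemma limitValue_le_approx (hp : p.Admissible) (hφ : φ ∈ quadrant) (n : ℕ) :
    p.limitValue φ ≤ p.approx n φ := ciInf_le (bddBelow_approx hp hφ) n

lemma isCandidate_limitValue (hp : p.Admissible) : p.IsCandidate p.limitValue where
  measurable := Measurable.iInf fun n => (isCandidate_approx hp n).measurable
  nonpos _ hφ := limitValue_le_approx hp hφ 0
  neg_bound_le φ hφ := le_ciInf fun n => (isCandidate_approx hp n).neg_bound_le φ hφ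

lemma tendsto_op_approx (hp : p.Admissible) (hφ : φ ∈ quadrant) (T : ℝ≥0∞) :
    Tendsto (fun n => p.op (p.approx n) T φ) atTop (𝓝 (p.op p.limitValue T φ)) := by
  refine tendsto_integral_of_dominated_convergence
    (fun t => (p.gConst + p.mu * p.bound) * size φ * Real.exp (-(p.mu - 1) * t))
    (fun n => (integrableOn_opIntegrand hp (isCandidate_approx hp n) hφ T).aestronglyMeasurable)
    (((integrableOn_exp_neg_Ici (sub_pos.2 hp.one_lt_mu)).mono_set
      (horizon_subset_Ici T)).const_mul _) (fun n => ?_) ?_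
  · filter_upwards [ae_restrict_mem (measurableSet_horizon T)] with t ht
    exact abs_opIntegrand_le hp (isCandidate_approx hp n) hφ ht.1
  · filter_upwards [ae_restrict_mem (measurableSet_horizon T)] with t ht
    exact ((tendsto_approx hp (jump_mem hp (flow_mem hp ht.1 hφ))).const_mul _).const_add _
      |>.const_mul _

/-- The limit of the successive approximations is a fixed point of the operator. -/
lemma limitValue_eq_opInf (hp : p.Admissible) (hφ : φ ∈ quadrant) :
    p.limitValue φ = p.opInf p.limitValue φ := by
  have hc := isCandidate_limitValue hp
  refine le_antisymm (le_ciInf fun q => ?_) (le_ciInf fun n => ?_)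
  -- At a fixed horizon the limit lies below `approx (n + 1)`, which lies below `op (approx n)`;
  -- dominated convergence then replaces `approx n` by the limit.
  · exact ge_of_tendsto' (tendsto_op_approx hp hφ _) fun n =>
      (limitValue_le_approx hp hφ (n + 1)).trans (opInf_le hp (isCandidate_approx hp n) hφ _)
  -- Here monotonicity is enough: applying the operator to the limit gives at most `approx (n + 1)`,
  -- hence at most `approx n`.
  · exact (opInf_mono hp hc (isCandidate_approx hp n)
      (fun ψ hψ => limitValue_le_approx hp hψ n) hφ).trans (approx_succ_le hp n φ hφ)

/-! ### Dynamic programming and regularity of fixed points along the flow. -/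

/-- Candidates that are fixed points of the operator. -/
structure IsFixed (p : Params) (w : ℝ × ℝ → ℝ) : Prop extends p.IsCandidate w where
  eq_opInf : ∀ φ ∈ quadrant, w φ = p.opInf w φ

lemma isFixed_limitValue (hp : p.Admissible) : p.IsFixed p.limitValue :=
  ⟨isCandidate_limitValue hp, fun _ hφ => limitValue_eq_opInf hp hφ⟩

/-- The value of continuing for the time `h` or until the first jump, and being paid `w` then. -/
def continuation (p : Params) (w : ℝ × ℝ → ℝ) (h : ℝ) (φ : ℝ × ℝ) : ℝ :=
  p.op w (ENNReal.ofReal h) φ + Real.exp (-(p.lam + p.mu) * h) * w (p.flow h φ)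

lemma measurable_continuation (hw : Measurable w) (h : ℝ) : Measurable (p.continuation w h) :=
  (measurable_op hw _).add ((hw.comp
    (measurable_flow.comp (measurable_const.prodMk measurable_id))).const_mul _)

/-- A horizon `q` chosen at `flow h φ` amounts to the horizon `h + q` at `φ`, which competes in the
infimum defining `w φ`; take the infimum over `q`. -/
lemma le_continuation (hp : p.Admissible) (hw : p.IsFixed w) (hφ : φ ∈ quadrant) {h : ℝ}
    (hh : 0 ≤ h) : w φ ≤ p.continuation w h φ := by
  have hf := flow_mem hp hh hφ
  have he := Real.exp_pos (-(p.lam + p.mu) * h)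
  have h1 : (w φ - p.op w (ENNReal.ofReal h) φ) / Real.exp (-(p.lam + p.mu) * h) ≤
      w (p.flow h φ) := by
    rw [hw.eq_opInf _ hf]
    refine le_ciInf fun q => ?_
    rw [div_le_iff₀ he, hw.eq_opInf φ hφ]
    have h2 := opInf_le hp hw.toIsCandidate hφ (ENNReal.ofReal h + ((q : ℝ≥0) : ℝ≥0∞))
    rw [op_add hp hw.toIsCandidate hφ hh] at h2
    linarith
  rw [div_le_iff₀ he] at h1
  rw [continuation]
  linarith

/-- A horizon shorter than `h` earns at most `(lam + mu) * bound * h`. If `w φ` is below minus that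
amount, nearly optimal horizons are longer than `h`, so committing to `h` loses nothing. This yields
a good stopping rule without any optimal horizon being attained. -/
lemma eq_continuation (hp : p.Admissible) (hw : p.IsFixed w) (hφ : φ ∈ quadrant) {h : ℝ}
    (hh : 0 ≤ h) (hlt : w φ < -((p.lam + p.mu) * p.bound * h)) :
    w φ = p.continuation w h φ := by
  have hs : 0 < p.lam + p.mu := by linarith [hp.lam_pos, hp.one_lt_mu]
  refine le_antisymm (le_continuation hp hw hφ hh) (le_of_forall_gt_imp_ge_of_dense fun b hb => ?_)
  have hb' : p.opInf w φ < min b (-((p.lam + p.mu) * p.bound * h)) := by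
    rw [← hw.eq_opInf φ hφ]
    exact lt_min hb hlt
  obtain ⟨q, hq⟩ := exists_lt_of_ciInf_lt hb'
  -- The minimum in `hb'` makes `q` both nearly optimal and better than every horizon shorter than
  -- `h`.
  have hhq : h ≤ q := by
    by_contra! hlt'
    have h1 := neg_le_op_ofReal hp hw.toIsCandidate hφ (h := (q : ℝ)) (by positivity)
    rw [ofReal_nnratCast] at h1
    have h3 := mul_le_mul_of_nonneg_left hlt'.le (mul_pos hs (bound_pos hp)).le
    linarith [hq.trans_le (min_le_right _ _)]
  have h2 : ((q : ℝ≥0) : ℝ≥0∞) = ENNReal.ofReal h + ENNReal.ofReal (q - h) := by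
    rw [← ENNReal.ofReal_add hh (by linarith), add_sub_cancel, ofReal_nnratCast]
  refine le_trans ?_ (hq.le.trans (min_le_left _ _))
  rw [h2, op_add hp hw.toIsCandidate hφ hh, continuation]
  have hf := flow_mem hp hh hφ
  gcongr
  rw [hw.eq_opInf _ hf]
  exact opInf_le hp hw.toIsCandidate hf _

/-- Below the threshold, `w φ` is the continuation value, and its terminal weight `e^{-(lam + mu)
h}` may be raised to `e^{-lam h}` because `w ≤ 0`. Above the threshold, nonpositivity of `w` at the
later point is enough. -/
lemma exp_mul_flow_sub_le (hp : p.Admissible) (hw : p.IsFixed w) (hφ : φ ∈ quadrant) {h : ℝ}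
    (hh : 0 ≤ h) : Real.exp (-p.lam * h) * w (p.flow h φ) - (p.lam + p.mu) * p.bound * h ≤
      w φ := by
  have hs : 0 < p.lam + p.mu := by linarith [hp.lam_pos, hp.one_lt_mu]
  have hf := flow_mem hp hh hφ
  have hn := hw.nonpos _ hf
  rcases lt_or_ge (w φ) (-((p.lam + p.mu) * p.bound * h)) with hlt | hge
  · rw [eq_continuation hp hw hφ hh hlt, continuation]
    have h1 := neg_le_op_ofReal hp hw.toIsCandidate hφ hh
    have h2 : Real.exp (-(p.lam + p.mu) * h) ≤ Real.exp (-p.lam * h) :=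
      Real.exp_le_exp.2 (by nlinarith [mul_nonneg (show 0 ≤ p.mu by linarith [hp.one_lt_mu]) hh])
    nlinarith
  · nlinarith [Real.exp_pos (-p.lam * h)]

/-- From `le_continuation`: the cost of the step is at most `size φ * h`, and dropping the survival
factor from the terminal weight costs at most `mu * h * bound`. Together with the preceding bound,
`w` is Lipschitz along the flow, although nothing is known about its continuity in `φ`. -/
lemma le_exp_mul_flow_add (hp : p.Admissible) (hw : p.IsFixed w) (hφ : φ ∈ quadrant) {h : ℝ}
    (hh : 0 ≤ h) : w φ ≤ Real.exp (-p.lam * h) * w (p.flow h φ) +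
      (1 + p.mu * p.bound) * size φ * h := by
  have hmu : 0 ≤ p.mu := by linarith [hp.one_lt_mu]
  have hf := flow_mem hp hh hφ
  have h1 := op_ofReal_le hp hw.toIsCandidate hφ hh
  have h2 := le_continuation hp hw hφ hh
  have h3 := hw.neg_bound_le _ hf
  have h4 := hw.nonpos _ hf
  have h5 := one_le_size hφ
  have h6 : Real.exp (-p.lam * h) - Real.exp (-(p.lam + p.mu) * h) ≤ p.mu * h := by
    have e1 : Real.exp (-(p.lam + p.mu) * h) = Real.exp (-p.lam * h) * Real.exp (-p.mu * h) := by
      rw [← Real.exp_add]; ring_nf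
    have e2 : 1 - p.mu * h ≤ Real.exp (-p.mu * h) := by
      linarith [Real.add_one_le_exp (-p.mu * h)]
    have e3 : Real.exp (-p.lam * h) ≤ 1 :=
      Real.exp_le_one_iff.2 (by nlinarith [mul_nonneg hp.lam_pos.le hh])
    have e4 := Real.exp_pos (-p.lam * h)
    rw [e1]
    nlinarith [mul_nonneg hmu hh]
  have h7 : (Real.exp (-(p.lam + p.mu) * h) - Real.exp (-p.lam * h)) * w (p.flow h φ) ≤
      p.mu * h * p.bound := by
    have h8 := mul_nonneg (sub_nonneg.2 h6) (neg_nonneg.2 h4)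
    have h9 := mul_nonneg (mul_nonneg hmu hh) (show 0 ≤ w (p.flow h φ) + p.bound by linarith)
    nlinarith
  have h10 : p.mu * h * p.bound ≤ p.mu * p.bound * size φ * h := by
    have := mul_le_mul_of_nonneg_left h5 (mul_nonneg (mul_nonneg hmu (bound_pos hp).le) hh)
    nlinarith
  rw [continuation] at h2
  nlinarith

end Params

end PoissonDisorder

end

/-! ### Jump times, and the path of the sufficient statistic. -/

noncomputable section

namespace PoissonDisorder

section JumpTime

variable {Ω : Type*} {N : ℝ≥0 → Ω → ℕ}

/-- A family of nondecreasing right-continuous paths started at `0`. -/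
structure IsCounting (N : ℝ≥0 → Ω → ℕ) : Prop where
  zero : ∀ ω, N 0 ω = 0
  mono : ∀ ω, Monotone fun t => N t ω
  rightCont : ∀ ω t, ContinuousWithinAt (fun s => N s ω) (Set.Ici t) t

/-- Right continuity with discrete values keeps the path constant just after `t`, so the infimum
cannot be reached from strictly later times only. -/
lemma jumpTime_le_iff (hN : IsCounting N) {n : ℕ} {t : ℝ≥0} {ω : Ω} :
    jumpTime N n ω ≤ t ↔ n ≤ N t ω := by
  refine ⟨fun h => ?_, fun h => iInf₂_le t h⟩
  by_contra! hlt
  have h1 := (hN.rightCont ω t).preimage_mem_nhdsWithin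
    ((isOpen_discrete {N t ω}).mem_nhds rfl)
  obtain ⟨u, htu, hu⟩ := mem_nhdsGE_iff_exists_Ico_subset.1 h1
  have h2 : (u : ℝ≥0∞) ≤ jumpTime N n ω := by
    refine le_iInf₂ fun s hs => ENNReal.coe_le_coe.2 ?_
    by_contra! hsu
    rcases le_total t s with hts | hst
    · have : N s ω = N t ω := hu ⟨hts, hsu⟩
      omega
    · exact absurd (hN.mono ω hst) (by simp only; omega)
  exact absurd (ENNReal.coe_le_coe.1 (h2.trans h)) (not_le.2 htu)

lemma lt_jumpTime_iff (hN : IsCounting N) {n : ℕ} {t : ℝ≥0} {ω : Ω} :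
    (t : ℝ≥0∞) < jumpTime N n ω ↔ N t ω < n := by
  rw [← not_le, jumpTime_le_iff hN, not_le]

lemma jumpTime_mono (N : ℝ≥0 → Ω → ℕ) (ω : Ω) : Monotone fun n => jumpTime N n ω :=
  fun _ _ hmn => le_iInf₂ fun t ht => iInf₂_le t (hmn.trans ht)

lemma jumpTime_zero (N : ℝ≥0 → Ω → ℕ) (ω : Ω) : jumpTime N 0 ω = 0 :=
  le_antisymm (iInf₂_le (0 : ℝ≥0) (Nat.zero_le _)) zero_le

lemma jumpTime_ne_top {n : ℕ} {t : ℝ≥0} {ω : Ω} (h : n ≤ N t ω) : jumpTime N n ω ≠ ⊤ :=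
  ((iInf₂_le t h).trans_lt ENNReal.coe_lt_top).ne

lemma toReal_jumpTime_le {n : ℕ} {t : ℝ≥0} {ω : Ω} (h : n ≤ N t ω) :
    (jumpTime N n ω).toReal ≤ t :=
  ENNReal.toReal_mono ENNReal.coe_ne_top (iInf₂_le (α := ℝ≥0∞) t h)

lemma lt_toReal_jumpTime (hN : IsCounting N) {n : ℕ} {t : ℝ≥0} {ω : Ω} (h : N t ω < n)
    (htop : jumpTime N n ω ≠ ⊤) : (t : ℝ) < (jumpTime N n ω).toReal := by
  have := (ENNReal.toReal_lt_toReal ENNReal.coe_ne_top htop).2 ((lt_jumpTime_iff hN).2 h)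
  simpa using this

lemma toReal_jumpTime_mono {m n : ℕ} {ω : Ω} (h : m ≤ n) (htop : jumpTime N n ω ≠ ⊤) :
    (jumpTime N m ω).toReal ≤ (jumpTime N n ω).toReal :=
  ENNReal.toReal_mono htop (jumpTime_mono N ω h)

end JumpTime

namespace Params

variable {p : Params} {Ω : Type*} {N : ℝ≥0 → Ω → ℕ} {φ : ℝ × ℝ} {ω : Ω}

lemma postJump_succ (n : ℕ) : p.postJump N φ (n + 1) ω = p.jump (p.flow
    ((jumpTime N (n + 1) ω).toReal - (jumpTime N n ω).toReal) (p.postJump N φ n ω)) := rfl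

lemma postJump_mem (hp : p.Admissible) (hφ : φ ∈ quadrant) {n : ℕ}
    (h : jumpTime N n ω ≠ ⊤) : p.postJump N φ n ω ∈ quadrant := by
  induction n with
  | zero => exact hφ
  | succ n ih =>
    have h' : jumpTime N n ω ≠ ⊤ := ne_top_of_le_ne_top h (jumpTime_mono N ω n.le_succ)
    exact jump_mem hp (flow_mem hp (sub_nonneg.2 (toReal_jumpTime_mono n.le_succ h)) (ih h'))

lemma statistic_mem (hp : p.Admissible) (hφ : φ ∈ quadrant) (t : ℝ≥0) (ω : Ω) :
    p.statistic N φ t ω ∈ quadrant :=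
  flow_mem hp (sub_nonneg.2 (toReal_jumpTime_le le_rfl))
    (postJump_mem hp hφ (jumpTime_ne_top le_rfl))

lemma statistic_zero (hN : IsCounting N) : p.statistic N φ 0 ω = φ := by
  simp [statistic, hN.zero, jumpTime_zero, flow_zero, postJump]

lemma flow_sub_postJump (s r : ℝ) (t : ℝ≥0) (hst : s = t) :
    p.flow (r - (jumpTime N (N t ω) ω).toReal) (p.postJump N φ (N t ω) ω) =
      p.flow (r - s) (p.statistic N φ t ω) := by
  rw [statistic, ← flow_add, hst]
  ring_nf

lemma statistic_of_eq {s t : ℝ≥0} (h : N t ω = N s ω) :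
    p.statistic N φ t ω = p.flow (t - s) (p.statistic N φ s ω) := by
  rw [← flow_sub_postJump _ _ s rfl, statistic, h]

lemma statistic_of_eq_succ {s t : ℝ≥0} (h : N t ω = N s ω + 1) :
    p.statistic N φ t ω = p.flow (t - (jumpTime N (N s ω + 1) ω).toReal) (p.jump
      (p.flow ((jumpTime N (N s ω + 1) ω).toReal - s) (p.statistic N φ s ω))) := by
  rw [← flow_sub_postJump _ _ s rfl, statistic, h, postJump_succ]

/-- Each jump at most doubles the size, and the flow contributes one exponential factor in total.
The time `r` is not required to precede the next jump, so that the induction hypothesis can be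
applied at the next jump time itself. -/
lemma size_flow_postJump_le (hp : p.Admissible) (hN : IsCounting N) (hφ : φ ∈ quadrant)
    (s : ℝ≥0) (k : ℕ) : ∀ r : ℝ, s ≤ r → jumpTime N (N s ω + k) ω ≠ ⊤ →
      (jumpTime N (N s ω + k) ω).toReal ≤ r →
      size (p.flow (r - (jumpTime N (N s ω + k) ω).toReal) (p.postJump N φ (N s ω + k) ω)) ≤
        2 ^ k * Real.exp ((p.lam + 1) * (r - s)) * size (p.statistic N φ s ω) := by
  induction k with
  | zero =>
    intro r hr _ _
    rw [add_zero, flow_sub_postJump _ _ s rfl, pow_zero, one_mul]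
    exact size_flow_le hp (sub_nonneg.2 hr) (statistic_mem hp hφ s ω)
  | succ k ih =>
    intro r hr htop hle
    have htop' : jumpTime N (N s ω + k) ω ≠ ⊤ :=
      ne_top_of_le_ne_top htop (jumpTime_mono N ω (Nat.le_succ _))
    have h1 := (lt_toReal_jumpTime hN (show N s ω < N s ω + (k + 1) by omega) htop).le
    have h2 := toReal_jumpTime_mono (show N s ω + k ≤ N s ω + (k + 1) by omega) htop
    have h3 := ih _ h1 htop' h2
    have h4 := flow_mem hp (sub_nonneg.2 h2) (postJump_mem hp hφ htop')
    have h5 := size_flow_le hp (sub_nonneg.2 hle) (jump_mem hp h4)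
    have h6 := size_jump_le hp h4
    rw [← add_assoc, postJump_succ, add_assoc]
    refine h5.trans ((mul_le_mul_of_nonneg_left (h6.trans
      (mul_le_mul_of_nonneg_left h3 zero_le_two)) (Real.exp_pos _).le).trans (le_of_eq ?_))
    have h7 : Real.exp ((p.lam + 1) * (r - s)) =
        Real.exp ((p.lam + 1) * (r - (jumpTime N (N s ω + (k + 1)) ω).toReal)) *
          Real.exp ((p.lam + 1) * ((jumpTime N (N s ω + (k + 1)) ω).toReal - s)) := by
      rw [← Real.exp_add]; ring_nf
    rw [h7]
    ring

lemma size_statistic_le (hp : p.Admissible) (hN : IsCounting N) (hφ : φ ∈ quadrant)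
    {s t : ℝ≥0} (hst : s ≤ t) : size (p.statistic N φ t ω) ≤
      2 ^ (N t ω - N s ω) * Real.exp ((p.lam + 1) * (t - s)) * size (p.statistic N φ s ω) := by
  have h : N s ω + (N t ω - N s ω) = N t ω := Nat.add_sub_cancel' (hN.mono ω hst)
  have h1 := size_flow_postJump_le (ω := ω) hp hN hφ s (N t ω - N s ω) t
  rw [h] at h1
  exact h1 (by exact_mod_cast hst) (jumpTime_ne_top le_rfl) (toReal_jumpTime_le le_rfl)

/-- The sufficient statistic after `n` jumps at the times `τ`. -/
def stateAfter (p : Params) (τ : ℕ → ℝ) (φ : ℝ × ℝ) : ℕ → ℝ × ℝ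
  | 0 => φ
  | n + 1 => p.jump (p.flow (τ (n + 1) - τ n) (stateAfter p τ φ n))

lemma postJump_eq_stateAfter {τ : ℕ → ℝ} {n : ℕ}
    (h : ∀ k ≤ n, (jumpTime N k ω).toReal = τ k) : p.postJump N φ n ω = p.stateAfter τ φ n := by
  induction n with
  | zero => rfl
  | succ n ih =>
    rw [postJump_succ, stateAfter, ih fun k hk => h k (hk.trans n.le_succ), h _ le_rfl,
      h _ n.le_succ]

end Params

section Measurability

variable {Ω : Type*} {N : ℝ≥0 → Ω → ℕ} [mΩ : MeasurableSpace Ω]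

lemma measurable_of_forall_le {α : Type*} [MeasurableSpace α] {f : α → ℝ≥0∞}
    (h : ∀ a : ℝ≥0, MeasurableSet {x | f x ≤ a}) : Measurable f := by
  refine measurable_of_Iic fun b => ?_
  induction b with
  | top => simp
  | coe a => exact h a

lemma measurable_jumpTime (hN : IsCounting N) (hm : ∀ t, Measurable (N t)) (n : ℕ) :
    Measurable (jumpTime N n) := by
  refine measurable_of_forall_le fun a => ?_
  simp only [jumpTime_le_iff hN]
  exact hm a measurableSet_Ici

lemma measurable_jumpTime_inf (hN : IsCounting N) {t : ℝ≥0} (hm : ∀ s ≤ t, Measurable (N s))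
    (n : ℕ) : Measurable fun ω => min (jumpTime N n ω) t := by
  refine measurable_of_forall_le fun a => ?_
  rcases le_or_gt t a with h | h
  · have : {ω | min (jumpTime N n ω) (t : ℝ≥0∞) ≤ a} = Set.univ :=
      Set.eq_univ_of_forall fun ω => (min_le_right _ _).trans (ENNReal.coe_le_coe.2 h)
    rw [this]
    exact MeasurableSet.univ
  · have : {ω | min (jumpTime N n ω) (t : ℝ≥0∞) ≤ a} = {ω | n ≤ N a ω} := by
      ext ω
      simp [jumpTime_le_iff hN, h]
    rw [this]
    exact hm a h.le measurableSet_Ici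

lemma measurable_uncurry_counting (hN : IsCounting N) (hm : ∀ t, Measurable (N t)) :
    Measurable fun q : ℝ × Ω => N q.1.toNNReal q.2 := by
  refine measurable_of_Ici fun n => ?_
  have : (fun q : ℝ × Ω => N q.1.toNNReal q.2) ⁻¹' Set.Ici n =
      {q : ℝ × Ω | jumpTime N n q.2 ≤ ENNReal.ofReal q.1} := by
    ext q
    exact (jumpTime_le_iff hN).symm
  rw [this]
  exact measurableSet_le ((measurable_jumpTime hN hm n).comp measurable_snd)
    (ENNReal.measurable_ofReal.comp measurable_fst)

lemma Measurable.apply_nat {α β : Type*} [MeasurableSpace α] [MeasurableSpace β] {k : α → ℕ}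
    {f : ℕ → α → β} (hk : Measurable k) (hf : ∀ n, Measurable (f n)) :
    Measurable fun a => f (k a) a :=
  (measurable_from_prod_countable_right (f := fun q : ℕ × α => f q.1 q.2) hf).comp
    (hk.prodMk measurable_id)

namespace Params

variable {p : Params} {φ : ℝ × ℝ}

lemma measurable_stateAfter {α : Type*} [MeasurableSpace α] {τ : ℕ → α → ℝ}
    (h : ∀ n, Measurable (τ n)) (n : ℕ) :
    Measurable fun a => p.stateAfter (fun k => τ k a) φ n := by
  induction n with
  | zero => exact measurable_const
  | succ n ih =>
    exact measurable_jump.comp (measurable_flow.comp (((h _).sub (h _)).prodMk ih))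

/-- The sufficient statistic is adapted to the counting process. -/
lemma measurable_statistic (hN : IsCounting N) {t : ℝ≥0} (hm : ∀ s ≤ t, Measurable (N s)) :
    Measurable (p.statistic N φ t) := by
  have h1 : ∀ n, Measurable fun ω => (min (jumpTime N n ω) t).toReal := fun n =>
    (measurable_jumpTime_inf hN hm n).ennreal_toReal
  -- Jump times are truncated at `t` since only the truncations depend on the path up to `t`; the
  -- jumps entering the statistic have occurred by `t` and are unaffected.
  have h2 : p.statistic N φ t = fun ω => p.flow ((t : ℝ) - (min (jumpTime N (N t ω) ω) t).toReal)
      (p.stateAfter (fun k => (min (jumpTime N k ω) t).toReal) φ (N t ω)) := by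
    ext1 ω
    have h3 : ∀ k ≤ N t ω, (jumpTime N k ω).toReal = (min (jumpTime N k ω) t).toReal :=
      fun k hk => by rw [min_eq_left ((jumpTime_le_iff hN).2 hk)]
    rw [statistic, postJump_eq_stateAfter h3, h3 _ le_rfl]
  rw [h2]
  exact Measurable.apply_nat (hm t le_rfl) fun n =>
    measurable_flow.comp (((h1 n).const_sub _).prodMk (measurable_stateAfter h1 n))

lemma measurable_uncurry_statistic (hN : IsCounting N) (hm : ∀ t, Measurable (N t)) :
    Measurable fun q : ℝ × Ω => p.statistic N φ q.1.toNNReal q.2 := by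
  have h1 : ∀ n, Measurable fun q : ℝ × Ω => (jumpTime N n q.2).toReal := fun n =>
    ((measurable_jumpTime hN hm n).comp measurable_snd).ennreal_toReal
  have h2 : (fun q : ℝ × Ω => p.statistic N φ q.1.toNNReal q.2) = fun q =>
      p.flow ((q.1.toNNReal : ℝ) - (jumpTime N (N q.1.toNNReal q.2) q.2).toReal)
        (p.stateAfter (fun k => (jumpTime N k q.2).toReal) φ (N q.1.toNNReal q.2)) := by
    ext1 q
    rw [statistic, postJump_eq_stateAfter fun _ _ => rfl]
  rw [h2]
  have h3 : Measurable fun q : ℝ × Ω => (q.1.toNNReal : ℝ) :=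
    measurable_real_toNNReal.coe_nnreal_real.comp measurable_fst
  exact Measurable.apply_nat (measurable_uncurry_counting hN hm) fun n =>
    measurable_flow.comp ((h3.sub (h1 n)).prodMk (measurable_stateAfter h1 n))

/-- The discounted running cost rate along a path. -/
def costRate (p : Params) (N : ℝ≥0 → Ω → ℕ) (φ : ℝ × ℝ) (t : ℝ) (ω : Ω) : ℝ :=
  Real.exp (-p.lam * t) * p.g (p.statistic N φ t.toNNReal ω)

lemma measurable_uncurry_costRate (hN : IsCounting N) (hm : ∀ t, Measurable (N t)) :
    Measurable fun q : ℝ × Ω => p.costRate N φ q.1 q.2 :=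
  (measurable_fst.const_mul _).exp.mul (measurable_g.comp (measurable_uncurry_statistic hN hm))

end Params

end Measurability

end PoissonDisorder

end

/-! ### Poisson increments: moments, and independence of the past. -/

noncomputable section

namespace PoissonDisorder

section PoissonMean

lemma hasSum_pow_poisson (r : ℝ≥0) (z : ℝ) :
    HasSum (fun n : ℕ => Real.exp (-r) * (r : ℝ) ^ n / n.factorial * z ^ n)
      (Real.exp (r * (z - 1))) := by
  have h := (NormedSpace.expSeries_div_hasSum_exp ((r : ℝ) * z)).mul_left (Real.exp (-r))
  convert! h using 1
  · ext n
    rw [mul_pow]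
    ring
  · rw [← Real.exp_eq_exp_ℝ, ← Real.exp_add]
    ring_nf

lemma integrable_pow_poisson (r : ℝ≥0) {z : ℝ} (hz : 0 ≤ z) :
    Integrable (fun n : ℕ => z ^ n) (poissonMeasure r) := by
  rw [integrable_poissonMeasure_iff]
  convert! (hasSum_pow_poisson r z).summable using 3
  rw [Real.norm_of_nonneg (pow_nonneg hz _)]

lemma integral_pow_poisson (r : ℝ≥0) (z : ℝ) :
    ∫ n : ℕ, z ^ n ∂poissonMeasure r = Real.exp (r * (z - 1)) := by
  rw [integral_poissonMeasure]
  exact (hasSum_pow_poisson r z).tsum_eq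

end PoissonMean

section Past

variable {Ω : Type*} [mΩ : MeasurableSpace Ω]

/-- The filtration generated by the process and the null sets. -/
def past (P : Measure Ω) (N : ℝ≥0 → Ω → ℕ) (hN : ∀ t, Measurable (N t)) : Filtration ℝ≥0 mΩ where
  seq t := Filtration.natural N (fun s => (hN s).stronglyMeasurable) t ⊔
    MeasurableSpace.generateFrom {A : Set Ω | MeasurableSet A ∧ P A = 0}
  mono' _ _ hst := sup_le_sup_right (Filtration.mono _ hst) _
  le' t := sup_le (Filtration.le _ t) (MeasurableSpace.generateFrom_le fun _ hA => hA.1)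

variable {P : Measure Ω} {N : ℝ≥0 → Ω → ℕ} (hm : ∀ t, Measurable (N t))

lemma past_le_history (s : ℝ≥0) : past P N hm s ≤ history P N hm s :=
  (past P N hm).le_rightCont s

/-- Independence of increments is proved for the filtration without right-continuous enlargement; an
arbitrarily small delay passes from one to the other. -/
lemma history_le_past {s t : ℝ≥0} (hst : s < t) : history P N hm s ≤ past P N hm t := by
  change Filtration.rightCont (past P N hm) s ≤ _
  rw [Filtration.rightCont_eq]
  exact iInf₂_le t hst

lemma measurable_past {s t : ℝ≥0} (hst : s ≤ t) : Measurable[past P N hm t] (N s) := by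
  refine Measurable.mono ?_ (le_sup_left : Filtration.natural N _ t ≤ past P N hm t) le_rfl
  exact Measurable.mono (comap_measurable (N s)) (le_iSup₂_of_le s hst le_rfl) le_rfl

/-- Events of the augmented past agree almost surely with events of the natural filtration, so null
sets do not affect independence. -/
lemma past_le_eventuallyMeasurableSpace (s : ℝ≥0) : past P N hm s ≤ eventuallyMeasurableSpace
    (Filtration.natural N (fun s => (hm s).stronglyMeasurable) s) (ae P) :=
  sup_le le_eventuallyMeasurableSpace (MeasurableSpace.generateFrom_le fun _ hA =>
    ⟨∅, @MeasurableSet.empty _ (_), ae_eq_empty.2 hA.2⟩)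

include hm

/-- Sort `I` together with `0` and `s` into an increasing grid and append `s + u`. Each value at a
grid time is a sum of increments that precede the last one, because the path starts at `0`. -/
lemma indep_iSup_comap_increment [IsProbabilityMeasure P] (h0 : ∀ ω, N 0 ω = 0)
    (hmono : ∀ ω, Monotone fun t => N t ω) (hi : HasIndepIncrements N P) (s u : ℝ≥0)
    (I : Finset ℝ≥0) (hI : ∀ t ∈ I, t ≤ s) :
    Indep (⨆ t ∈ I, MeasurableSpace.comap (N t) ⊤)
      (MeasurableSpace.comap (fun ω => N (s + u) ω - N s ω) ⊤) P := by
  classical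
  let S : Finset ℝ≥0 := insert 0 (insert s I)
  have hSle : ∀ t ∈ S, t ≤ s := by
    intro t ht
    rcases Finset.mem_insert.1 ht with rfl | ht
    · exact zero_le
    rcases Finset.mem_insert.1 ht with rfl | ht
    · exact le_rfl
    exact hI t ht
  have hpos : 0 < S.card := Finset.card_pos.2 ⟨0, Finset.mem_insert_self _ _⟩
  have hs : s ∈ S := Finset.mem_insert_of_mem (Finset.mem_insert_self _ _)
  -- The grid is extended by the constant `s + u`, so that index `S.card - 1` carries exactly the
  -- increment from `s` to `s + u`.
  let τ : ℕ → ℝ≥0 := fun i => if h : i < S.card then S.orderEmbOfFin rfl ⟨i, h⟩ else s + u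
  have hτ_lt : ∀ i (h : i < S.card), τ i = S.orderEmbOfFin rfl ⟨i, h⟩ := fun i h => dif_pos h
  have hτ_mono : Monotone τ := by
    intro i j hij
    by_cases hj : j < S.card
    · rw [hτ_lt j hj, hτ_lt i (hij.trans_lt hj)]
      exact (S.orderEmbOfFin rfl).monotone hij
    · rw [show τ j = s + u from dif_neg hj]
      by_cases h : i < S.card
      · rw [hτ_lt i h]
        exact (hSle _ (S.orderEmbOfFin_mem rfl _)).trans le_self_add
      · exact (dif_neg h).le
  have hτ_zero : τ 0 = 0 := by
    rw [hτ_lt 0 hpos, Finset.orderEmbOfFin_zero rfl hpos]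
    exact le_antisymm (Finset.min'_le _ _ (Finset.mem_insert_self _ _)) zero_le
  have hτ_last : τ (S.card - 1) = s := by
    rw [hτ_lt _ (Nat.sub_lt hpos one_pos), Finset.orderEmbOfFin_last rfl hpos]
    exact le_antisymm (Finset.max'_le _ _ _ hSle) (Finset.le_max' _ _ hs)
  have hτ_card : τ S.card = s + u := dif_neg (lt_irrefl _)
  let m : ℕ → MeasurableSpace Ω := fun i =>
    MeasurableSpace.comap (fun ω => N (τ (i + 1)) ω - N (τ i) ω) ⊤
  have hle : ∀ i, m i ≤ mΩ := fun i => Measurable.comap_le ((hm _).sub (hm _))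
  have hind : iIndep m P := hi.nat hτ_mono
  have hd : Disjoint {i : ℕ | i < S.card - 1} {S.card - 1} := by
    simp
  have h := indep_iSup_of_disjoint hle hind hd
  have hmeas : ∀ i < S.card, Measurable[⨆ i ∈ {i : ℕ | i < S.card - 1}, m i] (N (τ i)) := by
    intro i
    induction i with
    | zero =>
      intro _
      rw [hτ_zero, show N 0 = fun _ => 0 from funext h0]
      exact measurable_const
    | succ i ih =>
      intro hi'
      have h1 : N (τ (i + 1)) = fun ω => N (τ i) ω + (N (τ (i + 1)) ω - N (τ i) ω) := by
        ext ω
        exact (Nat.add_sub_cancel' (hmono ω (hτ_mono i.le_succ))).symm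
      rw [h1]
      refine Measurable.add (ih (by omega)) ?_
      refine Measurable.mono (comap_measurable _) (le_iSup₂_of_le (f := fun i _ => m i) i ?_ le_rfl)
        le_rfl
      show i < S.card - 1
      omega
  refine indep_of_indep_of_le_left (indep_of_indep_of_le_right h ?_) (iSup₂_le fun t ht => ?_)
  · refine le_iSup₂_of_le (f := fun i _ => m i) (S.card - 1) rfl (le_of_eq ?_)
    simp only [m, hτ_last, Nat.sub_add_cancel hpos, hτ_card]
  · have hmem : t ∈ Set.range (S.orderEmbOfFin rfl) := by
      rw [Finset.range_orderEmbOfFin]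
      exact Finset.mem_insert_of_mem (Finset.mem_insert_of_mem ht)
    obtain ⟨i, rfl⟩ := hmem
    rw [← hτ_lt i i.2]
    exact (hmeas i i.2).comap_le

/-- The natural sigma-algebra is a directed supremum over finite sets of times, which reduces the
claim to the finite case. -/
lemma indep_natural_increment [IsProbabilityMeasure P] (h0 : ∀ ω, N 0 ω = 0)
    (hmono : ∀ ω, Monotone fun t => N t ω) (hi : HasIndepIncrements N P) (s u : ℝ≥0) :
    Indep (Filtration.natural N (fun s => (hm s).stronglyMeasurable) s)
      (MeasurableSpace.comap (fun ω => N (s + u) ω - N s ω) ⊤) P := by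
  classical
  have h := indep_iSup_of_directed_le (m := fun I : {I : Finset ℝ≥0 // ∀ t ∈ I, t ≤ s} =>
      ⨆ t ∈ I.1, MeasurableSpace.comap (N t) ⊤)
    (fun I => indep_iSup_comap_increment hm h0 hmono hi s u I.1 I.2)
    (fun I => iSup₂_le fun t _ => (hm t).comap_le) (Measurable.comap_le ((hm _).sub (hm _)))
    (fun I J => ⟨⟨I.1 ∪ J.1, fun t ht => (Finset.mem_union.1 ht).elim (I.2 t) (J.2 t)⟩,
      biSup_mono fun _ => Finset.mem_union_left _, biSup_mono fun _ => Finset.mem_union_right _⟩)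
  refine indep_of_indep_of_le_left h (iSup₂_le fun t ht => ?_)
  refine le_iSup_of_le (⟨{t}, by simpa using ht⟩ : {I : Finset ℝ≥0 // ∀ t ∈ I, t ≤ s}) ?_
  exact le_iSup₂_of_le (f := fun t _ => MeasurableSpace.comap (N t) ⊤) t
    (Finset.mem_singleton_self t) le_rfl

end Past

/-- An upper bound of the indicator of the event that there are two jumps or more. -/
lemma indicator_two_le_pow (n : ℕ) :
    (if 2 ≤ n then (1 : ℝ) else 0) ≤ (3 ^ n - 2 * 2 ^ n + 1) / 2 := by
  have h : ∀ n : ℕ, 2 ≤ n → (2 * 2 ^ n + 1 : ℝ) ≤ 3 ^ n := by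
    intro n hn
    induction n, hn using Nat.le_induction with
    | base => norm_num
    | succ n _ ih => rw [pow_succ, pow_succ]; nlinarith [pow_pos (two_pos : (0 : ℝ) < 2) n]
  split_ifs with h2
  · linarith [h n h2]
  · interval_cases n <;> norm_num

namespace IsPoissonProcess

variable {Ω : Type*} [mΩ : MeasurableSpace Ω] {P : Measure Ω} {N : ℝ≥0 → Ω → ℕ} {rate : ℝ}
  (hN : IsPoissonProcess N rate P)

include hN

lemma isCounting : IsCounting N := ⟨hN.zero, hN.mono, hN.rightCont⟩

lemma measurable_increment (s u : ℝ≥0) : Measurable fun ω => N (s + u) ω - N s ω :=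
  (hN.measurable _).sub (hN.measurable _)

lemma integrable_pow_increment (s u : ℝ≥0) {z : ℝ} (hz : 0 ≤ z) :
    Integrable (fun ω => z ^ (N (s + u) ω - N s ω)) P := by
  have h := integrable_pow_poisson (rate * (((s + u : ℝ≥0) : ℝ) - s)).toNNReal hz
  rw [← hN.law s (s + u) le_self_add] at h
  exact h.comp_measurable (hN.measurable_increment s u)

lemma integral_pow_increment (hr : 0 ≤ rate) (s u : ℝ≥0) (z : ℝ) :
    ∫ ω, z ^ (N (s + u) ω - N s ω) ∂P = Real.exp (rate * u * (z - 1)) := by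
  have h := integral_pow_poisson (rate * (((s + u : ℝ≥0) : ℝ) - s)).toNNReal z
  rw [← hN.law s (s + u) le_self_add, integral_map (hN.measurable_increment s u).aemeasurable
    (by fun_prop)] at h
  rw [h, NNReal.coe_add, add_sub_cancel_left, Real.coe_toNNReal _ (by positivity)]

lemma measure_increment_eq_zero (hr : 0 ≤ rate) (s u : ℝ≥0) :
    P ((fun ω => N (s + u) ω - N s ω) ⁻¹' {0}) = ENNReal.ofReal (Real.exp (-(rate * u))) := by
  rw [← Measure.map_apply (hN.measurable_increment s u) (measurableSet_singleton 0),
    hN.law s (s + u) le_self_add, poissonMeasure_singleton]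
  rw [NNReal.coe_add, add_sub_cancel_left, Real.coe_toNNReal _ (by positivity)]
  simp

lemma ae_jumpTime_ne_top (hr : 0 < rate) (s : ℝ≥0) :
    ∀ᵐ ω ∂P, jumpTime N (N s ω + 1) ω ≠ ⊤ := by
  rw [ae_iff]
  simp only [not_not]
  have h1 : ∀ n : ℕ, P {ω | jumpTime N (N s ω + 1) ω = ⊤} ≤
      ENNReal.ofReal (Real.exp (-(rate * n))) := by
    intro n
    have := hN.measure_increment_eq_zero hr.le s n
    rw [NNReal.coe_natCast] at this
    rw [← this]
    refine measure_mono fun ω hω => ?_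
    have h2 := (lt_jumpTime_iff hN.isCounting (t := s + n)).1 (hω ▸ ENNReal.coe_lt_top)
    simp only [Set.mem_preimage, Set.mem_singleton_iff]
    omega
  have h2 : Tendsto (fun n : ℕ => ENNReal.ofReal (Real.exp (-(rate * n)))) atTop (𝓝 0) := by
    rw [← ENNReal.ofReal_zero]
    refine ENNReal.tendsto_ofReal (Real.tendsto_exp_neg_atTop_nhds_zero.comp ?_)
    exact tendsto_natCast_atTop_atTop.const_mul_atTop hr
  exact le_antisymm (ge_of_tendsto' h2 h1) zero_le

variable [IsProbabilityMeasure P]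

lemma measure_inter_increment {s u : ℝ≥0} {A : Set Ω}
    (hA : MeasurableSet[past P N hN.measurable s] A) (B : Set ℕ) :
    P (A ∩ (fun ω => N (s + u) ω - N s ω) ⁻¹' B) =
      P A * P ((fun ω => N (s + u) ω - N s ω) ⁻¹' B) := by
  obtain ⟨A', hA', hAA'⟩ := past_le_eventuallyMeasurableSpace hN.measurable s A hA
  have h1 : P (A ∩ (fun ω => N (s + u) ω - N s ω) ⁻¹' B) =
      P (A' ∩ (fun ω => N (s + u) ω - N s ω) ⁻¹' B) := measure_congr (hAA'.inter (ae_eq_refl _))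
  have h2 : P A = P A' := measure_congr hAA'
  rw [h1, h2]
  exact (Indep_iff _ _ _).1 (indep_natural_increment hN.measurable hN.zero hN.mono hN.indep s u)
    A' _ hA' ⟨B, trivial, rfl⟩

lemma indepFun_increment {s u : ℝ≥0} {β : Type*} [MeasurableSpace β] {f : Ω → β}
    (hf : Measurable[past P N hN.measurable s] f) :
    IndepFun f (fun ω => N (s + u) ω - N s ω) P := by
  rw [indepFun_iff_measure_inter_preimage_eq_mul]
  exact fun A B hA _ => hN.measure_inter_increment (hf hA) B

/-- With `x = rate * u`, the dominating function `(3^n - 2 * 2^n + 1) / 2` has Poisson mean `(e^{2x}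
- 2e^x + 1) / 2`, a perfect square and thus quadratic in `u`. -/
lemma measure_two_le_increment (hr : 0 ≤ rate) (s u : ℝ≥0) :
    P.real {ω | 2 ≤ N (s + u) ω - N s ω} ≤ (Real.exp (rate * u) - 1) ^ 2 / 2 := by
  have h2 := hN.integrable_pow_increment s u (zero_le_two (α := ℝ))
  have h3 := hN.integrable_pow_increment s u (zero_le_three (α := ℝ))
  have h32 : Integrable (fun ω => (3 : ℝ) ^ (N (s + u) ω - N s ω) -
      2 * 2 ^ (N (s + u) ω - N s ω)) P := h3.sub (h2.const_mul 2)
  have hi : Integrable (fun ω => ((3 : ℝ) ^ (N (s + u) ω - N s ω) -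
      2 * 2 ^ (N (s + u) ω - N s ω) + 1) / 2) P := (h32.add (integrable_const 1)).div_const 2
  have hm : MeasurableSet {ω | 2 ≤ N (s + u) ω - N s ω} :=
    hN.measurable_increment s u measurableSet_Ici
  have h4 : ∫ ω, ({ω | 2 ≤ N (s + u) ω - N s ω} : Set Ω).indicator (fun _ => (1 : ℝ)) ω ∂P ≤
      ∫ ω, ((3 : ℝ) ^ (N (s + u) ω - N s ω) - 2 * 2 ^ (N (s + u) ω - N s ω) + 1) / 2 ∂P := by
    refine integral_mono ((integrable_const _).indicator hm)
      hi fun ω => ?_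
    simpa [Set.indicator_apply] using indicator_two_le_pow (N (s + u) ω - N s ω)
  rw [integral_indicator_const _ hm, smul_eq_mul, mul_one, integral_div,
    integral_add h32 (integrable_const 1), integral_sub h3 (h2.const_mul 2),
    integral_const_mul, hN.integral_pow_increment hr, hN.integral_pow_increment hr] at h4
  refine h4.trans (le_of_eq ?_)
  have h5 : Real.exp (rate * u * (3 - 1)) = Real.exp (rate * u) ^ 2 := by
    rw [← Real.exp_nat_mul]; push_cast; ring_nf
  rw [h5, show rate * u * (2 - 1) = rate * u by ring]
  simp
  ring

end IsPoissonProcess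

/-! ### Waiting times for the next jump. -/

section Waiting

variable {Ω : Type*} {N : ℝ≥0 → Ω → ℕ}

/-- The waiting time from `s` to the next jump. -/
def waiting (N : ℝ≥0 → Ω → ℕ) (s : ℝ≥0) (ω : Ω) : ℝ :=
  (jumpTime N (N s ω + 1) ω).toReal - s

lemma waiting_pos (hN : IsCounting N) {s : ℝ≥0} {ω : Ω}
    (h : jumpTime N (N s ω + 1) ω ≠ ⊤) : 0 < waiting N s ω :=
  sub_pos.2 (lt_toReal_jumpTime hN (Nat.lt_succ_self _) h)

lemma waiting_le_iff (hN : IsCounting N) {s u : ℝ≥0} {ω : Ω}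
    (h : jumpTime N (N s ω + 1) ω ≠ ⊤) : waiting N s ω ≤ u ↔ N s ω + 1 ≤ N (s + u) ω := by
  rw [← jumpTime_le_iff hN, waiting, sub_le_iff_le_add, add_comm (u : ℝ), ← NNReal.coe_add,
    ← ENNReal.coe_toReal, ENNReal.toReal_le_toReal h ENNReal.coe_ne_top]

variable [mΩ : MeasurableSpace Ω] {P : Measure Ω} [IsProbabilityMeasure P] {rate : ℝ}

lemma measurable_waiting (hN : IsCounting N) (hm : ∀ t, Measurable (N t)) (s : ℝ≥0) :
    Measurable (waiting N s) :=
  (Measurable.apply_nat (f := fun n ω => (jumpTime N (n + 1) ω).toReal) (hm s)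
    fun _ => (measurable_jumpTime hN hm _).ennreal_toReal).sub_const _

/-- Almost surely the waiting time is at most `a` exactly when the increment over `[s, s + a]` is
nonzero, an event independent of `A`. Keeping `A` in the statement yields the exponential law and
the independence of the past at once. -/
lemma IsPoissonProcess.map_waiting_restrict (hN : IsPoissonProcess N rate P) (hr : 0 < rate)
    {s : ℝ≥0} {A : Set Ω} (hA : MeasurableSet[past P N hN.measurable s] A) :
    (P.restrict A).map (waiting N s) = P A • expMeasure rate := by
  have := isProbabilityMeasure_expMeasure hr
  have hc := hN.isCounting
  have hw := measurable_waiting hc hN.measurable s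
  have hA' : MeasurableSet A := (past P N hN.measurable).le s A hA
  have : IsFiniteMeasure ((P.restrict A).map (waiting N s)) := Measure.isFiniteMeasure_map _ _
  refine Measure.ext_of_Iic _ _ fun a => ?_
  rw [Measure.map_apply hw measurableSet_Iic, Measure.restrict_apply (hw measurableSet_Iic),
    Measure.smul_apply, smul_eq_mul, ← ofReal_cdf, cdf_expMeasure_eq hr, Set.inter_comm]
  have hfin := hN.ae_jumpTime_ne_top hr s
  split_ifs with ha
  · lift a to ℝ≥0 using ha
    have h1 : (waiting N s ⁻¹' Set.Iic (a : ℝ) : Set Ω) =ᵐ[P]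
        (fun ω => N (s + a) ω - N s ω) ⁻¹' {0}ᶜ := by
      filter_upwards [hfin] with ω hω
      refine propext ((waiting_le_iff hc hω).trans ?_)
      show _ ↔ ¬ (N (s + a) ω - N s ω = 0)
      omega
    rw [measure_congr (Filter.EventuallyEq.rfl.inter h1), hN.measure_inter_increment hA,
      Set.preimage_compl, prob_compl_eq_one_sub
        (hN.measurable_increment s a (measurableSet_singleton 0)),
      hN.measure_increment_eq_zero hr.le, ENNReal.ofReal_sub _ (Real.exp_pos _).le,
      ENNReal.ofReal_one]
  · have h1 : (waiting N s ⁻¹' Set.Iic a : Set Ω) =ᵐ[P] (∅ : Set Ω) := by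
      filter_upwards [hfin] with ω hω
      refine eq_false ?_
      show ¬ (waiting N s ω ≤ a)
      linarith [waiting_pos hc hω]
    rw [measure_congr (Filter.EventuallyEq.rfl.inter h1)]
    simp

lemma IsPoissonProcess.map_waiting (hN : IsPoissonProcess N rate P) (hr : 0 < rate) (s : ℝ≥0) :
    P.map (waiting N s) = expMeasure rate := by
  simpa using hN.map_waiting_restrict hr (s := s) (A := Set.univ) MeasurableSet.univ

lemma IsPoissonProcess.indepFun_waiting (hN : IsPoissonProcess N rate P) (hr : 0 < rate)
    {s : ℝ≥0} {β : Type*} [MeasurableSpace β] {f : Ω → β}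
    (hf : Measurable[past P N hN.measurable s] f) : IndepFun f (waiting N s) P := by
  have hw := measurable_waiting hN.isCounting hN.measurable s
  rw [indepFun_iff_measure_inter_preimage_eq_mul]
  intro A B hA hB
  have h := congr_arg (· B) (hN.map_waiting_restrict hr (hf hA))
  simp only [Measure.smul_apply, smul_eq_mul, Measure.map_apply hw hB,
    Measure.restrict_apply (hw hB)] at h
  rw [Set.inter_comm, h, ← hN.map_waiting hr s, Measure.map_apply hw hB]

/-- Unit jumps are not part of the definition of the process. If the first two jumps coincide by
time `T`, then among `n` equal cells the one where the path leaves `0` has an increment of at least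
two; each cell does so with probability `O(1 / n²)`. -/
lemma IsPoissonProcess.measure_double_jump_le (hN : IsPoissonProcess N rate P) (hr : 0 < rate)
    (T : ℝ≥0) {n : ℕ} (hn : 0 < n) (hn' : rate * (T / n) ≤ 1) :
    P.real {ω | jumpTime N 1 ω ≤ T ∧ jumpTime N 2 ω = jumpTime N 1 ω} ≤
      2 * (rate * T) ^ 2 / n := by
  have hc := hN.isCounting
  have hn0 : (n : ℝ≥0) ≠ 0 := by exact_mod_cast hn.ne'
  have hsub : {ω | jumpTime N 1 ω ≤ T ∧ jumpTime N 2 ω = jumpTime N 1 ω} ⊆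
      ⋃ k ∈ Finset.range n, {ω | 2 ≤ N (k * (T / n) + T / n) ω - N (k * (T / n)) ω} := by
    rintro ω ⟨h1, h2⟩
    have h3 : 1 ≤ N (n * (T / n)) ω := by
      rw [mul_div_cancel₀ _ hn0]
      exact (jumpTime_le_iff hc).1 h1
    classical
    have hex : ∃ k : ℕ, 1 ≤ N (k * (T / n)) ω := ⟨n, h3⟩
    obtain ⟨k, hk⟩ : ∃ k, Nat.find hex = k + 1 := by
      refine Nat.exists_eq_succ_of_ne_zero fun h0 => ?_
      have := Nat.find_spec hex
      rw [h0, Nat.cast_zero, zero_mul, hN.zero] at this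
      omega
    have hk1 : k + 1 ≤ n := hk ▸ Nat.find_min' hex h3
    have hk2 := Nat.find_spec hex
    have hk3 := Nat.find_min hex (m := k) (by omega)
    rw [hk, Nat.cast_succ, add_mul, one_mul, ← jumpTime_le_iff hc, ← h2,
      jumpTime_le_iff hc] at hk2
    refine Set.mem_biUnion (Finset.mem_coe.2 (Finset.mem_range.2 hk1)) ?_
    show 2 ≤ _
    omega
  have h4 : ((T / n : ℝ≥0) : ℝ) = T / n := by push_cast; rfl
  have hx : 0 ≤ rate * (T / n) := by positivity
  have h5 : Real.exp (rate * (T / n)) - 1 ≤ 2 * (rate * (T / n)) := by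
    have := Real.abs_exp_sub_one_le (x := rate * (T / n)) (by rwa [abs_of_nonneg hx])
    rw [abs_of_nonneg hx] at this
    exact (le_abs_self _).trans this
  have h6 : 0 ≤ Real.exp (rate * (T / n)) - 1 := sub_nonneg.2 (Real.one_le_exp hx)
  calc _ ≤ P.real (⋃ k ∈ Finset.range n,
        {ω | 2 ≤ N (k * (T / n) + T / n) ω - N (k * (T / n)) ω}) := measureReal_mono hsub (measure_ne_top _ _)
    _ ≤ ∑ k ∈ Finset.range n,
        P.real {ω | 2 ≤ N (k * (T / n) + T / n) ω - N (k * (T / n)) ω} :=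
        measureReal_biUnion_finset_le _ _
    _ ≤ ∑ _k ∈ Finset.range n, 2 * (rate * (T / n)) ^ 2 := by
        refine Finset.sum_le_sum fun k _ => (hN.measure_two_le_increment hr.le _ _).trans ?_
        rw [h4]
        nlinarith
    _ = 2 * (rate * T) ^ 2 / n := by
        have : (n : ℝ) ≠ 0 := by exact_mod_cast hn.ne'
        rw [Finset.sum_const, Finset.card_range, nsmul_eq_mul]
        field_simp

/-- Almost surely, the first jump is simple. -/
lemma IsPoissonProcess.ae_jumpTime_one_ne_two (hN : IsPoissonProcess N rate P) (hr : 0 < rate) :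
    ∀ᵐ ω ∂P, jumpTime N 2 ω = jumpTime N 1 ω → jumpTime N 1 ω = ⊤ := by
  have h1 : ∀ T : ℕ, ∀ᵐ ω ∂P,
      ¬ (jumpTime N 1 ω ≤ (T : ℝ≥0) ∧ jumpTime N 2 ω = jumpTime N 1 ω) := by
    intro T
    rw [ae_iff]
    simp only [not_not]
    rw [← measureReal_eq_zero_iff]
    refine le_antisymm ?_ measureReal_nonneg
    have h2 : Tendsto (fun n : ℕ => 2 * (rate * (T : ℝ≥0)) ^ 2 / (n : ℝ)) atTop (𝓝 0) :=
      tendsto_const_div_atTop_nhds_zero_nat _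
    have h3 : Tendsto (fun n : ℕ => rate * (T : ℝ≥0) / (n : ℝ)) atTop (𝓝 0) :=
      tendsto_const_div_atTop_nhds_zero_nat _
    refine ge_of_tendsto h2 ?_
    filter_upwards [eventually_gt_atTop 0, h3.eventually (eventually_le_nhds one_pos)] with n hn hn'
    exact hN.measure_double_jump_le hr T hn (by rwa [← mul_div_assoc])
  filter_upwards [ae_all_iff.2 h1] with ω hω heq
  by_contra htop
  obtain ⟨T, hT⟩ := ENNReal.exists_nat_gt htop
  exact hω T ⟨by exact_mod_cast hT.le, heq⟩

end Waiting

end PoissonDisorder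

end

/-! ### Reduction of the probabilistic single-jump operator to the deterministic one. -/

noncomputable section

namespace PoissonDisorder

section ExtIntegral

variable {α : Type*} [MeasurableSpace α] {μ : Measure α}

lemma extIntegral_mono_ae {f h : α → EReal} (hfh : ∀ᵐ a ∂μ, f a ≤ h a) :
    extIntegral μ f ≤ extIntegral μ h := by
  refine EReal.sub_le_sub (EReal.coe_ennreal_le_coe_ennreal_iff.2 (lintegral_mono_ae ?_))
    (EReal.coe_ennreal_le_coe_ennreal_iff.2 (lintegral_mono_ae ?_))
  · filter_upwards [hfh] with a ha using EReal.toENNReal_le_toENNReal ha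
  · filter_upwards [hfh] with a ha using EReal.toENNReal_le_toENNReal (EReal.neg_le_neg_iff.2 ha)

lemma extIntegral_congr_ae {f h : α → EReal} (hfh : ∀ᵐ a ∂μ, f a = h a) :
    extIntegral μ f = extIntegral μ h :=
  le_antisymm (extIntegral_mono_ae (hfh.mono fun _ ha => ha.le))
    (extIntegral_mono_ae (hfh.mono fun _ ha => ha.ge))

lemma extIntegral_coe {f : α → ℝ} (hf : Integrable f μ) :
    extIntegral μ (fun a => (f a : EReal)) = ((∫ a, f a ∂μ : ℝ) : EReal) := by
  have h1 : ∫⁻ a, ENNReal.ofReal (f a) ∂μ ≠ ⊤ := hf.lintegral_lt_top.ne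
  have h2 : ∫⁻ a, ENNReal.ofReal (-f a) ∂μ ≠ ⊤ := hf.neg.lintegral_lt_top.ne
  rw [integral_eq_lintegral_pos_part_sub_lintegral_neg_part hf, EReal.coe_sub,
    EReal.coe_ennreal_toReal h1, EReal.coe_ennreal_toReal h2]
  rfl

end ExtIntegral

/-- Fubini for the product law: the known variable is frozen and the independent one is integrated
out. -/
lemma IndepFun.integral_comp_eq {Ω β γ : Type*} [MeasurableSpace Ω] [MeasurableSpace β]
    [MeasurableSpace γ] {P : Measure Ω} [IsProbabilityMeasure P] {f : Ω → β} {X : Ω → γ}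
    (h : ProbabilityTheory.IndepFun f X P) (hf : Measurable f) (hX : Measurable X)
    {G : β × γ → ℝ} (hG : Measurable G) (hi : Integrable (fun ω => G (f ω, X ω)) P) :
    ∫ ω, G (f ω, X ω) ∂P = ∫ ω, ∫ r, G (f ω, r) ∂(P.map X) ∂P := by
  have hm := hf.prodMk hX
  have : IsProbabilityMeasure (P.map X) := Measure.isProbabilityMeasure_map hX.aemeasurable
  have hp := (indepFun_iff_map_prod_eq_prod_map_map hf.aemeasurable hX.aemeasurable).1 h
  have hi' : Integrable G ((P.map f).prod (P.map X)) := by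
    rw [← hp, integrable_map_measure hG.aestronglyMeasurable hm.aemeasurable]
    exact hi
  rw [← integral_map (φ := fun ω => (f ω, X ω)) hm.aemeasurable hG.aestronglyMeasurable, hp,
    integral_prod _ hi', integral_map hf.aemeasurable
      hG.stronglyMeasurable.integral_prod_right'.aestronglyMeasurable]

section Exponential

variable {r : ℝ}

lemma expMeasure_eq_withDensity (r : ℝ) :
    expMeasure r = volume.withDensity (exponentialPDF r) := rfl

lemma ae_expMeasure_nonneg (hr : 0 < r) : ∀ᵐ x ∂expMeasure r, 0 ≤ x := by
  have := isProbabilityMeasure_expMeasure hr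
  have h : expMeasure r (Set.Iic 0) = 0 := by
    rw [← ofReal_cdf, cdf_expMeasure_eq hr]
    simp
  rw [ae_iff]
  exact measure_mono_null (fun x hx => (not_le.1 hx).le) h

lemma expMeasure_real_Ioi (hr : 0 < r) {t : ℝ} (ht : 0 ≤ t) :
    (expMeasure r).real (Set.Ioi t) = Real.exp (-(r * t)) := by
  have := isProbabilityMeasure_expMeasure hr
  have h := cdf_expMeasure_eq hr t
  rw [if_pos ht, cdf_eq_real] at h
  rw [← Set.compl_Iic, measureReal_compl measurableSet_Iic, h]
  simp

lemma integral_expMeasure {f : ℝ → ℝ} :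
    ∫ x, f x ∂expMeasure r = ∫ x, (exponentialPDF r x).toReal * f x := by
  have hm : Measurable (exponentialPDF r) := (measurable_exponentialPDFReal r).ennreal_ofReal
  rw [expMeasure_eq_withDensity, integral_withDensity_eq_integral_toReal_smul hm
    (ae_of_all _ fun x => ENNReal.ofReal_lt_top)]
  rfl

lemma toReal_exponentialPDF (hr : 0 ≤ r) {x : ℝ} (hx : 0 ≤ x) :
    (exponentialPDF r x).toReal = r * Real.exp (-(r * x)) := by
  rw [exponentialPDF_of_nonneg hx, ENNReal.toReal_ofReal (by positivity)]

end Exponential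

namespace Params

variable {p : Params} {w : ℝ × ℝ → ℝ} {φ : ℝ × ℝ}

lemma continuous_g : Continuous p.g := by
  unfold g
  fun_prop

lemma continuous_flowCost (φ : ℝ × ℝ) :
    Continuous fun t => Real.exp (-p.lam * t) * p.g (p.flow t φ) :=
  (by fun_prop : Continuous fun t => Real.exp (-p.lam * t)).mul
    (continuous_g.comp (continuous_flow.comp (continuous_id.prodMk continuous_const)))

/-- The cost up to the time `T`, or up to a first jump at the time `r` followed by `w`. -/
def payoff (p : Params) (w : ℝ × ℝ → ℝ) (T : ℝ≥0∞) (φ : ℝ × ℝ) (r : ℝ) : ℝ :=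
  (∫ t in horizon T, if t < r then Real.exp (-p.lam * t) * p.g (p.flow t φ) else 0) +
    if ENNReal.ofReal r ≤ T then Real.exp (-p.lam * r) * w (p.jump (p.flow r φ)) else 0

lemma measurable_payoff_left (T : ℝ≥0∞) : Measurable fun q : (ℝ × ℝ) × ℝ =>
    ∫ t in horizon T, if t < q.2 then Real.exp (-p.lam * t) * p.g (p.flow t q.1) else 0 := by
  have h : Measurable fun q : ((ℝ × ℝ) × ℝ) × ℝ =>
      if q.2 < q.1.2 then Real.exp (-p.lam * q.2) * p.g (p.flow q.2 q.1.1) else 0 := by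
    refine Measurable.ite (measurableSet_lt measurable_snd (measurable_snd.comp measurable_fst)) ?_
      measurable_const
    exact ((measurable_snd.const_mul _).exp).mul (measurable_g.comp (measurable_flow.comp
      (measurable_snd.prodMk (measurable_fst.comp measurable_fst))))
  exact (h.stronglyMeasurable.integral_prod_right (f := fun (q : (ℝ × ℝ) × ℝ) (t : ℝ) =>
    if t < q.2 then Real.exp (-p.lam * t) * p.g (p.flow t q.1) else 0)
    (ν := volume.restrict (horizon T))).measurable

lemma measurable_payoff_right (hw : Measurable w) (T : ℝ≥0∞) :
    Measurable fun q : (ℝ × ℝ) × ℝ => if ENNReal.ofReal q.2 ≤ T then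
      Real.exp (-p.lam * q.2) * w (p.jump (p.flow q.2 q.1)) else 0 := by
  refine Measurable.ite (measurableSet_le (ENNReal.measurable_ofReal.comp measurable_snd)
    measurable_const) ?_ measurable_const
  exact ((measurable_snd.const_mul _).exp).mul (hw.comp (measurable_jump.comp
    (measurable_flow.comp (measurable_snd.prodMk measurable_fst))))

lemma measurable_payoff (hw : Measurable w) (T : ℝ≥0∞) :
    Measurable fun q : (ℝ × ℝ) × ℝ => p.payoff w T q.1 q.2 :=
  (measurable_payoff_left T).add (measurable_payoff_right hw T)

lemma opIntegrand_zero (t : ℝ) : p.opIntegrand (fun _ => 0) φ t =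
    Real.exp (-(p.mu * t)) * (Real.exp (-p.lam * t) * p.g (p.flow t φ)) := by
  rw [opIntegrand, ← mul_assoc, ← Real.exp_add]
  ring_nf

/-- By Fubini, the cost rate at time `t` is charged with the probability `e^{-mu t}` that the jump
comes after `t`. -/
lemma integral_payoff_left (hp : p.Admissible) (hφ : φ ∈ quadrant) (T : ℝ≥0∞) :
    Integrable (fun r => ∫ t in horizon T,
      if t < r then Real.exp (-p.lam * t) * p.g (p.flow t φ) else 0) (expMeasure p.mu) ∧
    ∫ r, (∫ t in horizon T, if t < r then Real.exp (-p.lam * t) * p.g (p.flow t φ) else 0)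
      ∂expMeasure p.mu = p.op (fun _ => 0) T φ := by
  have hmu : 0 < p.mu := by linarith [hp.one_lt_mu]
  have := isProbabilityMeasure_expMeasure hmu
  set c : ℝ → ℝ := fun t => Real.exp (-p.lam * t) * p.g (p.flow t φ) with hc
  have hcm : Measurable c := (continuous_flowCost φ).measurable
  let F : ℝ → ℝ → ℝ := fun r t => if t < r then c t else 0
  have hF : Measurable (Function.uncurry F) :=
    Measurable.ite (measurableSet_lt measurable_snd measurable_fst)
      (hcm.comp measurable_snd) measurable_const
  have hF' : ∀ t, (fun r => F r t) = (Set.Ioi t).indicator fun _ => c t := by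
    intro t
    ext r
    simp [F, Set.indicator_apply]
  have hint : ∀ t ∈ horizon T, ∫ r, F r t ∂expMeasure p.mu = p.opIntegrand (fun _ => 0) φ t := by
    intro t ht
    rw [hF', integral_indicator_const _ measurableSet_Ioi, expMeasure_real_Ioi hmu ht.1,
      opIntegrand_zero, smul_eq_mul]
  have hi0 := integrableOn_opIntegrand hp (isCandidate_zero hp) hφ T
  have hi : Integrable (Function.uncurry F)
      ((expMeasure p.mu).prod (volume.restrict (horizon T))) := by
    rw [integrable_prod_iff' hF.aestronglyMeasurable]
    refine ⟨ae_of_all _ fun t => ?_, hi0.norm.congr ?_⟩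
    · change Integrable (fun r => F r t) _
      rw [hF']
      exact (integrable_const _).indicator measurableSet_Ioi
    · filter_upwards [ae_restrict_mem (measurableSet_horizon T)] with t ht
      have : ∀ r, ‖Function.uncurry F (r, t)‖ = (Set.Ioi t).indicator (fun _ => ‖c t‖) r := by
        intro r
        change ‖F r t‖ = _
        rw [congr_fun (hF' t) r]
        exact norm_indicator_eq_indicator_norm _ _
      simp only [this]
      rw [integral_indicator_const _ measurableSet_Ioi, expMeasure_real_Ioi hmu ht.1,
        opIntegrand_zero, smul_eq_mul, norm_mul, Real.norm_of_nonneg (Real.exp_pos _).le]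
  refine ⟨hi.integral_prod_left, ?_⟩
  rw [integral_integral_swap hi]
  exact setIntegral_congr_fun (measurableSet_horizon T) hint

/-- The density `mu * e^{-mu r}` combines with the discount into the jump term of the operator. -/
lemma integral_payoff_right (hp : p.Admissible) (hw : p.IsCandidate w) (hφ : φ ∈ quadrant)
    (T : ℝ≥0∞) :
    Integrable (fun r => if ENNReal.ofReal r ≤ T then
      Real.exp (-p.lam * r) * w (p.jump (p.flow r φ)) else 0) (expMeasure p.mu) ∧
    ∫ r, (if ENNReal.ofReal r ≤ T then Real.exp (-p.lam * r) * w (p.jump (p.flow r φ)) else 0)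
      ∂expMeasure p.mu = ∫ t in horizon T, Real.exp (-(p.lam + p.mu) * t) *
        (p.mu * w (p.jump (p.flow t φ))) := by
  have hmu : 0 < p.mu := by linarith [hp.one_lt_mu]
  have := isProbabilityMeasure_expMeasure hmu
  constructor
  · refine Integrable.mono' (integrable_const p.bound)
      ((measurable_payoff_right hw.measurable T).comp measurable_prodMk_left).aestronglyMeasurable
      ?_
    filter_upwards [ae_expMeasure_nonneg hmu] with r hr
    have hj := jump_mem hp (flow_mem hp hr hφ)
    have h1 : |w (p.jump (p.flow r φ))| ≤ p.bound :=
      abs_le.2 ⟨hw.neg_bound_le _ hj, (hw.nonpos _ hj).trans (bound_pos hp).le⟩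
    have h2 : Real.exp (-p.lam * r) ≤ 1 :=
      Real.exp_le_one_iff.2 (by have := mul_nonneg hp.lam_pos.le hr; linarith)
    split_ifs
    · rw [norm_mul, Real.norm_of_nonneg (Real.exp_pos _).le]
      calc _ ≤ 1 * p.bound := mul_le_mul h2 h1 (abs_nonneg _) zero_le_one
        _ = _ := one_mul _
    · simpa using (bound_pos hp).le
  · rw [integral_expMeasure, ← integral_indicator (measurableSet_horizon T)]
    refine integral_congr_ae ?_
    -- A jump exactly at `T` is paid, while the horizon is half-open; the two sets differ by one
    -- null point.
    have h0 : ∀ᵐ r : ℝ, r ≠ T.toReal := by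
      rw [ae_iff]
      simp
    filter_upwards [h0] with r hr
    rcases lt_or_ge r 0 with hneg | hnn
    · rw [exponentialPDF_of_neg hneg, Set.indicator_of_notMem fun h => not_le.2 hneg h.1]
      simp
    · have hne : ENNReal.ofReal r ≠ T := by
        rintro rfl
        exact hr (ENNReal.toReal_ofReal hnn).symm
      classical
      rw [toReal_exponentialPDF hmu.le hnn, Set.indicator_apply]
      have hiff : r ∈ horizon T ↔ ENNReal.ofReal r ≤ T :=
        ⟨fun h => h.2.le, fun h => ⟨hnn, lt_of_le_of_ne h hne⟩⟩
      simp only [hiff]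
      split_ifs
      · rw [show -(p.lam + p.mu) * r = -(p.mu * r) + -p.lam * r by ring, Real.exp_add]
        ring
      · simp

/-- The expectation of the payoff at an exponential time is the deterministic operator. -/
lemma integral_payoff (hp : p.Admissible) (hw : p.IsCandidate w) (hφ : φ ∈ quadrant)
    (T : ℝ≥0∞) : Integrable (p.payoff w T φ) (expMeasure p.mu) ∧
      ∫ r, p.payoff w T φ r ∂expMeasure p.mu = p.op w T φ := by
  obtain ⟨h1, h2⟩ := integral_payoff_left hp hφ T
  obtain ⟨h3, h4⟩ := integral_payoff_right hp hw hφ T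
  refine ⟨h1.add h3, ?_⟩
  have hi0 := integrableOn_opIntegrand hp (isCandidate_zero hp) hφ T
  have hi := integrableOn_opIntegrand hp hw hφ T
  have he : ∀ t, Real.exp (-(p.lam + p.mu) * t) * (p.mu * w (p.jump (p.flow t φ))) =
      p.opIntegrand w φ t - p.opIntegrand (fun _ => 0) φ t := by
    intro t
    simp only [opIntegrand]
    ring
  unfold payoff
  rw [integral_add h1 h3, h2, h4]
  simp only [he]
  rw [integral_sub hi hi0, op, op]
  ring

variable {Ω : Type*} {N : ℝ≥0 → Ω → ℕ}

lemma statistic_of_lt_jumpTime_one (hN : IsCounting N) {t : ℝ} (ht : 0 ≤ t) {ω : Ω}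
    (h : ENNReal.ofReal t < jumpTime N 1 ω) :
    p.statistic N φ t.toNNReal ω = p.flow t φ := by
  have h0 : N t.toNNReal ω = 0 := Nat.lt_one_iff.1 ((lt_jumpTime_iff hN).1 h)
  rw [statistic, h0, jumpTime_zero, Real.coe_toNNReal _ ht]
  simp [postJump]

lemma statistic_jumpTime_one (hN : IsCounting N) {ω : Ω} (h1 : jumpTime N 1 ω ≠ ⊤)
    (h2 : jumpTime N 2 ω ≠ jumpTime N 1 ω) :
    p.statistic N φ (jumpTime N 1 ω).toNNReal ω =
      p.jump (p.flow (jumpTime N 1 ω).toReal φ) := by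
  have h3 : 1 ≤ N (jumpTime N 1 ω).toNNReal ω :=
    (jumpTime_le_iff hN).1 (ENNReal.coe_toNNReal h1).ge
  have h4 : N (jumpTime N 1 ω).toNNReal ω < 2 := by
    rw [← lt_jumpTime_iff hN, ENNReal.coe_toNNReal h1]
    exact lt_of_le_of_ne (jumpTime_mono N ω one_le_two) h2.symm
  have h5 : N (jumpTime N 1 ω).toNNReal ω = N 0 ω + 1 := by
    rw [hN.zero]
    omega
  rw [statistic_of_eq_succ h5, statistic_zero hN, hN.zero, NNReal.coe_zero, sub_zero]
  change p.flow ((jumpTime N 1 ω).toReal - (jumpTime N 1 ω).toReal) _ = _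
  rw [sub_self, flow_zero]

lemma runningCost_of_le_jumpTime_one (hN : IsCounting N) {T : ℝ≥0∞} (hT : T ≠ ⊤) {ω : Ω}
    (h : T ≤ jumpTime N 1 ω) : p.runningCost N φ T ω =
      ((∫ t in horizon T, Real.exp (-p.lam * t) * p.g (p.flow t φ) : ℝ) : EReal) := by
  have hi : IntegrableOn (fun t => Real.exp (-p.lam * t) * p.g (p.flow t φ)) (horizon T) := by
    refine ((continuous_flowCost φ).continuousOn.integrableOn_Icc (a := 0) (b := T.toReal)).mono_set
      fun t ht => ⟨ht.1, ?_⟩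
    exact (ENNReal.ofReal_le_iff_le_toReal hT).1 ht.2.le
  rw [← extIntegral_coe hi]
  refine extIntegral_congr_ae ?_
  filter_upwards [ae_restrict_mem (measurableSet_horizon T)] with t ht
  rw [statistic_of_lt_jumpTime_one hN ht.1 (ht.2.trans_le h)]

lemma horizon_min_eq {T S : ℝ≥0∞} (hS : S ≠ ⊤) :
    horizon (min T S) = horizon T ∩ Set.Iio S.toReal := by
  ext t
  simp only [horizon, Set.mem_ofPred_eq, lt_min_iff, Set.mem_inter_iff, Set.mem_Iio, and_assoc]
  exact and_congr_right fun ht => and_congr_right fun _ =>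
    ENNReal.ofReal_lt_iff_lt_toReal ht hS

variable [MeasurableSpace Ω] {P : Measure Ω}

lemma J₀_mono (hp : p.Admissible) {W W' : ℝ × ℝ → EReal}
    (h : ∀ ψ ∈ quadrant, W ψ ≤ W' ψ) (hφ : φ ∈ quadrant) :
    p.J₀ N P W φ ≤ p.J₀ N P W' φ := by
  refine iInf_mono fun T => extIntegral_mono_ae (ae_of_all _ fun ω => add_le_add_right ?_ _)
  split_ifs
  · exact mul_le_mul_of_nonneg_left (h _ (statistic_mem hp hφ _ ω))
      (EReal.coe_nonneg.2 (Real.exp_pos _).le)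
  · exact le_rfl

/-- Only monotonicity of `J₀` is used, starting from `U ≤ 0`. Since the extended integral is
monotone for arbitrary functions, `U` may be unbounded below or equal to `⊥`. -/
lemma le_v_of_isNonposSolution (hp : p.Admissible) {U : ℝ × ℝ → EReal}
    (hU : p.IsNonposSolution N P U) (n : ℕ) : ∀ φ ∈ quadrant, U φ ≤ p.v N P n φ := by
  induction n with
  | zero => exact hU.2.1
  | succ n ih => exact fun φ hφ => (hU.2.2 φ hφ).trans_le (J₀_mono hp ih hφ)

variable [IsProbabilityMeasure P]

/-- The single-jump operator is given by an explicit deterministic integral. -/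
lemma J_eq_op (hp : p.Admissible) (hN : IsPoissonProcess N p.mu P) (hw : p.IsCandidate w)
    {W : ℝ × ℝ → EReal} (hW : ∀ ψ ∈ quadrant, W ψ = (w ψ : EReal)) (hφ : φ ∈ quadrant)
    (T : ℝ≥0∞) : p.J N P W T φ = ((p.op w T φ : ℝ) : EReal) := by
  have hmu : 0 < p.mu := by linarith [hp.one_lt_mu]
  have hc := hN.isCounting
  have hwm := measurable_waiting hc hN.measurable 0
  obtain ⟨hi, he⟩ := integral_payoff hp hw hφ T
  have hpm : Measurable (p.payoff w T φ) :=
    (measurable_payoff hw.measurable T).comp measurable_prodMk_left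
  rw [← hN.map_waiting hmu 0] at hi he
  rw [integral_map hwm.aemeasurable hpm.aestronglyMeasurable] at he
  have hi' : Integrable (fun ω => p.payoff w T φ (waiting N 0 ω)) P := hi.comp_measurable hwm
  rw [J, ← he, ← extIntegral_coe hi']
  refine extIntegral_congr_ae ?_
  filter_upwards [hN.ae_jumpTime_ne_top hmu 0, hN.ae_jumpTime_one_ne_two hmu] with ω h1 h2
  rw [hN.zero, zero_add] at h1
  have h2' : jumpTime N 2 ω ≠ jumpTime N 1 ω := fun h => h1 (h2 h)
  have hwait : waiting N 0 ω = (jumpTime N 1 ω).toReal := by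
    simp [waiting, hN.zero]
  rw [runningCost_of_le_jumpTime_one hc (ne_top_of_le_ne_top h1 (min_le_right _ _))
    (min_le_right _ _), statistic_jumpTime_one hc h1 h2', hwait, payoff,
    EReal.coe_add, ENNReal.ofReal_toReal h1, horizon_min_eq h1,
    ← setIntegral_indicator measurableSet_Iio]
  congr 1
  have hj := jump_mem hp (flow_mem hp (ENNReal.toReal_nonneg (a := jumpTime N 1 ω)) hφ)
  simp only [h1.lt_top, and_true]
  split_ifs
  · rw [hW _ hj, EReal.coe_mul]
  · rfl

lemma J₀_eq_opInf (hp : p.Admissible) (hN : IsPoissonProcess N p.mu P) (hw : p.IsCandidate w)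
    {W : ℝ × ℝ → EReal} (hW : ∀ ψ ∈ quadrant, W ψ = (w ψ : EReal)) (hφ : φ ∈ quadrant) :
    p.J₀ N P W φ = ((p.opInf w φ : ℝ) : EReal) := by
  rw [J₀, ← iInf_op_eq hp hw hφ]
  exact iInf_congr fun T => J_eq_op hp hN hw hW hφ T

lemma v_eq_approx (hp : p.Admissible) (hN : IsPoissonProcess N p.mu P) (n : ℕ) :
    ∀ φ ∈ quadrant, p.v N P n φ = ((p.approx n φ : ℝ) : EReal) := by
  induction n with
  | zero => exact fun _ _ => rfl
  | succ n ih => exact fun φ hφ => J₀_eq_opInf hp hN (isCandidate_approx hp n) ih hφ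

end Params

end PoissonDisorder

end

/-! ### One time step, path by path. -/

noncomputable section

namespace PoissonDisorder

namespace Params

section Pathwise

variable {p : Params} {w : ℝ × ℝ → ℝ} {φ : ℝ × ℝ}

/-- The cost over a time step `h`, with the payment `w` at the first jump, at the time `r`, or at
the end of the step. -/
def stepPayoff (p : Params) (w : ℝ × ℝ → ℝ) (h : ℝ) (φ : ℝ × ℝ) (r : ℝ) : ℝ :=
  p.payoff w (ENNReal.ofReal h) φ r + if h < r then Real.exp (-p.lam * h) * w (p.flow h φ) else 0

lemma measurable_stepPayoff (hw : Measurable w) (h : ℝ) :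
    Measurable fun q : (ℝ × ℝ) × ℝ => p.stepPayoff w h q.1 q.2 :=
  (measurable_payoff hw _).add (Measurable.ite (measurableSet_lt measurable_const measurable_snd)
    ((hw.comp (measurable_flow.comp (measurable_const.prodMk measurable_fst))).const_mul _)
    measurable_const)

/-- No jump during the step has probability `e^{-mu h}`, which turns the terminal discount `e^{-lam
h}` into the weight occurring in `continuation`. -/
lemma integral_stepPayoff (hp : p.Admissible) (hw : p.IsCandidate w) (hφ : φ ∈ quadrant) {h : ℝ}
    (hh : 0 ≤ h) : ∫ r, p.stepPayoff w h φ r ∂expMeasure p.mu = p.continuation w h φ := by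
  have hmu : 0 < p.mu := by linarith [hp.one_lt_mu]
  have := isProbabilityMeasure_expMeasure hmu
  obtain ⟨h1, h2⟩ := integral_payoff hp hw hφ (ENNReal.ofReal h)
  have h3 : (fun r => if h < r then Real.exp (-p.lam * h) * w (p.flow h φ) else 0) =
      (Set.Ioi h).indicator fun _ => Real.exp (-p.lam * h) * w (p.flow h φ) := by
    ext r
    simp [Set.indicator_apply]
  have h4 : Integrable (fun r => if h < r then Real.exp (-p.lam * h) * w (p.flow h φ) else 0)
      (expMeasure p.mu) := by
    rw [h3]
    exact (integrable_const _).indicator measurableSet_Ioi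
  unfold stepPayoff
  rw [integral_add h1 h4, h2, h3, integral_indicator_const _ measurableSet_Ioi,
    expMeasure_real_Ioi hmu hh, smul_eq_mul, ← mul_assoc, ← Real.exp_add, continuation]
  ring_nf

/-- The error of neglecting further jumps in a time step `h` with `n` jumps. -/
def stepError (h : ℝ) (n : ℕ) : ℝ := h * (2 ^ n - 1) + (3 ^ n - 2 * 2 ^ n + 1)

lemma two_pow_sub_one_nonneg (n : ℕ) : (0 : ℝ) ≤ 2 ^ n - 1 :=
  sub_nonneg.2 (one_le_pow₀ one_le_two)

lemma second_difference_nonneg (n : ℕ) : (0 : ℝ) ≤ 3 ^ n - 2 * 2 ^ n + 1 := by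
  have h := indicator_two_le_pow n
  split_ifs at h <;> linarith

lemma stepError_nonneg {h : ℝ} (hh : 0 ≤ h) (n : ℕ) : 0 ≤ stepError h n :=
  add_nonneg (mul_nonneg hh (two_pow_sub_one_nonneg n)) (second_difference_nonneg n)

/-- The Lipschitz constant of a fixed point along the flow, relative to the size. -/
def flowConst (p : Params) : ℝ := (p.lam + p.mu) * p.bound + (1 + p.mu * p.bound)

lemma flowConst_nonneg (hp : p.Admissible) : 0 ≤ p.flowConst := by
  have := hp.lam_pos
  have := hp.one_lt_mu
  have := bound_pos hp
  unfold flowConst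
  positivity

lemma abs_exp_mul_flow_sub_le (hp : p.Admissible) (hw : p.IsFixed w) (hφ : φ ∈ quadrant) {h : ℝ}
    (hh : 0 ≤ h) : |Real.exp (-p.lam * h) * w (p.flow h φ) - w φ| ≤ p.flowConst * size φ * h := by
  have h1 := exp_mul_flow_sub_le hp hw hφ hh
  have h2 := le_exp_mul_flow_add hp hw hφ hh
  have hs : 0 ≤ (p.lam + p.mu) * p.bound * h :=
    mul_nonneg (mul_nonneg (by linarith [hp.lam_pos, hp.one_lt_mu]) (bound_pos hp).le) hh
  have ht : 0 ≤ (1 + p.mu * p.bound) * size φ * h :=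
    mul_nonneg (mul_nonneg (by nlinarith [hp.one_lt_mu, bound_pos hp]) (size_pos hφ).le) hh
  have h3 := mul_le_mul_of_nonneg_left (one_le_size hφ) hs
  unfold flowConst
  rw [abs_le]
  constructor <;> nlinarith

/-- The constant in the error of a time step. -/
def stepConst (p : Params) : ℝ :=
  2 * (p.gConst + p.flowConst) * Real.exp (p.lam + 1) + p.bound

lemma stepConst_nonneg (hp : p.Admissible) : 0 ≤ p.stepConst := by
  have := gConst_pos hp
  have := bound_pos hp
  have := flowConst_nonneg hp
  unfold stepConst
  positivity

lemma exp_neg_lam_mul_le_one (hp : p.Admissible) {t : ℝ} (ht : 0 ≤ t) :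
    Real.exp (-p.lam * t) ≤ 1 :=
  Real.exp_le_one_iff.2 (by have := mul_nonneg hp.lam_pos.le ht; linarith)

variable {Ω : Type*} {N : ℝ≥0 → Ω → ℕ}

lemma abs_costRate_le (hp : p.Admissible) (hN : IsCounting N) (hφ : φ ∈ quadrant) {t : ℝ}
    (ht : 0 ≤ t) {b : ℝ≥0} (htb : t ≤ b) (ω : Ω) : |p.costRate N φ t ω| ≤
      p.gConst * (2 ^ (N b ω - N 0 ω) * Real.exp ((p.lam + 1) * b) * size φ) := by
  have h1 := abs_g_le hp (statistic_mem (N := N) hp hφ t.toNNReal ω)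
  have h2 := size_statistic_le (ω := ω) hp hN hφ (zero_le (a := t.toNNReal))
  rw [statistic_zero hN, hN.zero, Real.coe_toNNReal _ ht] at h2
  have h3 : N t.toNNReal ω ≤ N b ω := hN.mono ω (Real.toNNReal_le_iff_le_coe.2 htb)
  have h4 : (2 : ℝ) ^ (N t.toNNReal ω - 0) ≤ 2 ^ (N b ω - N 0 ω) :=
    pow_le_pow_right₀ one_le_two (by rw [hN.zero]; omega)
  have h5 : Real.exp ((p.lam + 1) * (t - (0 : ℝ≥0))) ≤ Real.exp ((p.lam + 1) * b) :=
    Real.exp_le_exp.2 (mul_le_mul_of_nonneg_left (by simpa using htb) (by linarith [hp.lam_pos]))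
  rw [costRate, abs_mul, abs_of_pos (Real.exp_pos _)]
  calc _ ≤ 1 * |p.g (p.statistic N φ t.toNNReal ω)| :=
        mul_le_mul_of_nonneg_right (exp_neg_lam_mul_le_one hp ht) (abs_nonneg _)
    _ ≤ p.gConst * size (p.statistic N φ t.toNNReal ω) := by rw [one_mul]; exact h1
    _ ≤ _ := by
        refine mul_le_mul_of_nonneg_left (h2.trans ?_) (gConst_pos hp).le
        exact mul_le_mul_of_nonneg_right (mul_le_mul h4 h5 (Real.exp_pos _).le (by positivity))
          (size_pos hφ).le

/-- The discounted running cost over the time step from `s` to `s + h`. -/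
def stepCost (p : Params) (N : ℝ≥0 → Ω → ℕ) (φ : ℝ × ℝ) (s h : ℝ≥0) (ω : Ω) : ℝ :=
  ∫ t in Set.Ico (s : ℝ) ((s + h : ℝ≥0) : ℝ), p.costRate N φ t ω

lemma abs_stepCost_le (hp : p.Admissible) (hN : IsCounting N) (hφ : φ ∈ quadrant) (s h : ℝ≥0)
    (ω : Ω) : |p.stepCost N φ s h ω| ≤ p.gConst *
      (2 ^ (N (s + h) ω - N 0 ω) * Real.exp ((p.lam + 1) * (s + h : ℝ≥0)) * size φ) * h := by
  have h1 := norm_setIntegral_le_of_norm_le_const (μ := volume)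
    (s := Set.Ico (s : ℝ) ((s + h : ℝ≥0) : ℝ)) (f := fun t => p.costRate N φ t ω) (by simp)
    fun t ht => abs_costRate_le hp hN hφ (s.coe_nonneg.trans ht.1) ht.2.le ω
  refine h1.trans (le_of_eq ?_)
  simp

lemma stepCost_eq (s h : ℝ≥0) (ω : Ω) :
    p.stepCost N φ s h ω = Real.exp (-p.lam * s) * ∫ u in Set.Ico (0 : ℝ) h,
      Real.exp (-p.lam * u) * p.g (p.statistic N φ (s + u.toNNReal) ω) := by
  have hme : MeasurableEmbedding fun t : ℝ => (s : ℝ) + t := measurableEmbedding_addLeft _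
  have h1 : Set.Ico (s : ℝ) ((s + h : ℝ≥0) : ℝ) = (fun t : ℝ => (s : ℝ) + t) '' Set.Ico 0 h := by
    rw [Set.image_const_add_Ico, add_zero, NNReal.coe_add]
  rw [stepCost, h1, (measurePreserving_add_left volume (s : ℝ)).setIntegral_image_emb hme,
    ← integral_const_mul]
  refine setIntegral_congr_fun measurableSet_Ico fun u hu => ?_
  simp only [costRate]
  rw [Real.toNNReal_add s.coe_nonneg hu.1, Real.toNNReal_coe, mul_add, Real.exp_add, mul_assoc]

/-- With no jump the payments agree. With one jump, the payments at the jump and at the end of the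
step differ by the Lipschitz estimate along the flow, and `stepError` equals `h`. With more jumps,
both payments lie in `[-bound, 0]` and `stepError` is at least one. -/
lemma abs_terminal_sub_le (hp : p.Admissible) (hN : IsCounting N) (hw : p.IsFixed w)
    (hφ : φ ∈ quadrant) (s : ℝ≥0) {h : ℝ≥0} (hh : h ≤ 1) {ω : Ω}
    (hfin : jumpTime N (N s ω + 1) ω ≠ ⊤) :
    |Real.exp (-p.lam * h) * w (p.statistic N φ (s + h) ω) -
      ((if waiting N s ω ≤ h then Real.exp (-p.lam * waiting N s ω) *
          w (p.jump (p.flow (waiting N s ω) (p.statistic N φ s ω))) else 0) +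
        if h < waiting N s ω then
          Real.exp (-p.lam * h) * w (p.flow h (p.statistic N φ s ω)) else 0)| ≤
      (2 * p.flowConst * Real.exp (p.lam + 1) + p.bound) * size (p.statistic N φ s ω) *
        stepError h (N (s + h) ω - N s ω) := by
  have hs := statistic_mem (N := N) hp hφ s ω
  have hl : 0 < p.lam + 1 := by linarith [hp.lam_pos]
  have h1 : (h : ℝ) ≤ 1 := hh
  have hF := flowConst_nonneg hp
  have hB := (bound_pos hp).le
  have hS := one_le_size hs
  have hK : 0 ≤ (2 * p.flowConst * Real.exp (p.lam + 1) + p.bound) *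
      size (p.statistic N φ s ω) := by positivity
  have hwl := waiting_le_iff hN (u := h) hfin
  have hpos := waiting_pos hN hfin
  have hmon : N s ω ≤ N (s + h) ω := hN.mono ω le_self_add
  have hneg : ∀ ψ ∈ quadrant, ∀ t : ℝ, 0 ≤ t → Real.exp (-p.lam * t) * w ψ ≤ 0 ∧
      -p.bound ≤ Real.exp (-p.lam * t) * w ψ := by
    intro ψ hψ t ht
    have e1 := exp_neg_lam_mul_le_one hp ht
    have e2 := Real.exp_pos (-p.lam * t)
    have e3 := hw.nonpos ψ hψ
    have e4 := hw.neg_bound_le ψ hψ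
    constructor <;> nlinarith
  rcases lt_or_ge (h : ℝ) (waiting N s ω) with hlt | hle
  · have heq : N (s + h) ω = N s ω := by
      have := mt hwl.2 (not_le.2 hlt)
      omega
    rw [if_neg (not_le.2 hlt), if_pos hlt, zero_add, statistic_of_eq heq, NNReal.coe_add,
      add_sub_cancel_left, sub_self, abs_zero]
    exact mul_nonneg hK (stepError_nonneg h.coe_nonneg _)
  · have hge := hwl.1 hle
    rw [if_pos hle, if_neg (not_lt.2 hle), add_zero]
    have hψ := jump_mem hp (flow_mem hp hpos.le hs)
    rcases hge.eq_or_lt with heq | hgt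
    · have e1 := statistic_of_eq_succ (p := p) (φ := φ) heq.symm
      have e2 : (jumpTime N (N s ω + 1) ω).toReal = s + waiting N s ω := by
        simp [waiting]
      rw [e2, NNReal.coe_add, add_sub_add_left_eq_sub, add_sub_cancel_left] at e1
      have e3 := abs_exp_mul_flow_sub_le hp hw hψ (sub_nonneg.2 hle)
      have e4 : Real.exp (-p.lam * h) =
          Real.exp (-p.lam * waiting N s ω) * Real.exp (-p.lam * (h - waiting N s ω)) := by
        rw [← Real.exp_add]; ring_nf
      have e5 := (size_jump_le hp (flow_mem hp hpos.le hs)).trans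
        (mul_le_mul_of_nonneg_left (size_flow_le hp hpos.le hs) zero_le_two)
      have e6 : Real.exp ((p.lam + 1) * waiting N s ω) ≤ Real.exp (p.lam + 1) :=
        Real.exp_le_exp.2 (mul_le_of_le_one_right hl.le (hle.trans h1))
      -- The factor `2 * e^{lam + 1}` of the constant: at most one doubling, after flowing for at
      -- most one unit of time.
      have e7 : size (p.jump (p.flow (waiting N s ω) (p.statistic N φ s ω))) ≤
          2 * (Real.exp (p.lam + 1) * size (p.statistic N φ s ω)) :=
        e5.trans (mul_le_mul_of_nonneg_left (mul_le_mul_of_nonneg_right e6 (size_pos hs).le)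
          zero_le_two)
      have e8 : stepError h (N (s + h) ω - N s ω) = h := by
        rw [← heq, Nat.add_sub_cancel_left, stepError]
        norm_num
      rw [e1, e4, e8, mul_assoc, ← mul_sub, abs_mul, abs_of_pos (Real.exp_pos _)]
      calc _ ≤ 1 * (p.flowConst * size (p.jump (p.flow (waiting N s ω) (p.statistic N φ s ω))) *
              (h - waiting N s ω)) :=
            mul_le_mul (exp_neg_lam_mul_le_one hp hpos.le) e3 (abs_nonneg _) zero_le_one
        _ ≤ 1 * (p.flowConst * (2 * (Real.exp (p.lam + 1) * size (p.statistic N φ s ω))) * h) := by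
            have := sub_nonneg.2 hle
            gcongr
            linarith
        _ ≤ _ := by
            have : 0 ≤ p.bound * size (p.statistic N φ s ω) * h := by positivity
            linarith
    · have e1 := hneg _ (statistic_mem (N := N) hp hφ (s + h) ω) h h.coe_nonneg
      have e2 := hneg _ hψ (waiting N s ω) hpos.le
      have e3 : 1 ≤ stepError h (N (s + h) ω - N s ω) := by
        have := indicator_two_le_pow (N (s + h) ω - N s ω)
        rw [if_pos (by omega)] at this
        have := mul_nonneg h.coe_nonneg (two_pow_sub_one_nonneg (N (s + h) ω - N s ω))
        unfold stepError
        change (0 : ℝ) ≤ h * _ at this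
        linarith
      have e4 : p.bound ≤ (2 * p.flowConst * Real.exp (p.lam + 1) + p.bound) *
          size (p.statistic N φ s ω) := by
        have : 0 ≤ 2 * p.flowConst * Real.exp (p.lam + 1) := by positivity
        nlinarith
      have e5 := le_mul_of_one_le_right hK e3
      rw [abs_le]
      constructor <;> linarith [e1.1, e1.2, e2.1, e2.2]

variable [MeasurableSpace Ω]

lemma integrableOn_costRate (hp : p.Admissible) (hN : IsCounting N) (hm : ∀ t, Measurable (N t))
    (hφ : φ ∈ quadrant) {a : ℝ} (ha : 0 ≤ a) (b : ℝ≥0) (ω : Ω) :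
    IntegrableOn (fun t => p.costRate N φ t ω) (Set.Ico a b) := by
  refine Measure.integrableOn_of_bounded (by simp)
    ((measurable_uncurry_costRate hN hm).comp measurable_prodMk_right).aestronglyMeasurable
    ?_ (M := p.gConst * (2 ^ (N b ω - N 0 ω) * Real.exp ((p.lam + 1) * b) * size φ))
  filter_upwards [ae_restrict_mem measurableSet_Ico] with t ht
  exact abs_costRate_le hp hN hφ (ha.trans ht.1) ht.2.le ω

lemma measurable_stepCost (hN : IsCounting N) (hm : ∀ t, Measurable (N t)) (s h : ℝ≥0) :
    Measurable (p.stepCost N φ s h) :=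
  ((measurable_uncurry_costRate hN hm).stronglyMeasurable.integral_prod_left'
    (μ := volume.restrict (Set.Ico (s : ℝ) ((s + h : ℝ≥0) : ℝ)))).measurable

/-- The integrands agree before the first jump of the step; afterwards only the true path is
charged, and its growth factor `2^n` is controlled. -/
lemma abs_integral_g_sub_le (hp : p.Admissible) (hN : IsCounting N) (hm : ∀ t, Measurable (N t))
    (hφ : φ ∈ quadrant) (s : ℝ≥0) {h : ℝ≥0} (hh : h ≤ 1) {ω : Ω}
    (hfin : jumpTime N (N s ω + 1) ω ≠ ⊤) :
    |(∫ u in Set.Ico (0 : ℝ) h, Real.exp (-p.lam * u) * p.g (p.statistic N φ (s + u.toNNReal) ω)) -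
      ∫ u in Set.Ico (0 : ℝ) h, if u < waiting N s ω then
        Real.exp (-p.lam * u) * p.g (p.flow u (p.statistic N φ s ω)) else 0| ≤
      2 * p.gConst * Real.exp (p.lam + 1) * size (p.statistic N φ s ω) *
        (h * (2 ^ (N (s + h) ω - N s ω) - 1)) := by
  have hs := statistic_mem (N := N) hp hφ s ω
  have hl : 0 < p.lam + 1 := by linarith [hp.lam_pos]
  have h1 : (h : ℝ) ≤ 1 := hh
  have hi1 : IntegrableOn (fun u : ℝ => Real.exp (-p.lam * u) *
      p.g (p.statistic N φ (s + u.toNNReal) ω)) (Set.Ico (0 : ℝ) h) := by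
    have h2 := integrableOn_costRate hp hN hm hφ s.coe_nonneg (s + h) ω
    have hme : MeasurableEmbedding fun t : ℝ => (s : ℝ) + t := measurableEmbedding_addLeft _
    have h3 : Set.Ico (s : ℝ) ((s + h : ℝ≥0) : ℝ) =
        (fun t : ℝ => (s : ℝ) + t) '' Set.Ico 0 h := by
      rw [Set.image_const_add_Ico, add_zero, NNReal.coe_add]
    rw [h3, (measurePreserving_add_left volume (s : ℝ)).integrableOn_image hme] at h2
    refine IntegrableOn.congr_fun (h2.const_mul (Real.exp (p.lam * s))) (fun u hu => ?_)
      measurableSet_Ico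
    simp only [costRate, Function.comp]
    rw [Real.toNNReal_add s.coe_nonneg hu.1, Real.toNNReal_coe, ← mul_assoc, ← Real.exp_add]
    ring_nf
  have hi2 : IntegrableOn (fun u : ℝ => if u < waiting N s ω then
      Real.exp (-p.lam * u) * p.g (p.flow u (p.statistic N φ s ω)) else 0) (Set.Ico (0 : ℝ) h) := by
    have h2 : IntegrableOn ((Set.Iio (waiting N s ω)).indicator fun u =>
        Real.exp (-p.lam * u) * p.g (p.flow u (p.statistic N φ s ω))) (Set.Ico (0 : ℝ) h) :=
      (((continuous_flowCost _).continuousOn.integrableOn_Icc).mono_set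
        Set.Ico_subset_Icc_self).indicator measurableSet_Iio
    refine IntegrableOn.congr_fun h2 (fun u _ => ?_) measurableSet_Ico
    simp [Set.indicator_apply]
  rw [← integral_sub hi1 hi2]
  have hbd : ∀ u ∈ Set.Ico (0 : ℝ) h,
      ‖Real.exp (-p.lam * u) * p.g (p.statistic N φ (s + u.toNNReal) ω) -
        (if u < waiting N s ω then
          Real.exp (-p.lam * u) * p.g (p.flow u (p.statistic N φ s ω)) else 0)‖ ≤
      2 * p.gConst * Real.exp (p.lam + 1) * size (p.statistic N φ s ω) *
        (2 ^ (N (s + h) ω - N s ω) - 1) := by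
    intro u hu
    have hK : 0 ≤ 2 * p.gConst * Real.exp (p.lam + 1) * size (p.statistic N φ s ω) := by
      have := gConst_pos hp
      have := size_pos hs
      positivity
    have hmon : N s ω ≤ N (s + u.toNNReal) ω := hN.mono ω le_self_add
    have hw : waiting N s ω ≤ u ↔ N s ω + 1 ≤ N (s + u.toNNReal) ω := by
      rw [← waiting_le_iff hN hfin, Real.coe_toNNReal _ hu.1]
    split_ifs with hlt
    · have heq : N (s + u.toNNReal) ω = N s ω := by
        have := mt hw.2 (not_le.2 hlt)
        omega
      rw [statistic_of_eq heq, NNReal.coe_add, add_sub_cancel_left, Real.coe_toNNReal _ hu.1,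
        sub_self, norm_zero]
      exact mul_nonneg hK (two_pow_sub_one_nonneg _)
    · have hge := hw.1 (not_lt.1 hlt)
      have hle : N (s + u.toNNReal) ω ≤ N (s + h) ω :=
        hN.mono ω (add_le_add_right (Real.toNNReal_le_iff_le_coe.2 hu.2.le) s)
      have e1 := size_statistic_le (ω := ω) hp hN hφ (le_self_add (a := s) (b := u.toNNReal))
      have e2 := abs_g_le hp (statistic_mem (N := N) hp hφ (s + u.toNNReal) ω)
      have e3 : (2 : ℝ) ^ (N (s + u.toNNReal) ω - N s ω) ≤ 2 ^ (N (s + h) ω - N s ω) :=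
        pow_le_pow_right₀ one_le_two (by omega)
      -- A jump has occurred, so `2^n ≤ 2 * (2^n - 1)`; the right side vanishes when there is no
      -- jump, which gains an extra order of `h` in the mean.
      have e4 : (2 : ℝ) ^ 1 ≤ 2 ^ (N (s + h) ω - N s ω) :=
        pow_le_pow_right₀ one_le_two (by omega)
      have e5 : Real.exp ((p.lam + 1) * (((s + u.toNNReal : ℝ≥0) : ℝ) - s)) ≤
          Real.exp (p.lam + 1) := by
        rw [NNReal.coe_add, add_sub_cancel_left, Real.coe_toNNReal _ hu.1]
        exact Real.exp_le_exp.2 (mul_le_of_le_one_right hl.le (hu.2.le.trans h1))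
      have e6 : size (p.statistic N φ (s + u.toNNReal) ω) ≤
          (2 * (2 ^ (N (s + h) ω - N s ω) - 1)) * Real.exp (p.lam + 1) *
            size (p.statistic N φ s ω) :=
        e1.trans (mul_le_mul_of_nonneg_right (mul_le_mul (by linarith) e5 (Real.exp_pos _).le
          (by linarith)) (size_pos hs).le)
      rw [sub_zero, norm_mul, Real.norm_of_nonneg (Real.exp_pos _).le, Real.norm_eq_abs]
      calc _ ≤ 1 * |p.g (p.statistic N φ (s + u.toNNReal) ω)| :=
            mul_le_mul_of_nonneg_right (exp_neg_lam_mul_le_one hp hu.1) (abs_nonneg _)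
        _ ≤ p.gConst * ((2 * (2 ^ (N (s + h) ω - N s ω) - 1)) * Real.exp (p.lam + 1) *
              size (p.statistic N φ s ω)) := by
            rw [one_mul]
            exact e2.trans (mul_le_mul_of_nonneg_left e6 (gConst_pos hp).le)
        _ = _ := by ring
  refine (norm_setIntegral_le_of_norm_le_const (by simp) hbd).trans (le_of_eq ?_)
  simp
  ring

/-- In a time step, further jumps after the first one are negligible. -/
lemma abs_step_sub_stepPayoff_le (hp : p.Admissible) (hN : IsCounting N)
    (hm : ∀ t, Measurable (N t)) (hw : p.IsFixed w) (hφ : φ ∈ quadrant) (s : ℝ≥0) {h : ℝ≥0}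
    (hh : h ≤ 1) {ω : Ω} (hfin : jumpTime N (N s ω + 1) ω ≠ ⊤) :
    |p.stepCost N φ s h ω + Real.exp (-p.lam * (s + h : ℝ≥0)) * w (p.statistic N φ (s + h) ω) -
      Real.exp (-p.lam * s) * p.stepPayoff w h (p.statistic N φ s ω) (waiting N s ω)| ≤
      p.stepConst * (size (p.statistic N φ s ω) * stepError h (N (s + h) ω - N s ω)) := by
  have h1 := abs_integral_g_sub_le hp hN hm hφ s hh hfin
  have h2 := abs_terminal_sub_le hp hN hw hφ s hh hfin
  have hs := size_pos (statistic_mem (N := N) hp hφ s ω)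
  have h3 : (h : ℝ) * (2 ^ (N (s + h) ω - N s ω) - 1) ≤ stepError h (N (s + h) ω - N s ω) := by
    unfold stepError
    linarith [second_difference_nonneg (N (s + h) ω - N s ω)]
  have h4 := mul_le_mul_of_nonneg_left h3 (show 0 ≤ 2 * p.gConst * Real.exp (p.lam + 1) *
    size (p.statistic N φ s ω) by have := gConst_pos hp; positivity)
  have h5 : ENNReal.ofReal (waiting N s ω) ≤ ENNReal.ofReal (h : ℝ) ↔ waiting N s ω ≤ h :=
    ENNReal.ofReal_le_ofReal_iff h.coe_nonneg
  rw [stepCost_eq, stepPayoff, payoff, horizon_ofReal, NNReal.coe_add, mul_add (-p.lam),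
    Real.exp_add, mul_assoc (Real.exp (-p.lam * s)), ← mul_add, ← mul_sub, abs_mul,
    abs_of_pos (Real.exp_pos _)]
  simp only [h5]
  refine (mul_le_mul_of_nonneg_right (exp_neg_lam_mul_le_one hp s.coe_nonneg) (abs_nonneg _)).trans ?_
  rw [one_mul, add_assoc, add_sub_add_comm]
  refine (abs_add_le _ _).trans ((add_le_add h1 h2).trans ?_)
  unfold stepConst
  nlinarith

end Pathwise

end Params

end PoissonDisorder

end

/-! ### One time step in the mean: the approximate Markov property. -/

noncomputable section

namespace PoissonDisorder

namespace Params

section Step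

variable {p : Params} {w : ℝ × ℝ → ℝ} {φ : ℝ × ℝ} {Ω : Type*} {N : ℝ≥0 → Ω → ℕ}

lemma size_statistic_le_two_pow (hp : p.Admissible) (hN : IsCounting N) (hφ : φ ∈ quadrant)
    (t : ℝ≥0) (ω : Ω) : size (p.statistic N φ t ω) ≤
      2 ^ (N t ω - N 0 ω) * (Real.exp ((p.lam + 1) * t) * size φ) := by
  have h := size_statistic_le (ω := ω) hp hN hφ (zero_le (a := t))
  rwa [statistic_zero hN, NNReal.coe_zero, sub_zero, mul_assoc] at h

/-- The discounted payment `w` at the time `t`. -/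
def discounted (p : Params) (w : ℝ × ℝ → ℝ) (N : ℝ≥0 → Ω → ℕ) (φ : ℝ × ℝ) (t : ℝ≥0) (ω : Ω) : ℝ :=
  Real.exp (-p.lam * t) * w (p.statistic N φ t ω)

lemma discounted_nonpos (hp : p.Admissible) (hw : p.IsCandidate w) (hφ : φ ∈ quadrant)
    (t : ℝ≥0) (ω : Ω) : p.discounted w N φ t ω ≤ 0 :=
  mul_nonpos_of_nonneg_of_nonpos (Real.exp_pos _).le (hw.nonpos _ (statistic_mem hp hφ t ω))

lemma neg_le_discounted (hp : p.Admissible) (hw : p.IsCandidate w) (hφ : φ ∈ quadrant)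
    (t : ℝ≥0) (ω : Ω) : -(p.bound * Real.exp (-p.lam * t)) ≤ p.discounted w N φ t ω := by
  have h1 := hw.neg_bound_le _ (statistic_mem (N := N) hp hφ t ω)
  have h2 := mul_le_mul_of_nonneg_left h1 (Real.exp_pos (-p.lam * t)).le
  unfold discounted
  linarith

/-- The constant in the bound of the mean error of a time step. -/
def rateConst (p : Params) : ℝ := p.mu * Real.exp p.mu + (p.mu * Real.exp p.mu) ^ 2

lemma rateConst_nonneg (hp : p.Admissible) : 0 ≤ p.rateConst := by
  have := hp.one_lt_mu
  unfold rateConst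
  positivity

/-- The constant in the bound of the mean error of a time step started at the time `t`. -/
def errorConst (p : Params) (t : ℝ) (φ : ℝ × ℝ) : ℝ :=
  p.stepConst * p.rateConst * (Real.exp ((p.lam + 1 + p.mu) * t) * size φ)

lemma errorConst_mono (hp : p.Admissible) (hφ : φ ∈ quadrant) {s t : ℝ} (hst : s ≤ t) :
    p.errorConst s φ ≤ p.errorConst t φ := by
  have h1 : 0 ≤ p.lam + 1 + p.mu := by linarith [hp.lam_pos, hp.one_lt_mu]
  refine mul_le_mul_of_nonneg_left (mul_le_mul_of_nonneg_right ?_ (size_pos hφ).le)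
    (mul_nonneg (stepConst_nonneg hp) (rateConst_nonneg hp))
  exact Real.exp_le_exp.2 (mul_le_mul_of_nonneg_left hst h1)

variable [MeasurableSpace Ω] {P : Measure Ω}

lemma measurable_past_statistic (hN : IsCounting N) (hm : ∀ t, Measurable (N t)) (t : ℝ≥0) :
    Measurable[past P N hm t] (p.statistic N φ t) :=
  measurable_statistic (mΩ := past P N hm t) hN fun _ hs => measurable_past hm hs

lemma integrable_two_pow (hN : IsPoissonProcess N p.mu P) (t : ℝ≥0) :
    Integrable (fun ω => (2 : ℝ) ^ (N t ω - N 0 ω)) P := by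
  simpa using hN.integrable_pow_increment 0 t zero_le_two

lemma integral_two_pow (hp : p.Admissible) (hN : IsPoissonProcess N p.mu P) (t : ℝ≥0) :
    ∫ ω, (2 : ℝ) ^ (N t ω - N 0 ω) ∂P = Real.exp (p.mu * t) := by
  have h := hN.integral_pow_increment (by linarith [hp.one_lt_mu]) 0 t 2
  rw [zero_add] at h
  rw [h]
  ring_nf

lemma measurable_size_statistic (hN : IsCounting N) (hm : ∀ t, Measurable (N t)) (t : ℝ≥0) :
    Measurable fun ω => size (p.statistic N φ t ω) :=
  measurable_size.comp (measurable_statistic hN fun s _ => hm s)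

lemma integrable_size_statistic (hp : p.Admissible) (hN : IsPoissonProcess N p.mu P)
    (hφ : φ ∈ quadrant) (t : ℝ≥0) : Integrable (fun ω => size (p.statistic N φ t ω)) P := by
  refine ((integrable_two_pow hN t).mul_const (Real.exp ((p.lam + 1) * t) * size φ)).mono'
    (measurable_size_statistic hN.isCounting hN.measurable t).aestronglyMeasurable
    (ae_of_all _ fun ω => ?_)
  rw [Real.norm_of_nonneg (size_pos (statistic_mem hp hφ t ω)).le]
  exact size_statistic_le_two_pow hp hN.isCounting hφ t ω

lemma integral_size_statistic_le (hp : p.Admissible) (hN : IsPoissonProcess N p.mu P)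
    (hφ : φ ∈ quadrant) (t : ℝ≥0) : ∫ ω, size (p.statistic N φ t ω) ∂P ≤
      Real.exp ((p.lam + 1 + p.mu) * t) * size φ := by
  refine (integral_mono (integrable_size_statistic hp hN hφ t)
    ((integrable_two_pow hN t).mul_const _)
    fun ω => size_statistic_le_two_pow hp hN.isCounting hφ t ω).trans (le_of_eq ?_)
  rw [integral_mul_const, integral_two_pow hp hN, ← mul_assoc, ← Real.exp_add]
  ring_nf

lemma integrable_stepCost (hp : p.Admissible) (hN : IsPoissonProcess N p.mu P)
    (hφ : φ ∈ quadrant) (s h : ℝ≥0) : Integrable (p.stepCost N φ s h) P := by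
  have h1 : Integrable (fun ω => p.gConst *
      (2 ^ (N (s + h) ω - N 0 ω) * Real.exp ((p.lam + 1) * (s + h : ℝ≥0)) * size φ) * h) P :=
    ((((integrable_two_pow hN (s + h)).mul_const _).mul_const _).const_mul _).mul_const _
  exact h1.mono' (measurable_stepCost hN.isCounting hN.measurable s h).aestronglyMeasurable
    (ae_of_all _ fun ω => abs_stepCost_le hp hN.isCounting hφ s h ω)

variable [IsProbabilityMeasure P]

lemma integrable_stepError (hN : IsPoissonProcess N p.mu P) (s h : ℝ≥0) :
    Integrable (fun ω => stepError h (N (s + h) ω - N s ω)) P := by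
  have h2 := hN.integrable_pow_increment s h (zero_le_two (α := ℝ))
  have h3 := hN.integrable_pow_increment s h (zero_le_three (α := ℝ))
  exact ((h2.sub (integrable_const 1)).const_mul _).add
    ((h3.sub (h2.const_mul 2)).add (integrable_const 1))

/-- The mean is `h * (e^{mu h} - 1) + (e^{mu h} - 1)²`, and `e^{mu h} - 1 ≤ mu * e^mu * h` for `h ≤
1`. -/
lemma integral_stepError_le (hp : p.Admissible) (hN : IsPoissonProcess N p.mu P) (s : ℝ≥0)
    {h : ℝ≥0} (hh : h ≤ 1) :
    ∫ ω, stepError h (N (s + h) ω - N s ω) ∂P ≤ p.rateConst * (h : ℝ) ^ 2 := by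
  have hmu : 0 ≤ p.mu := by linarith [hp.one_lt_mu]
  have hx : 0 ≤ p.mu * h := mul_nonneg hmu h.coe_nonneg
  have h2 := hN.integrable_pow_increment s h (zero_le_two (α := ℝ))
  have h3 := hN.integrable_pow_increment s h (zero_le_three (α := ℝ))
  have h4 : Integrable (fun ω => (3 : ℝ) ^ (N (s + h) ω - N s ω) -
      2 * 2 ^ (N (s + h) ω - N s ω)) P := h3.sub (h2.const_mul 2)
  have h5 : Integrable (fun ω => (h : ℝ) * ((2 : ℝ) ^ (N (s + h) ω - N s ω) - 1)) P :=
    (h2.sub (integrable_const 1)).const_mul _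
  have h6 : Integrable (fun ω => (3 : ℝ) ^ (N (s + h) ω - N s ω) -
      2 * 2 ^ (N (s + h) ω - N s ω) + 1) P := h4.add (integrable_const 1)
  have e1 : Real.exp (p.mu * h * (3 - 1)) = Real.exp (p.mu * h) ^ 2 := by
    rw [← Real.exp_nat_mul]; push_cast; ring_nf
  have e2 : Real.exp (p.mu * h) - 1 ≤ p.mu * Real.exp p.mu * h := by
    have e3 := mul_le_mul_of_nonneg_left (Real.add_one_le_exp (-(p.mu * h)))
      (Real.exp_pos (p.mu * h)).le
    rw [← Real.exp_add, add_neg_cancel, Real.exp_zero] at e3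
    have e4 : Real.exp (p.mu * h) ≤ Real.exp p.mu :=
      Real.exp_le_exp.2 (mul_le_of_le_one_right hmu hh)
    have e5 := mul_le_mul_of_nonneg_left e4 hx
    linarith
  have e6 : 0 ≤ Real.exp (p.mu * h) - 1 := sub_nonneg.2 (Real.one_le_exp hx)
  have e7 := pow_le_pow_left₀ e6 e2 2
  have e8 := mul_le_mul_of_nonneg_left e2 h.coe_nonneg
  unfold stepError rateConst
  rw [integral_add h5 h6, integral_const_mul, integral_sub h2 (integrable_const 1),
    integral_add h4 (integrable_const 1), integral_sub h3 (h2.const_mul 2), integral_const_mul,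
    hN.integral_pow_increment hmu, hN.integral_pow_increment hmu, e1,
    show p.mu * h * (2 - 1) = p.mu * (h : ℝ) by ring]
  simp only [integral_const, probReal_univ, smul_eq_mul, mul_one]
  nlinarith

lemma indepFun_size_stepError (hN : IsPoissonProcess N p.mu P) (s h : ℝ≥0) :
    IndepFun (fun ω => size (p.statistic N φ s ω))
      (fun ω => stepError h (N (s + h) ω - N s ω)) P :=
  (hN.indepFun_increment (measurable_past_statistic hN.isCounting hN.measurable s)).comp
    measurable_size (measurable_of_countable (stepError h))

lemma integrable_size_mul_stepError (hp : p.Admissible) (hN : IsPoissonProcess N p.mu P)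
    (hφ : φ ∈ quadrant) (s h : ℝ≥0) : Integrable (fun ω =>
      size (p.statistic N φ s ω) * stepError h (N (s + h) ω - N s ω)) P :=
  (indepFun_size_stepError hN s h).integrable_mul (integrable_size_statistic hp hN hφ s)
    (integrable_stepError hN s h)

/-- The size at time `s` belongs to the past and is independent of the increment, so the mean
factorizes: exponential growth in `s` times `O(h²)`. -/
lemma integral_step_error_le (hp : p.Admissible) (hN : IsPoissonProcess N p.mu P)
    (hφ : φ ∈ quadrant) (s : ℝ≥0) {h : ℝ≥0} (hh : h ≤ 1) :
    ∫ ω, p.stepConst * (size (p.statistic N φ s ω) * stepError h (N (s + h) ω - N s ω)) ∂P ≤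
      p.errorConst s φ * (h : ℝ) ^ 2 := by
  have h1 := (indepFun_size_stepError (φ := φ) hN s h).integral_fun_mul_eq_mul_integral
    (integrable_size_statistic hp hN hφ s).aestronglyMeasurable
    (integrable_stepError hN s h).aestronglyMeasurable
  have h2 := integral_stepError_le hp hN s hh
  have h3 := integral_size_statistic_le hp hN hφ s
  have h4 : 0 ≤ ∫ ω, stepError h (N (s + h) ω - N s ω) ∂P :=
    integral_nonneg fun ω => stepError_nonneg h.coe_nonneg _
  rw [integral_const_mul, h1, errorConst]
  have h5 := mul_le_mul h3 h2 h4 (mul_nonneg (Real.exp_pos _).le (size_pos hφ).le)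
  have h6 := mul_le_mul_of_nonneg_left h5 (stepConst_nonneg hp)
  linarith

lemma integrable_discounted (hp : p.Admissible) (hw : p.IsCandidate w)
    (hN : IsPoissonProcess N p.mu P) (hφ : φ ∈ quadrant) (t : ℝ≥0) :
    Integrable (p.discounted w N φ t) P := by
  have hm : Measurable (p.discounted w N φ t) := (hw.measurable.comp
    (measurable_statistic hN.isCounting fun s _ => hN.measurable s)).const_mul _
  refine (integrable_const (p.bound * Real.exp (-p.lam * t))).mono' hm.aestronglyMeasurable
    (ae_of_all _ fun ω => abs_le.2 ⟨neg_le_discounted hp hw hφ t ω, ?_⟩)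
  exact (discounted_nonpos hp hw hφ t ω).trans
    (mul_nonneg (bound_pos hp).le (Real.exp_pos _).le)

lemma integrable_continuation (hp : p.Admissible) (hw : p.IsFixed w)
    (hN : IsPoissonProcess N p.mu P) (hφ : φ ∈ quadrant) (t : ℝ≥0) {h : ℝ} (hh : 0 ≤ h) :
    Integrable (fun ω => p.continuation w h (p.statistic N φ t ω)) P := by
  have hm : Measurable fun ω => p.continuation w h (p.statistic N φ t ω) :=
    (measurable_continuation hw.measurable h).comp
      (measurable_statistic hN.isCounting fun s _ => hN.measurable s)
  refine (((integrable_size_statistic hp hN hφ t).const_mul h).add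
    (integrable_const p.bound)).mono' hm.aestronglyMeasurable (ae_of_all _ fun ω => ?_)
  have hs := statistic_mem (N := N) hp hφ t ω
  have h1 := le_continuation hp hw hs hh
  have h2 := hw.neg_bound_le _ hs
  have h3 := op_ofReal_le hp hw.toIsCandidate hs hh
  have h4 := mul_nonpos_of_nonneg_of_nonpos (Real.exp_pos (-(p.lam + p.mu) * h)).le
    (hw.nonpos _ (flow_mem hp hh hs))
  have h5 := mul_nonneg hh (size_pos hs).le
  have h6 := bound_pos hp
  refine abs_le.2 ⟨?_, ?_⟩
  · simp only [Pi.add_apply]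
    linarith
  · simp only [continuation, Pi.add_apply]
    linarith

/-- The Markov property over a time step, up to the error of neglecting further jumps. -/
lemma abs_setIntegral_step_sub_le (hp : p.Admissible) (hN : IsPoissonProcess N p.mu P)
    (hw : p.IsFixed w) (hφ : φ ∈ quadrant) (s : ℝ≥0) {h : ℝ≥0} (hh : h ≤ 1) {A : Set Ω}
    (hA : MeasurableSet[past P N hN.measurable s] A) :
    |∫ ω in A, (p.stepCost N φ s h ω + p.discounted w N φ (s + h) ω) ∂P -
      ∫ ω in A, Real.exp (-p.lam * s) * p.continuation w h (p.statistic N φ s ω) ∂P| ≤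
      p.errorConst s φ * (h : ℝ) ^ 2 := by
  have hmu : 0 < p.mu := by linarith [hp.one_lt_mu]
  have hc := hN.isCounting
  have hwm := measurable_waiting hc hN.measurable s
  have hsm : Measurable (p.statistic N φ s) := measurable_statistic hc fun t _ => hN.measurable t
  have hA' : MeasurableSet A := (past P N hN.measurable).le s A hA
  set X : Ω → ℝ := fun ω => p.stepCost N φ s h ω + p.discounted w N φ (s + h) ω with hX
  set Y : Ω → ℝ := fun ω =>
    Real.exp (-p.lam * s) * p.stepPayoff w h (p.statistic N φ s ω) (waiting N s ω) with hY
  have hXi : Integrable X P := (integrable_stepCost hp hN hφ s h).add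
    (integrable_discounted hp hw.toIsCandidate hN hφ (s + h))
  have hYm : Measurable Y :=
    ((measurable_stepPayoff hw.measurable h).comp (hsm.prodMk hwm)).const_mul _
  have hbd : ∀ᵐ ω ∂P, |X ω - Y ω| ≤ p.stepConst *
      (size (p.statistic N φ s ω) * stepError h (N (s + h) ω - N s ω)) := by
    filter_upwards [hN.ae_jumpTime_ne_top hmu s] with ω hω
    exact abs_step_sub_stepPayoff_le hp hc hN.measurable hw hφ s hh hω
  have hEi := (integrable_size_mul_stepError hp hN hφ s h).const_mul p.stepConst
  have hdi : Integrable (fun ω => X ω - Y ω) P :=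
    hEi.mono' (hXi.aestronglyMeasurable.sub hYm.aestronglyMeasurable) hbd
  -- Integrability is inherited from `X` through the pathwise error bound.
  have hYi : Integrable Y P := by
    refine (hXi.sub hdi).congr (ae_of_all _ fun ω => ?_)
    simp
  -- Adjoining the indicator of `A` to the state lets the freezing argument localize to `A`.
  let f : Ω → (ℝ × ℝ) × ℝ := fun ω => (p.statistic N φ s ω, A.indicator (fun _ => 1) ω)
  have hf : Measurable[past P N hN.measurable s] f :=
    (measurable_past_statistic hc hN.measurable s).prodMk (Measurable.indicator (@measurable_const _ _ _ (past P N hN.measurable s) 1) hA)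
  let G : ((ℝ × ℝ) × ℝ) × ℝ → ℝ := fun q =>
    q.1.2 * (Real.exp (-p.lam * s) * p.stepPayoff w h q.1.1 q.2)
  have hG : Measurable G := (measurable_snd.comp measurable_fst).mul
    (((measurable_stepPayoff hw.measurable h).comp
      ((measurable_fst.comp measurable_fst).prodMk measurable_snd)).const_mul _)
  have hGY : (fun ω => G (f ω, waiting N s ω)) = A.indicator Y := by
    ext ω
    by_cases hω : ω ∈ A <;> simp [G, f, Y, hω]
  have hGi : Integrable (fun ω => G (f ω, waiting N s ω)) P := by
    rw [hGY]
    exact hYi.indicator hA'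
  have hind := hN.indepFun_waiting hmu hf
  have hGC : ∀ ω, ∫ r, G (f ω, r) ∂(P.map (waiting N s)) = A.indicator (fun ω =>
      Real.exp (-p.lam * s) * p.continuation w h (p.statistic N φ s ω)) ω := by
    intro ω
    have hs := statistic_mem (N := N) hp hφ s ω
    simp only [G, f]
    rw [hN.map_waiting hmu, integral_const_mul, integral_const_mul,
      integral_stepPayoff hp hw.toIsCandidate hs h.coe_nonneg]
    by_cases hω : ω ∈ A <;> simp [hω]
  have heq := IndepFun.integral_comp_eq hind (hf.mono ((past P N hN.measurable).le s) le_rfl) hwm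
    hG hGi
  simp only [hGC] at heq
  rw [hGY, integral_indicator hA', integral_indicator hA'] at heq
  rw [← heq, ← integral_sub hXi.integrableOn hYi.integrableOn]
  calc _ ≤ ∫ ω in A, |X ω - Y ω| ∂P := abs_integral_le_integral_abs
    _ ≤ ∫ ω, |X ω - Y ω| ∂P :=
      setIntegral_le_integral hdi.abs (ae_of_all _ fun ω => abs_nonneg _)
    _ ≤ _ := integral_mono_ae hdi.abs hEi hbd
    _ ≤ _ := integral_step_error_le hp hN hφ s hh

end Step

end Params

end PoissonDisorder

end

/-! ### Telescoping over a time grid. -/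

noncomputable section

namespace PoissonDisorder

section Telescope

variable {Ω : Type*} {B : ℕ → Set Ω} {a : ℕ → Ω → ℝ} {ω : Ω}

lemma sum_indicator_sub_eq {n : ℕ} (h : ∀ k < n, ω ∈ B k) :
    ∑ k ∈ Finset.range n, (B k).indicator (fun ω => a k ω - a (k + 1) ω) ω = a 0 ω - a n ω := by
  rw [← Finset.sum_range_sub' (fun k => a k ω)]
  exact Finset.sum_congr rfl fun k hk => Set.indicator_of_mem (h k (Finset.mem_range.1 hk)) _

/-- The sum telescopes up to the first index outside `B`, leaving `a 0` minus a nonpositive term. -/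
lemma le_sum_indicator_sub (hB : Antitone B) (ha : ∀ k, a k ω ≤ 0) (n : ℕ) :
    a 0 ω ≤ ∑ k ∈ Finset.range n, (B k).indicator (fun ω => a k ω - a (k + 1) ω) ω := by
  induction n with
  | zero => simpa using ha 0
  | succ n ih =>
    by_cases h : ω ∈ B n
    · rw [sum_indicator_sub_eq fun k hk => hB (Nat.lt_succ_iff.1 hk) h]
      linarith [ha (n + 1)]
    · rwa [Finset.sum_range_succ, Set.indicator_of_notMem h, add_zero]

/-- If the path leaves `B` before `n`, the sum stops at an index where `a` is at least `-D`. -/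
lemma sum_indicator_sub_le (hB : Antitone B) {D : ℝ}
    (ha : ∀ k, (∀ j < k, ω ∈ B j) → ω ∉ B k → -D ≤ a k ω) (n : ℕ)
    (hn : ¬ ∀ k < n, ω ∈ B k) :
    ∑ k ∈ Finset.range n, (B k).indicator (fun ω => a k ω - a (k + 1) ω) ω ≤ a 0 ω + D := by
  induction n with
  | zero => exact absurd (fun k hk => absurd hk (Nat.not_lt_zero k)) hn
  | succ n ih =>
    by_cases h : ω ∈ B n
    · exact absurd (fun k hk => hB (Nat.lt_succ_iff.1 hk) h) hn
    · rw [Finset.sum_range_succ, Set.indicator_of_notMem h, add_zero]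
      by_cases h' : ∀ k < n, ω ∈ B k
      · rw [sum_indicator_sub_eq h']
        linarith [ha n h' h]
      · exact ih h'

end Telescope

namespace Params

section Grid

variable {p : Params} {w : ℝ × ℝ → ℝ} {φ : ℝ × ℝ} {Ω : Type*} {N : ℝ≥0 → Ω → ℕ}

/-- The running cost over the first `n` steps of a grid, the step `k` being charged on `B k`. -/
def gridCost (p : Params) (N : ℝ≥0 → Ω → ℕ) (φ : ℝ × ℝ) (h : ℝ≥0) (B : ℕ → Set Ω) (n : ℕ)
    (ω : Ω) : ℝ :=
  ∑ k ∈ Finset.range n, (B k).indicator (p.stepCost N φ (k * h) h) ω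

lemma natCast_succ_mul (k : ℕ) (h : ℝ≥0) : ((k + 1 : ℕ) : ℝ≥0) * h = k * h + h := by
  push_cast
  ring

lemma natCast_mul_le {k n : ℕ} (hkn : k ≤ n) (h : ℝ≥0) : (k : ℝ≥0) * h ≤ n * h :=
  mul_le_mul_of_nonneg_right (by exact_mod_cast hkn) zero_le

lemma discounted_zero (hN : IsCounting N) (h : ℝ≥0) (ω : Ω) :
    p.discounted w N φ ((0 : ℕ) * h) ω = w φ := by
  simp [discounted, statistic_zero hN]

/-- The event that the payment `w` has been less than `-D` at the first `k + 1` grid times. -/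
def continueSet (p : Params) (w : ℝ × ℝ → ℝ) (N : ℝ≥0 → Ω → ℕ) (φ : ℝ × ℝ) (h : ℝ≥0) (D : ℝ)
    (k : ℕ) : Set Ω := {ω | ∀ j ≤ k, w (p.statistic N φ (j * h) ω) < -D}

lemma antitone_continueSet (h : ℝ≥0) (D : ℝ) : Antitone (p.continueSet w N φ h D) :=
  fun _ _ hij _ hω l hl => hω l (hl.trans hij)

variable [MeasurableSpace Ω] {P : Measure Ω}

lemma integrable_gridCost (hp : p.Admissible) (hN : IsPoissonProcess N p.mu P)
    (hφ : φ ∈ quadrant) {h : ℝ≥0} {B : ℕ → Set Ω} (hB : ∀ k, MeasurableSet (B k)) (n : ℕ) :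
    Integrable (p.gridCost N φ h B n) P :=
  integrable_finsetSum _ fun k _ => (integrable_stepCost hp hN hφ _ _).indicator (hB k)

lemma integral_gridCost (hp : p.Admissible) (hN : IsPoissonProcess N p.mu P)
    (hφ : φ ∈ quadrant) {h : ℝ≥0} {B : ℕ → Set Ω} (hB : ∀ k, MeasurableSet (B k)) (n : ℕ) :
    ∫ ω, p.gridCost N φ h B n ω ∂P =
      ∑ k ∈ Finset.range n, ∫ ω in B k, p.stepCost N φ (k * h) h ω ∂P := by
  unfold gridCost
  rw [integral_finsetSum _ fun k _ => (integrable_stepCost hp hN hφ _ _).indicator (hB k)]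
  exact Finset.sum_congr rfl fun k _ => integral_indicator (hB k)

lemma measurableSet_continueSet (hN : IsPoissonProcess N p.mu P) (hw : Measurable w) (h : ℝ≥0)
    (D : ℝ) (k : ℕ) :
    MeasurableSet[past P N hN.measurable (k * h)] (p.continueSet w N φ h D k) := by
  have he : p.continueSet w N φ h D k =
      ⋂ j : ℕ, ⋂ _ : j ≤ k, {ω | w (p.statistic N φ (j * h) ω) < -D} := by
    ext ω
    simp [continueSet]
  rw [he]
  refine MeasurableSet.iInter fun j => MeasurableSet.iInter fun hj => ?_
  refine (past P N hN.measurable).mono (natCast_mul_le hj h) _ ?_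
  exact (hw.comp (measurable_past_statistic hN.isCounting hN.measurable _)) measurableSet_Iio

variable [IsProbabilityMeasure P]

lemma integral_sum_indicator_discounted (hp : p.Admissible) (hN : IsPoissonProcess N p.mu P)
    (hw : p.IsCandidate w) (hφ : φ ∈ quadrant) {h : ℝ≥0} {B : ℕ → Set Ω}
    (hB : ∀ k, MeasurableSet (B k)) (n : ℕ) :
    Integrable (fun ω => ∑ k ∈ Finset.range n, (B k).indicator (fun ω =>
      p.discounted w N φ (k * h) ω - p.discounted w N φ ((k + 1 : ℕ) * h) ω) ω) P ∧
    ∫ ω, ∑ k ∈ Finset.range n, (B k).indicator (fun ω =>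
      p.discounted w N φ (k * h) ω - p.discounted w N φ ((k + 1 : ℕ) * h) ω) ω ∂P =
      ∑ k ∈ Finset.range n, (∫ ω in B k, p.discounted w N φ (k * h) ω ∂P -
        ∫ ω in B k, p.discounted w N φ ((k + 1 : ℕ) * h) ω ∂P) := by
  have hi : ∀ k : ℕ, Integrable (p.discounted w N φ (k * h)) P :=
    fun k => integrable_discounted hp hw hN hφ _
  have hd : ∀ k : ℕ, Integrable ((B k).indicator fun ω =>
      p.discounted w N φ (k * h) ω - p.discounted w N φ ((k + 1 : ℕ) * h) ω) P :=
    fun k => ((hi k).sub (hi (k + 1))).indicator (hB k)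
  refine ⟨integrable_finsetSum _ fun k _ => hd k, ?_⟩
  rw [integral_finsetSum _ fun k _ => hd k]
  refine Finset.sum_congr rfl fun k _ => ?_
  rw [integral_indicator (hB k), integral_sub (hi k).integrableOn (hi (k + 1)).integrableOn]

/-- Accumulated cost plus discounted `w` is a submartingale on the grid up to `O(h²)` per step, by
`le_continuation`, and the terminal payment is nonpositive. The sets `B k` encode an arbitrary
stopping rule on the grid. -/
lemma le_integral_gridCost (hp : p.Admissible) (hN : IsPoissonProcess N p.mu P)
    (hw : p.IsFixed w) (hφ : φ ∈ quadrant) {h : ℝ≥0} (hh : h ≤ 1) {B : ℕ → Set Ω}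
    (hB : Antitone B) {n : ℕ}
    (hBm : ∀ k : ℕ, MeasurableSet[past P N hN.measurable (k * h)] (B k)) :
    w φ - n * (p.errorConst (n * h) φ * (h : ℝ) ^ 2) ≤ ∫ ω, p.gridCost N φ h B n ω ∂P := by
  have hB' : ∀ k, MeasurableSet (B k) := fun k => (past P N hN.measurable).le _ _ (hBm k)
  obtain ⟨hi, he⟩ := integral_sum_indicator_discounted (h := h) hp hN hw.toIsCandidate hφ hB' n
  have h1 : w φ ≤ ∫ ω, ∑ k ∈ Finset.range n, (B k).indicator (fun ω =>
      p.discounted w N φ (k * h) ω - p.discounted w N φ ((k + 1 : ℕ) * h) ω) ω ∂P := by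
    have h2 := integral_mono (integrable_const (w φ)) hi fun ω => by
      have := le_sum_indicator_sub (ω := ω) (a := fun k => p.discounted w N φ (k * h)) hB
        (fun k => discounted_nonpos hp hw.toIsCandidate hφ _ ω) n
      simp only [discounted_zero hN.isCounting] at this
      exact this
    simpa using h2
  rw [he] at h1
  rw [integral_gridCost hp hN hφ hB']
  have h3 : ∀ k ∈ Finset.range n, (∫ ω in B k, p.discounted w N φ (k * h) ω ∂P -
      ∫ ω in B k, p.discounted w N φ ((k + 1 : ℕ) * h) ω ∂P) -
        p.errorConst (n * h) φ * (h : ℝ) ^ 2 ≤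
      ∫ ω in B k, p.stepCost N φ (k * h) h ω ∂P := by
    intro k hk
    have e1 := abs_setIntegral_step_sub_le hp hN hw hφ (k * h) hh (hBm k)
    have e2 : p.errorConst ((k * h : ℝ≥0) : ℝ) φ ≤ p.errorConst (n * h) φ :=
      errorConst_mono hp hφ (by exact_mod_cast natCast_mul_le (Finset.mem_range.1 hk).le h)
    have e3 := mul_le_mul_of_nonneg_right e2 (sq_nonneg (h : ℝ))
    have e4 : ∫ ω in B k, p.discounted w N φ (k * h) ω ∂P ≤ ∫ ω in B k,
        Real.exp (-p.lam * (k * h : ℝ≥0)) * p.continuation w h (p.statistic N φ (k * h) ω) ∂P :=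
      integral_mono (integrable_discounted hp hw.toIsCandidate hN hφ _).integrableOn
        ((integrable_continuation hp hw hN hφ _ h.coe_nonneg).const_mul _).integrableOn
        fun ω => mul_le_mul_of_nonneg_left
          (le_continuation hp hw (statistic_mem hp hφ _ ω) h.coe_nonneg) (Real.exp_pos _).le
    rw [integral_add (integrable_stepCost hp hN hφ _ _).integrableOn
      (integrable_discounted hp hw.toIsCandidate hN hφ _).integrableOn] at e1
    rw [natCast_succ_mul]
    linarith [(abs_le.1 e1).1]
  have h4 := Finset.sum_le_sum h3
  rw [Finset.sum_sub_distrib, Finset.sum_const, Finset.card_range, nsmul_eq_mul] at h4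
  linarith

/-- While the rule continues, `eq_continuation` gives equality instead of an inequality. On
stopping, `w` is within the threshold of `0`; a path that never stops leaves at most the discounted
bound at time `n * h`. -/
lemma integral_gridCost_le (hp : p.Admissible) (hN : IsPoissonProcess N p.mu P)
    (hw : p.IsFixed w) (hφ : φ ∈ quadrant) {h : ℝ≥0} (hh : h ≤ 1) (n : ℕ) :
    ∫ ω, p.gridCost N φ h (p.continueSet w N φ h ((p.lam + p.mu) * p.bound * h)) n ω ∂P ≤
      w φ + n * (p.errorConst (n * h) φ * (h : ℝ) ^ 2) + (p.lam + p.mu) * p.bound * h +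
        p.bound * Real.exp (-p.lam * (n * h : ℝ≥0)) := by
  set D := (p.lam + p.mu) * p.bound * (h : ℝ) with hD
  have hD0 : 0 ≤ D := mul_nonneg (mul_nonneg (by linarith [hp.lam_pos, hp.one_lt_mu])
    (bound_pos hp).le) h.coe_nonneg
  set B := p.continueSet w N φ h D with hBdef
  have hB : Antitone B := antitone_continueSet h D
  have hBm := measurableSet_continueSet (φ := φ) hN hw.measurable h D
  have hB' : ∀ k, MeasurableSet (B k) := fun k => (past P N hN.measurable).le _ _ (hBm k)
  obtain ⟨hi, he⟩ := integral_sum_indicator_discounted (h := h) hp hN hw.toIsCandidate hφ hB' n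
  have h1 : ∫ ω, ∑ k ∈ Finset.range n, (B k).indicator (fun ω =>
      p.discounted w N φ (k * h) ω - p.discounted w N φ ((k + 1 : ℕ) * h) ω) ω ∂P ≤
      w φ + D + p.bound * Real.exp (-p.lam * (n * h : ℝ≥0)) := by
    have hpos : 0 ≤ p.bound * Real.exp (-p.lam * (n * h : ℝ≥0)) :=
      mul_nonneg (bound_pos hp).le (Real.exp_pos _).le
    have h2 := integral_mono hi
      (integrable_const (w φ + D + p.bound * Real.exp (-p.lam * (n * h : ℝ≥0)))) fun ω => by
      by_cases hall : ∀ k < n, ω ∈ B k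
      · have := sum_indicator_sub_eq (a := fun k => p.discounted w N φ (k * h)) hall
        simp only [discounted_zero hN.isCounting] at this
        simp only [this]
        linarith [neg_le_discounted (N := N) hp hw.toIsCandidate hφ (n * h) ω]
      · have := sum_indicator_sub_le (a := fun k => p.discounted w N φ (k * h)) (D := D) hB
          (fun k hlt hnot => ?_) n hall
        · simp only [discounted_zero hN.isCounting] at this
          simp only
          linarith
        · have e1 : -D ≤ w (p.statistic N φ (k * h) ω) := by
            by_contra! hcon
            refine hnot fun j hj => ?_
            rcases hj.eq_or_lt with rfl | hjk
            · exact hcon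
            · exact hlt j hjk j le_rfl
          have e2 := exp_neg_lam_mul_le_one hp (k * h : ℝ≥0).coe_nonneg
          have e3 := Real.exp_pos (-p.lam * (k * h : ℝ≥0))
          simp only [discounted]
          nlinarith
    simpa using h2
  rw [he] at h1
  rw [integral_gridCost hp hN hφ hB']
  have h3 : ∀ k ∈ Finset.range n, ∫ ω in B k, p.stepCost N φ (k * h) h ω ∂P ≤
      (∫ ω in B k, p.discounted w N φ (k * h) ω ∂P -
      ∫ ω in B k, p.discounted w N φ ((k + 1 : ℕ) * h) ω ∂P) +
        p.errorConst (n * h) φ * (h : ℝ) ^ 2 := by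
    intro k hk
    have e1 := abs_setIntegral_step_sub_le hp hN hw hφ (k * h) hh (hBm k)
    have e2 : p.errorConst ((k * h : ℝ≥0) : ℝ) φ ≤ p.errorConst (n * h) φ :=
      errorConst_mono hp hφ (by exact_mod_cast natCast_mul_le (Finset.mem_range.1 hk).le h)
    have e3 := mul_le_mul_of_nonneg_right e2 (sq_nonneg (h : ℝ))
    have e4 : ∫ ω in B k, p.discounted w N φ (k * h) ω ∂P = ∫ ω in B k,
        Real.exp (-p.lam * (k * h : ℝ≥0)) * p.continuation w h (p.statistic N φ (k * h) ω) ∂P :=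
      setIntegral_congr_fun (hB' k) fun ω hω => by
        simp only [discounted]
        rw [← eq_continuation hp hw (statistic_mem hp hφ _ ω) h.coe_nonneg (hω k le_rfl)]
    rw [integral_add (integrable_stepCost hp hN hφ _ _).integrableOn
      (integrable_discounted hp hw.toIsCandidate hN hφ _).integrableOn] at e1
    rw [natCast_succ_mul]
    linarith [(abs_le.1 e1).2]
  have h4 := Finset.sum_le_sum h3
  rw [Finset.sum_add_distrib, Finset.sum_const, Finset.card_range, nsmul_eq_mul] at h4
  linarith

end Grid

end Params

end PoissonDisorder

end

/-! ### Lower bound: arbitrary stopping times of the history. -/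

noncomputable section

namespace PoissonDisorder

namespace Params

section Lower

variable {p : Params} {φ : ℝ × ℝ} {Ω : Type*} {N : ℝ≥0 → Ω → ℕ} [MeasurableSpace Ω]

lemma stepCost_le_setIntegral (hp : p.Admissible) (hN : IsCounting N)
    (hm : ∀ t, Measurable (N t)) (hφ : φ ∈ quadrant) (S : ℝ≥0∞) (s h b : ℝ≥0) (hb : s + h ≤ b)
    (ω : Ω) : p.stepCost N φ s h ω ≤
      (∫ t in horizon S ∩ Set.Ico (s : ℝ) ((s + h : ℝ≥0) : ℝ), p.costRate N φ t ω) +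
        if ((s + h : ℝ≥0) : ℝ≥0∞) ≤ S then 0 else
          p.gConst * (2 ^ (N b ω - N 0 ω) * Real.exp ((p.lam + 1) * b) * size φ) * h := by
  have hi := integrableOn_costRate hp hN hm hφ s.coe_nonneg (s + h) ω
  have hd := integral_inter_add_sdiff (s := Set.Ico (s : ℝ) ((s + h : ℝ≥0) : ℝ))
    (measurableSet_horizon S) hi
  rw [stepCost, ← hd, Set.inter_comm]
  gcongr
  split_ifs with hle
  · have : Set.Ico (s : ℝ) ((s + h : ℝ≥0) : ℝ) \ horizon S = ∅ := by
      refine Set.sdiff_eq_empty.2 fun t ht => ⟨s.coe_nonneg.trans ht.1, lt_of_lt_of_le ?_ hle⟩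
      rw [← ENNReal.ofReal_coe_nnreal]
      exact (ENNReal.ofReal_lt_ofReal_iff_of_nonneg (s.coe_nonneg.trans ht.1)).2 ht.2
    rw [this, setIntegral_empty]
  · have hG : 0 ≤ p.gConst * (2 ^ (N b ω - N 0 ω) * Real.exp ((p.lam + 1) * b) * size φ) := by
      have := gConst_pos hp
      have := size_pos hφ
      positivity
    have hv : volume.real (Set.Ico (s : ℝ) ((s + h : ℝ≥0) : ℝ) \ horizon S) ≤ h := by
      refine (measureReal_mono Set.sdiff_subset (by simp)).trans (le_of_eq ?_)
      simp
    have h1 := norm_setIntegral_le_of_norm_le_const (μ := volume)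
      (s := Set.Ico (s : ℝ) ((s + h : ℝ≥0) : ℝ) \ horizon S)
      (f := fun t => p.costRate N φ t ω)
      ((measure_mono Set.sdiff_subset).trans_lt (by simp)) fun t ht =>
        abs_costRate_le hp hN hφ (s.coe_nonneg.trans ht.1.1)
          (ht.1.2.le.trans (NNReal.coe_le_coe.2 hb)) ω
    exact (le_abs_self _).trans (h1.trans (mul_le_mul_of_nonneg_left hv hG))

lemma integrableOn_costRate_inter (hp : p.Admissible) (hN : IsCounting N)
    (hm : ∀ t, Measurable (N t)) (hφ : φ ∈ quadrant) (S : ℝ≥0∞) (b : ℝ≥0) (ω : Ω) :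
    IntegrableOn (fun t => p.costRate N φ t ω) (horizon S ∩ Set.Iio (b : ℝ)) :=
  (integrableOn_costRate hp hN hm hφ le_rfl b ω).mono_set fun _ ht => ⟨ht.1.1, ht.2⟩

/-- Rounding `τ` up to the grid adds cost only in the single step containing `τ`; the conditional
term records whether that error has been spent. -/
lemma gridCost_le_setIntegral (hp : p.Admissible) (hN : IsCounting N)
    (hm : ∀ t, Measurable (N t)) (hφ : φ ∈ quadrant) (τ : Ω → ℝ≥0∞) (h b : ℝ≥0) (ω : Ω) {n : ℕ}
    (hb : n * h ≤ b) :
    p.gridCost N φ h (fun k => {ω | ((k * h : ℝ≥0) : ℝ≥0∞) ≤ τ ω}) n ω ≤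
      (∫ t in horizon (τ ω) ∩ Set.Iio ((n * h : ℝ≥0) : ℝ), p.costRate N φ t ω) +
        if ((n * h : ℝ≥0) : ℝ≥0∞) ≤ τ ω then 0 else
          p.gConst * (2 ^ (N b ω - N 0 ω) * Real.exp ((p.lam + 1) * b) * size φ) * h := by
  induction n with
  | zero =>
    have : horizon (τ ω) ∩ Set.Iio ((((0 : ℕ) : ℝ≥0) * h : ℝ≥0) : ℝ) = ∅ := by
      ext t
      simpa using fun ht : t ∈ horizon (τ ω) => ht.1
    rw [this]
    simp [gridCost]
  | succ n ih =>
    have ih' := ih ((natCast_mul_le n.le_succ h).trans hb)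
    rw [natCast_succ_mul] at hb ⊢
    have hu : horizon (τ ω) ∩ Set.Iio ((n * h + h : ℝ≥0) : ℝ) =
        (horizon (τ ω) ∩ Set.Iio ((n * h : ℝ≥0) : ℝ)) ∪
          (horizon (τ ω) ∩ Set.Ico ((n * h : ℝ≥0) : ℝ) ((n * h + h : ℝ≥0) : ℝ)) := by
      rw [← Set.inter_union_distrib_left, Set.Iio_union_Ico_eq_Iio (by simp)]
    have hd : Disjoint (horizon (τ ω) ∩ Set.Iio ((n * h : ℝ≥0) : ℝ))
        (horizon (τ ω) ∩ Set.Ico ((n * h : ℝ≥0) : ℝ) ((n * h + h : ℝ≥0) : ℝ)) :=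
      Set.disjoint_left.2 fun t h1 h2 => absurd h2.2.1 (not_le.2 h1.2)
    have hi := integrableOn_costRate_inter hp hN hm hφ (τ ω) (n * h + h) ω
    rw [hu] at hi
    rw [hu, setIntegral_union hd ((measurableSet_horizon _).inter measurableSet_Ico)
      (hi.mono_set Set.subset_union_left) (hi.mono_set Set.subset_union_right), gridCost,
      Finset.sum_range_succ, ← gridCost]
    have hs := stepCost_le_setIntegral hp hN hm hφ (τ ω) (n * h) h b hb ω
    by_cases hle : ((n * h : ℝ≥0) : ℝ≥0∞) ≤ τ ω
    · rw [if_pos hle] at ih'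
      rw [Set.indicator_of_mem (show ω ∈ {ω | ((n * h : ℝ≥0) : ℝ≥0∞) ≤ τ ω} from hle)]
      linarith
    · have hempty : horizon (τ ω) ∩ Set.Ico ((n * h : ℝ≥0) : ℝ) ((n * h + h : ℝ≥0) : ℝ) = ∅ := by
        ext t
        simp only [Set.mem_inter_iff, Set.mem_Ico, Set.mem_empty_iff_false, iff_false, not_and]
        intro h1 h2
        refine absurd ?_ hle
        rw [← ENNReal.ofReal_coe_nnreal]
        exact (ENNReal.ofReal_le_ofReal h2).trans h1.2.le
      have hle' : ¬ ((n * h + h : ℝ≥0) : ℝ≥0∞) ≤ τ ω := fun hcon =>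
        hle ((ENNReal.coe_le_coe.2 le_self_add).trans hcon)
      rw [if_neg hle] at ih'
      rw [Set.indicator_of_notMem (show ω ∉ {ω | ((n * h : ℝ≥0) : ℝ≥0∞) ≤ τ ω} from hle), hempty,
        if_neg hle', setIntegral_empty]
      linarith

/-- After time `b` the rate is at least `-lam * bound * e^{-lam t}`, whose tail integral is `-bound
* e^{-lam b}`. The running cost may be infinite, so it is compared with the integrable minorant `F₁
- F₂`. -/
lemma setIntegral_sub_le_runningCost (hp : p.Admissible) (hN : IsCounting N)
    (hm : ∀ t, Measurable (N t)) (hφ : φ ∈ quadrant) (S : ℝ≥0∞) (b : ℝ≥0) (ω : Ω) :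
    (((∫ t in horizon S ∩ Set.Iio (b : ℝ), p.costRate N φ t ω) -
      p.bound * Real.exp (-p.lam * b) : ℝ) : EReal) ≤ p.runningCost N φ S ω := by
  have hlam := hp.lam_pos
  have hbd := bound_pos hp
  let F₁ : ℝ → ℝ := (Set.Iio (b : ℝ)).indicator fun t => p.costRate N φ t ω
  let F₂ : ℝ → ℝ := (Set.Ici (b : ℝ)).indicator fun t =>
    p.lam * p.bound * Real.exp (-p.lam * t)
  have hi₁ : IntegrableOn F₁ (horizon S) := by
    rw [integrableOn_indicator_iff measurableSet_Iio, Set.inter_comm]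
    exact integrableOn_costRate_inter hp hN hm hφ S b ω
  have hi₂' : IntegrableOn (fun t => p.lam * p.bound * Real.exp (-p.lam * t)) (Set.Ici 0) :=
    (integrableOn_exp_neg_Ici hlam).const_mul _
  have hi₂ : IntegrableOn F₂ (horizon S) :=
    (hi₂'.mono_set (horizon_subset_Ici S)).indicator measurableSet_Ici
  have h1 : ∫ t in horizon S, F₂ t ≤ p.bound * Real.exp (-p.lam * b) := by
    rw [setIntegral_indicator measurableSet_Ici]
    have h2 := setIntegral_mono_set (s := horizon S ∩ Set.Ici (b : ℝ)) (t := Set.Ici (b : ℝ))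
      (hi₂'.mono_set (Set.Ici_subset_Ici.2 b.coe_nonneg))
      (ae_of_all _ fun t => by positivity) Set.inter_subset_right.eventuallyLE
    refine h2.trans (le_of_eq ?_)
    rw [integral_const_mul, integral_Ici_eq_integral_Ioi, integral_exp_mul_Ioi (by linarith)]
    field_simp
  calc _ ≤ ((∫ t in horizon S, (F₁ t - F₂ t) : ℝ) : EReal) := by
        rw [EReal.coe_le_coe_iff, integral_sub hi₁ hi₂, setIntegral_indicator measurableSet_Iio]
        linarith
    _ = extIntegral (volume.restrict (horizon S)) fun t => ((F₁ t - F₂ t : ℝ) : EReal) :=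
        (extIntegral_coe (hi₁.sub hi₂)).symm
    _ ≤ _ := by
        refine extIntegral_mono_ae ?_
        filter_upwards [ae_restrict_mem (measurableSet_horizon S)] with t ht
        refine EReal.coe_le_coe_iff.2 ?_
        rcases lt_or_ge t (b : ℝ) with hlt | hge
        · have hn : t ∉ Set.Ici (b : ℝ) := fun hcon => absurd hcon (not_le.2 hlt)
          simp only [F₁, F₂, Set.indicator_of_mem (Set.mem_Iio.2 hlt),
            Set.indicator_of_notMem hn, sub_zero]
          exact le_rfl
        · have hn : t ∉ Set.Iio (b : ℝ) := fun hcon => absurd hcon (not_lt.2 hge)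
          simp only [F₁, F₂, Set.indicator_of_mem (Set.mem_Ici.2 hge),
            Set.indicator_of_notMem hn, zero_sub]
          have h3 := neg_le_g (p := p) (statistic_mem (N := N) hp hφ t.toNNReal ω)
          have h4 := mul_le_mul_of_nonneg_left h3 (Real.exp_pos (-p.lam * t)).le
          linarith

lemma gridCost_sub_le_runningCost (hp : p.Admissible) (hN : IsCounting N)
    (hm : ∀ t, Measurable (N t)) (hφ : φ ∈ quadrant) (τ : Ω → ℝ≥0∞) (h : ℝ≥0) (n : ℕ) (ω : Ω) :
    ((p.gridCost N φ h (fun k => {ω | ((k * h : ℝ≥0) : ℝ≥0∞) ≤ τ ω}) n ω -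
      p.gConst * (2 ^ (N (n * h) ω - N 0 ω) * Real.exp ((p.lam + 1) * (n * h : ℝ≥0)) * size φ) * h -
      p.bound * Real.exp (-p.lam * (n * h : ℝ≥0)) : ℝ) : EReal) ≤
      p.runningCost N φ (τ ω) ω := by
  refine le_trans (EReal.coe_le_coe_iff.2 ?_)
    (setIntegral_sub_le_runningCost hp hN hm hφ (τ ω) (n * h) ω)
  have h1 := gridCost_le_setIntegral hp hN hm hφ τ h (n * h) ω le_rfl
  have h2 : 0 ≤ p.gConst * (2 ^ (N (n * h) ω - N 0 ω) *
      Real.exp ((p.lam + 1) * (n * h : ℝ≥0)) * size φ) * h := by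
    have := gConst_pos hp
    have := size_pos hφ
    positivity
  split_ifs at h1 <;> linarith

/-- The event `τ < t` is a union of events `τ ≤ q` over rationals `q < t`, and the gap between `q`
and `t` removes the right-continuous enlargement. -/
lemma measurableSet_le_stoppingTime {P : Measure Ω} {hm : ∀ t, Measurable (N t)}
    {τ : Ω → ℝ≥0∞} (hτ : IsStoppingTime (history P N hm) τ) (t : ℝ≥0) :
    MeasurableSet[past P N hm t] {ω | (t : ℝ≥0∞) ≤ τ ω} := by
  have he : {ω | (t : ℝ≥0∞) ≤ τ ω}ᶜ =
      ⋃ q : ℚ≥0, ⋃ _ : (q : ℝ≥0) < t, {ω | τ ω ≤ ((q : ℝ≥0) : ℝ≥0∞)} := by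
    ext ω
    simp only [Set.mem_compl_iff, Set.mem_ofPred_eq, not_le, Set.mem_iUnion, exists_prop]
    constructor
    · intro hlt
      obtain ⟨q, hq0, hq1, hq2⟩ := ENNReal.lt_iff_exists_rat_btwn.1 hlt
      lift q to ℚ≥0 using hq0
      have h : (((q : ℚ) : ℝ).toNNReal : ℝ≥0∞) = ((q : ℝ≥0) : ℝ≥0∞) := ofReal_nnratCast q
      rw [h] at hq1 hq2
      exact ⟨q, ENNReal.coe_lt_coe.1 hq2, hq1.le⟩
    · rintro ⟨q, hq1, hq2⟩
      exact hq2.trans_lt (ENNReal.coe_lt_coe.2 hq1)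
  rw [← MeasurableSet.compl_iff, he]
  exact MeasurableSet.iUnion fun q => MeasurableSet.iUnion fun hq =>
    history_le_past hm hq _ (hτ q)

lemma le_extIntegral_runningCost {P : Measure Ω} [IsProbabilityMeasure P] {w : ℝ × ℝ → ℝ}
    (hp : p.Admissible) (hN : IsPoissonProcess N p.mu P) (hw : p.IsFixed w) (hφ : φ ∈ quadrant)
    {τ : Ω → ℝ≥0∞} (hτ : IsStoppingTime (history P N hN.measurable) τ) {h : ℝ≥0} (hh : h ≤ 1)
    (n : ℕ) :
    ((w φ - n * (p.errorConst (n * h) φ * (h : ℝ) ^ 2) -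
      p.gConst * (Real.exp (p.mu * (n * h : ℝ≥0)) * Real.exp ((p.lam + 1) * (n * h : ℝ≥0)) *
        size φ) * h - p.bound * Real.exp (-p.lam * (n * h : ℝ≥0)) : ℝ) : EReal) ≤
      extIntegral P fun ω => p.runningCost N φ (τ ω) ω := by
  let B : ℕ → Set Ω := fun k => {ω | ((k * h : ℝ≥0) : ℝ≥0∞) ≤ τ ω}
  have hB : Antitone B := fun i j hij ω hω =>
    (ENNReal.coe_le_coe.2 (natCast_mul_le hij h)).trans hω
  have hBm : ∀ k : ℕ, MeasurableSet[past P N hN.measurable (k * h)] (B k) :=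
    fun k => measurableSet_le_stoppingTime hτ _
  have h1 := le_integral_gridCost (n := n) hp hN hw hφ hh hB hBm
  have hi1 := integrable_gridCost (h := h) hp hN hφ
    (fun k => (past P N hN.measurable).le _ _ (hBm k)) n
  have hi2 : Integrable (fun ω => p.gConst * (2 ^ (N (n * h) ω - N 0 ω) *
      Real.exp ((p.lam + 1) * (n * h : ℝ≥0)) * size φ) * h) P :=
    ((((integrable_two_pow hN (n * h)).mul_const _).mul_const _).const_mul _).mul_const _
  have hi12 : Integrable (fun ω => p.gridCost N φ h B n ω - p.gConst *
      (2 ^ (N (n * h) ω - N 0 ω) * Real.exp ((p.lam + 1) * (n * h : ℝ≥0)) * size φ) * h) P :=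
    hi1.sub hi2
  have hi3 : Integrable (fun ω => p.gridCost N φ h B n ω - p.gConst *
      (2 ^ (N (n * h) ω - N 0 ω) * Real.exp ((p.lam + 1) * (n * h : ℝ≥0)) * size φ) * h -
        p.bound * Real.exp (-p.lam * (n * h : ℝ≥0))) P := hi12.sub (integrable_const _)
  refine le_trans ?_ (extIntegral_mono_ae (ae_of_all _ fun ω =>
    gridCost_sub_le_runningCost hp hN.isCounting hN.measurable hφ τ h n ω))
  rw [extIntegral_coe hi3, EReal.coe_le_coe_iff,
    integral_sub hi12 (integrable_const _), integral_sub hi1 hi2, integral_mul_const,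
    integral_const_mul, integral_mul_const, integral_mul_const, integral_two_pow hp hN]
  simp only [integral_const, probReal_univ, one_smul]
  linarith

end Lower

/-! ### Upper bound: a nearly optimal stopping rule on the grid. -/

section Upper

variable {p : Params} {φ : ℝ × ℝ} {Ω : Type*} {N : ℝ≥0 → Ω → ℕ}

/-- The time at which the first `n` steps of a grid, charged on the sets `B k`, are over. -/
def gridTime (h : ℝ≥0) (B : ℕ → Set Ω) (n : ℕ) (ω : Ω) : ℝ≥0 :=
  ∑ k ∈ Finset.range n, (B k).indicator (fun _ => h) ω

lemma gridTime_eq {h : ℝ≥0} {B : ℕ → Set Ω} {n : ℕ} {ω : Ω} (hω : ∀ k < n, ω ∈ B k) :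
    gridTime h B n ω = n * h := by
  rw [gridTime, Finset.sum_congr rfl fun k hk =>
    Set.indicator_of_mem (hω k (Finset.mem_range.1 hk)) (fun _ : Ω => h)]
  simp

lemma gridTime_succ (h : ℝ≥0) (B : ℕ → Set Ω) (n : ℕ) (ω : Ω) :
    gridTime h B (n + 1) ω = gridTime h B n ω + (B n).indicator (fun _ => h) ω :=
  Finset.sum_range_succ _ _

variable [MeasurableSpace Ω] {P : Measure Ω}

/-- Whether to run step `k` is decided at its start `k * h`, so the first `m + 1` steps are already
determined at time `m * h`. -/
lemma measurable_gridTime {hm : ∀ t, Measurable (N t)} {h : ℝ≥0} {B : ℕ → Set Ω}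
    (hBm : ∀ k : ℕ, MeasurableSet[past P N hm (k * h)] (B k)) {n m : ℕ} (hnm : n ≤ m + 1) :
    Measurable[past P N hm (m * h)] (gridTime h B n) := by
  refine Finset.measurable_fun_sum _ fun k hk => ?_
  have hk' := Finset.mem_range.1 hk
  exact Measurable.indicator (@measurable_const _ _ _ (past P N hm (m * h)) h)
    ((past P N hm).mono (natCast_mul_le (by omega) h) _ (hBm k))

/-- If `t < n * h`, step `n` cannot affect the event: it runs only on paths whose grid time is
already `n * h > t`. Otherwise all the sets involved are known by time `t`. -/
lemma isStoppingTime_gridTime {hm : ∀ t, Measurable (N t)} {h : ℝ≥0} {B : ℕ → Set Ω}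
    (hB : Antitone B) (hBm : ∀ k : ℕ, MeasurableSet[past P N hm (k * h)] (B k)) (n : ℕ) :
    IsStoppingTime (history P N hm) fun ω => ((gridTime h B n ω : ℝ≥0) : ℝ≥0∞) := by
  intro t
  refine past_le_history hm t _ ?_
  have hset : {ω | ((gridTime h B n ω : ℝ≥0) : ℝ≥0∞) ≤ (t : ℝ≥0∞)} =
      {ω | gridTime h B n ω ≤ t} := by
    ext ω
    exact ENNReal.coe_le_coe
  refine (congrArg (MeasurableSet[past P N hm t]) hset).mpr ?_
  clear hset
  induction n with
  | zero => simp [gridTime]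
  | succ n ih =>
    rcases le_or_gt ((n : ℝ≥0) * h) t with hle | hlt
    · exact (past P N hm).mono hle _ (measurable_gridTime hBm le_rfl measurableSet_Iic)
    · have : {ω | gridTime h B (n + 1) ω ≤ t} = {ω | gridTime h B n ω ≤ t} := by
        ext ω
        simp only [Set.mem_ofPred_eq, gridTime_succ]
        by_cases hω : ω ∈ B n
        · have h1 : gridTime h B n ω = n * h := gridTime_eq fun k hk => hB hk.le hω
          rw [h1]
          exact iff_of_false (not_le.2 (hlt.trans_le le_self_add)) (not_le.2 hlt)
        · rw [Set.indicator_of_notMem hω, add_zero]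
      rw [this]
      exact ih

lemma integral_gridTime (hp : p.Admissible) (hN : IsCounting N) (hm : ∀ t, Measurable (N t))
    (hφ : φ ∈ quadrant) {h : ℝ≥0} {B : ℕ → Set Ω} (hB : Antitone B) (n : ℕ) (ω : Ω) :
    ∫ t in Set.Ico (0 : ℝ) (gridTime h B n ω : ℝ), p.costRate N φ t ω =
      p.gridCost N φ h B n ω := by
  induction n with
  | zero => simp [gridTime, gridCost]
  | succ n ih =>
    rw [gridCost, Finset.sum_range_succ, ← gridCost, gridTime_succ]
    by_cases hω : ω ∈ B n
    · have h1 : gridTime h B n ω = n * h := gridTime_eq fun k hk => hB hk.le hω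
      rw [h1] at ih
      have hi := integrableOn_costRate hp hN hm hφ le_rfl (n * h + h) ω
      have hu : Set.Ico (0 : ℝ) ((n * h + h : ℝ≥0) : ℝ) = Set.Ico (0 : ℝ) ((n * h : ℝ≥0) : ℝ) ∪
          Set.Ico ((n * h : ℝ≥0) : ℝ) ((n * h + h : ℝ≥0) : ℝ) :=
        (Set.Ico_union_Ico_eq_Ico (NNReal.coe_nonneg _)
          (NNReal.coe_le_coe.2 le_self_add)).symm
      rw [hu] at hi
      rw [h1, Set.indicator_of_mem hω, Set.indicator_of_mem hω, hu, setIntegral_union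
        (Set.Ico_disjoint_Ico_same) measurableSet_Ico (hi.mono_set Set.subset_union_left)
        (hi.mono_set Set.subset_union_right), ih, stepCost]
    · rw [Set.indicator_of_notMem hω, Set.indicator_of_notMem hω, add_zero, add_zero, ih]

lemma runningCost_gridTime (hp : p.Admissible) (hN : IsCounting N) (hm : ∀ t, Measurable (N t))
    (hφ : φ ∈ quadrant) {h : ℝ≥0} {B : ℕ → Set Ω} (hB : Antitone B) (n : ℕ) (ω : Ω) :
    p.runningCost N φ (gridTime h B n ω) ω = ((p.gridCost N φ h B n ω : ℝ) : EReal) := by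
  have h1 : horizon (gridTime h B n ω) = Set.Ico (0 : ℝ) (gridTime h B n ω : ℝ) := by
    rw [← ENNReal.ofReal_coe_nnreal, horizon_ofReal]
  have hi := integrableOn_costRate hp hN hm hφ le_rfl (gridTime h B n ω) ω
  rw [← integral_gridTime hp hN hm hφ hB, ← extIntegral_coe hi, ← h1]
  rfl

lemma value_le_of_grid [IsProbabilityMeasure P] {w : ℝ × ℝ → ℝ} (hp : p.Admissible)
    (hN : IsPoissonProcess N p.mu P) (hw : p.IsFixed w) (hφ : φ ∈ quadrant) {h : ℝ≥0}
    (hh : h ≤ 1) (n : ℕ) : p.value N P hN.measurable φ ≤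
      ((w φ + n * (p.errorConst (n * h) φ * (h : ℝ) ^ 2) + (p.lam + p.mu) * p.bound * h +
        p.bound * Real.exp (-p.lam * (n * h : ℝ≥0)) : ℝ) : EReal) := by
  have hB := antitone_continueSet (p := p) (w := w) (N := N) (φ := φ) h
    ((p.lam + p.mu) * p.bound * h)
  have hBm := measurableSet_continueSet (φ := φ) hN hw.measurable h
    ((p.lam + p.mu) * p.bound * h)
  refine (iInf₂_le _ (isStoppingTime_gridTime hB hBm n)).trans ?_
  simp only [runningCost_gridTime hp hN.isCounting hN.measurable hφ hB]
  rw [extIntegral_coe (integrable_gridCost hp hN hφ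
    (fun k => (past P N hN.measurable).le _ _ (hBm k)) n)]
  exact EReal.coe_le_coe_iff.2 (integral_gridCost_le hp hN hw hφ hh n)

end Upper

/-! ### Passage to the limit in the mesh and in the time span. -/

section Main

variable {p : Params} {φ : ℝ × ℝ} {Ω : Type*} {N : ℝ≥0 → Ω → ℕ} [MeasurableSpace Ω]
  {P : Measure Ω} [IsProbabilityMeasure P]

lemma tendsto_bound_mul_exp (hp : p.Admissible) :
    Tendsto (fun j : ℕ => p.bound * Real.exp (-p.lam * j)) atTop (𝓝 0) := by
  have h := (Real.tendsto_exp_neg_atTop_nhds_zero.comp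
    (tendsto_natCast_atTop_atTop.const_mul_atTop hp.lam_pos)).const_mul p.bound
  rw [mul_zero] at h
  refine h.congr fun j => ?_
  simp

/-- The mesh `1 / (m + 1)`. -/
def mesh (m : ℕ) : ℝ≥0 := 1 / (m + 1)

lemma mesh_le_one (m : ℕ) : mesh m ≤ 1 := by
  unfold mesh
  exact div_le_one_of_le₀ (by simp) zero_le

lemma natCast_mul_mesh (j m : ℕ) : (((m + 1) * j : ℕ) : ℝ≥0) * mesh m = j := by
  have : (m : ℝ≥0) + 1 ≠ 0 := by positivity
  unfold mesh
  push_cast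
  field_simp

lemma tendsto_mesh : Tendsto (fun m => (mesh m : ℝ)) atTop (𝓝 0) := by
  have h := tendsto_one_div_add_atTop_nhds_zero_nat (𝕜 := ℝ)
  refine h.congr fun m => ?_
  simp [mesh]

/-- Filling the span `j` takes `(m + 1) * j` steps of error `K * mesh²`, in total `j * K * mesh`. -/
lemma natCast_mul_error_mesh (j m : ℕ) (K : ℝ) :
    (((m + 1) * j : ℕ) : ℝ) * (K * (mesh m : ℝ) ^ 2) = j * K * mesh m := by
  have h : (((m + 1) * j : ℕ) : ℝ) * (mesh m : ℝ) = j := by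
    exact_mod_cast congrArg NNReal.toReal (natCast_mul_mesh j m)
  linear_combination K * mesh m * h

/-- The value function is the limit of the successive approximations. -/
lemma value_eq_limitValue (hp : p.Admissible) (hN : IsPoissonProcess N p.mu P)
    (hφ : φ ∈ quadrant) :
    p.value N P hN.measurable φ = ((p.limitValue φ : ℝ) : EReal) := by
  have hw := isFixed_limitValue hp
  have hcast : ∀ j m : ℕ, (((((m + 1) * j : ℕ) : ℝ≥0) * mesh m : ℝ≥0) : ℝ) = j := fun j m => by
    rw [natCast_mul_mesh, NNReal.coe_natCast]
  have hcast' : ∀ j m : ℕ, (((m + 1) * j : ℕ) : ℝ) * (mesh m : ℝ) = j := fun j m => by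
    rw [← hcast j m, NNReal.coe_mul, NNReal.coe_natCast]
  refine le_antisymm ?_ (le_iInf₂ fun τ hτ => ?_)
  -- The error constants grow exponentially in the span `j`, so `m → ∞` is taken at fixed `j`; only
  -- then `j → ∞`.
  · have h1 : ∀ j m : ℕ, p.value N P hN.measurable φ ≤ ((p.limitValue φ +
        (j * p.errorConst j φ + (p.lam + p.mu) * p.bound) * mesh m +
          p.bound * Real.exp (-p.lam * j) : ℝ) : EReal) := by
      intro j m
      refine (value_le_of_grid hp hN hw hφ (mesh_le_one m) ((m + 1) * j)).trans (le_of_eq ?_)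
      rw [hcast, hcast', natCast_mul_error_mesh]
      ring_nf
    have h2 : ∀ j : ℕ, p.value N P hN.measurable φ ≤
        ((p.limitValue φ + p.bound * Real.exp (-p.lam * j) : ℝ) : EReal) := by
      intro j
      have ht : Tendsto (fun m : ℕ => p.limitValue φ + (j * p.errorConst j φ +
          (p.lam + p.mu) * p.bound) * mesh m + p.bound * Real.exp (-p.lam * j)) atTop
          (𝓝 (p.limitValue φ + p.bound * Real.exp (-p.lam * j))) := by
        simpa using ((tendsto_mesh.const_mul (j * p.errorConst j φ +
          (p.lam + p.mu) * p.bound)).const_add (p.limitValue φ)).add_const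
            (p.bound * Real.exp (-p.lam * j))
      exact ge_of_tendsto' (EReal.tendsto_coe.2 ht) (h1 j)
    have ht : Tendsto (fun j : ℕ => p.limitValue φ + p.bound * Real.exp (-p.lam * j)) atTop
        (𝓝 (p.limitValue φ)) := by
      simpa using (tendsto_bound_mul_exp hp).const_add (p.limitValue φ)
    exact ge_of_tendsto' (EReal.tendsto_coe.2 ht) h2
  · have h1 : ∀ j m : ℕ, ((p.limitValue φ - (j * p.errorConst j φ + p.gConst *
        (Real.exp (p.mu * j) * Real.exp ((p.lam + 1) * j) * size φ)) * mesh m -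
          p.bound * Real.exp (-p.lam * j) : ℝ) : EReal) ≤
        extIntegral P fun ω => p.runningCost N φ (τ ω) ω := by
      intro j m
      refine (le_of_eq ?_).trans
        (le_extIntegral_runningCost hp hN hw hφ hτ (mesh_le_one m) ((m + 1) * j))
      rw [hcast, hcast', natCast_mul_error_mesh]
      ring_nf
    have h2 : ∀ j : ℕ, ((p.limitValue φ - p.bound * Real.exp (-p.lam * j) : ℝ) : EReal) ≤
        extIntegral P fun ω => p.runningCost N φ (τ ω) ω := by
      intro j
      have ht : Tendsto (fun m : ℕ => p.limitValue φ - (j * p.errorConst j φ + p.gConst *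
          (Real.exp (p.mu * j) * Real.exp ((p.lam + 1) * j) * size φ)) * mesh m -
            p.bound * Real.exp (-p.lam * j)) atTop
          (𝓝 (p.limitValue φ - p.bound * Real.exp (-p.lam * j))) := by
        simpa using ((tendsto_mesh.const_mul (j * p.errorConst j φ + p.gConst *
          (Real.exp (p.mu * j) * Real.exp ((p.lam + 1) * j) * size φ))).const_sub
            (p.limitValue φ)).sub_const (p.bound * Real.exp (-p.lam * j))
      exact le_of_tendsto' (EReal.tendsto_coe.2 ht) (h1 j)
    have ht : Tendsto (fun j : ℕ => p.limitValue φ - p.bound * Real.exp (-p.lam * j)) atTop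
        (𝓝 (p.limitValue φ)) := by
      simpa using (tendsto_bound_mul_exp hp).const_sub (p.limitValue φ)
    exact le_of_tendsto' (EReal.tendsto_coe.2 ht) h2

end Main

end Params

end PoissonDisorder

end

/-! ### Convergence, bounds, fixed-point equation and maximality. -/

theorem proposition5p6 {Ω : Type*} [MeasurableSpace Ω] (P : Measure Ω) [IsProbabilityMeasure P]
    (p : PoissonDisorder.Params) (hlam : 0 < p.lam) (hmu : 1 < p.mu) (hc : 0 < p.c)
    (hm : -1 < p.m) (hm' : p.m < 1)
    (N : ℝ≥0 → Ω → ℕ) (hN : PoissonDisorder.IsPoissonProcess N p.mu P) :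
    (∀ φ ∈ PoissonDisorder.quadrant,
      Tendsto (fun n => p.v N P n φ) atTop (𝓝 (p.value N P hN.measurable φ))) ∧
    (∀ φ ∈ PoissonDisorder.quadrant,
      ((-(√2 / p.c) : ℝ) : EReal) ≤ p.value N P hN.measurable φ) ∧
    p.IsNonposSolution N P (p.value N P hN.measurable) ∧
    ∀ U : ℝ × ℝ → EReal, p.IsNonposSolution N P U →
      ∀ φ ∈ PoissonDisorder.quadrant, U φ ≤ p.value N P hN.measurable φ := by
  have hp : p.Admissible := ⟨hlam, hmu, hc, hm, hm'⟩
  have hw := PoissonDisorder.Params.isFixed_limitValue hp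
  have hV : ∀ φ ∈ PoissonDisorder.quadrant, p.value N P hN.measurable φ =
      ((p.limitValue φ : ℝ) : EReal) :=
    fun φ hφ => PoissonDisorder.Params.value_eq_limitValue hp hN hφ
  have hlim : ∀ φ ∈ PoissonDisorder.quadrant,
      Tendsto (fun n => p.v N P n φ) atTop (𝓝 (p.value N P hN.measurable φ)) := by
    intro φ hφ
    rw [hV φ hφ]
    simp only [PoissonDisorder.Params.v_eq_approx hp hN _ φ hφ]
    exact EReal.tendsto_coe.2 (PoissonDisorder.Params.tendsto_approx hp hφ)
  refine ⟨hlim, fun φ hφ => ?_, ⟨?_, fun φ hφ => ?_, fun φ hφ => ?_⟩, fun U hU φ hφ => ?_⟩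
  · rw [hV φ hφ]
    exact EReal.coe_le_coe_iff.2 (hw.neg_bound_le φ hφ)
  · have : (fun φ : PoissonDisorder.quadrant => p.value N P hN.measurable φ) =
        fun φ : PoissonDisorder.quadrant => ((p.limitValue φ : ℝ) : EReal) :=
      funext fun φ => hV φ φ.2
    rw [this]
    exact (hw.measurable.comp measurable_subtype_coe).coe_real_ereal
  · rw [hV φ hφ]
    exact EReal.coe_nonpos.2 (hw.nonpos φ hφ)
  · rw [PoissonDisorder.Params.J₀_eq_opInf hp hN hw.toIsCandidate hV hφ, hV φ hφ,
      hw.eq_opInf φ hφ]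
  · exact ge_of_tendsto' (hlim φ hφ) fun n =>
      PoissonDisorder.Params.le_v_of_isNonposSolution hp hU n φ hφ
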